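/- Let $\delta$ be an infinite cardinal. Throughout, "definable" means first-order definable with parameters in $\langle V_\delta,\in\rangle$. The following are equivalent. 1. $\delta$ is a Vopěnka-scheme cardinal, i.e. $V_\delta$ satisfies ZFC together with the Vopěnka scheme: for every first-order language $\mathcal L\in V_\delta$ and every definable class $\mathcal M\subseteq V_\delta$ of $\mathcal L$-structures with $\mathcal M\notin V_\delta$, there are distinct $M,N\in\mathcal M$ and an elementary embedding $j:M\to N$ in $V_\delta$. 2. For every definable $A\subseteq V_\delta$ and all sufficiently large $\lambda<\delta$, there is an ordinal $\theta$ with $\lambda<\theta<\delta$ and an elementary embedding $j:\langle V_\lambda,\in,A\cap V_\lambda\rangle\to\langle V_\theta,\in,A\cap V_\theta\rangle$. 3. For every definable $A\subseteq V_\delta$, there is a $({<}\delta,A)$-extendible cardinal, that is, a cardinal $\kappa<\delta$ such that for every ordinal $\lambda$ with $\kappa<\lambda<\delta$ there are an ordinal $\theta<\delta$ and an elementary embedding $j:\langle V_\lambda,\in,A\cap V_\lambda\rangle\to\langle V_\theta,\in,A\cap V_\theta\rangle$ with critical point $\kappa$ and $\lambda<j(\kappa)$. 4. For every definable $A\subseteq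 V_\delta$, the set of $({<}\delta,A)$-extendible cardinals is definably stationary in $\delta$, i.e. it meets every definable closed unbounded subset of $\delta$. -/

import Mathlib

universe u

noncomputable section

namespace VopenkaScheme

open FirstOrder FirstOrder.Language ZFSet

/-! ### The language of set theory and ZFC -/

/-- The only symbol of the language of set theory is the binary relation symbol `∈`. -/
inductive SetRel : ℕ → Type
  | mem : SetRel 2

/-- The first-order language `{∈}` of set theory. -/
def setLang : Language := ⟨fun _ => Empty, SetRel⟩

/-- The symbol `∈`. -/
abbrev memSymb : setLang.Relations 2 := SetRel.mem

/-- The atomic formula `s ∈ t`. -/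
def memF {α : Type} {n : ℕ} (s t : setLang.Term (α ⊕ Fin n)) : setLang.BoundedFormula α n :=
  Relations.boundedFormula₂ memSymb s t

/-- The universal closure of a formula with free variables (parameters) indexed by `Fin n`. -/
def closure {n : ℕ} (φ : setLang.Formula (Fin n)) : setLang.Sentence :=
  Formula.iAlls (Fin n) (φ.relabel Sum.inr : setLang.Formula (Empty ⊕ Fin n))

/-- Let `φ` be a formula with parameter variables `Fin n` and `k` further free variables.
`plug φ v` is `φ` with its `i`-th further variable replaced by the bound variable `v i`. -/
def plug {n k m : ℕ} (φ : setLang.Formula (Fin n ⊕ Fin k)) (v : Fin k → Fin m) :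
    setLang.BoundedFormula (Fin n) m :=
  BoundedFormula.relabel (Sum.map id v : Fin n ⊕ Fin k → Fin n ⊕ Fin m) φ

/-- `∀ x y, (∀ z, z ∈ x ↔ z ∈ y) → x = y` -/
def extensionality : setLang.Sentence :=
  ∀' ∀' ((∀' (memF (&2) (&0) ⇔ memF (&2) (&1))) ⟹ (&0 =' &1))

/-- `∀ x, (∃ y, y ∈ x) → ∃ y, y ∈ x ∧ ∀ z, ¬ (z ∈ x ∧ z ∈ y)` -/
def foundation : setLang.Sentence :=
  ∀' ((∃' memF (&1) (&0)) ⟹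
    ∃' (memF (&1) (&0) ⊓ ∀' ∼(memF (&2) (&0) ⊓ memF (&2) (&1))))

/-- `∀ x y, ∃ p, ∀ z, z ∈ p ↔ z = x ∨ z = y` -/
def pairing : setLang.Sentence :=
  ∀' ∀' ∃' ∀' (memF (&3) (&2) ⇔ ((&3 =' &0) ⊔ (&3 =' &1)))

/-- `∀ x, ∃ b, ∀ z, z ∈ b ↔ ∃ y, y ∈ x ∧ z ∈ y` -/
def union : setLang.Sentence :=
  ∀' ∃' ∀' (memF (&2) (&1) ⇔ ∃' (memF (&3) (&0) ⊓ memF (&2) (&3)))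

/-- `∀ x, ∃ p, ∀ z, z ∈ p ↔ ∀ y, y ∈ z → y ∈ x` -/
def powerSet : setLang.Sentence :=
  ∀' ∃' ∀' (memF (&2) (&1) ⇔ ∀' (memF (&3) (&2) ⟹ memF (&3) (&0)))

/-- `∃ w, (∃ e, e ∈ w ∧ ∀ z, z ∉ e) ∧ ∀ x, x ∈ w → ∃ y, y ∈ w ∧ ∀ z, z ∈ y ↔ z ∈ x ∨ z = x` -/
def infinity : setLang.Sentence :=
  ∃' ((∃' (memF (&1) (&0) ⊓ ∀' ∼(memF (&2) (&1)))) ⊓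
    ∀' (memF (&1) (&0) ⟹
      ∃' (memF (&2) (&0) ⊓ ∀' (memF (&3) (&2) ⇔ (memF (&3) (&1) ⊔ (&3 =' &1))))))

/-- Every set `a` of nonempty pairwise disjoint sets has a transversal `c`:
`∀ a, (∀ x, x ∈ a → ∃ y, y ∈ x) →
(∀ x x' y, x ∈ a → x' ∈ a → y ∈ x → y ∈ x' → x = x') →
∃ c, ∀ x, x ∈ a → ∃ y, ∀ z, (z ∈ x ∧ z ∈ c) ↔ z = y` -/
def choice : setLang.Sentence :=
  ∀' ((∀' (memF (&1) (&0) ⟹ ∃' memF (&2) (&1))) ⟹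
    (∀' ∀' ∀' (memF (&1) (&0) ⟹ memF (&2) (&0) ⟹ memF (&3) (&1) ⟹ memF (&3) (&2) ⟹
      (&1 =' &2))) ⟹
    ∃' ∀' (memF (&2) (&0) ⟹
      ∃' ∀' ((memF (&4) (&2) ⊓ memF (&4) (&1)) ⇔ (&4 =' &3))))

/-- The instance of separation for `φ(p, x)`:
`∀ p a, ∃ b, ∀ x, x ∈ b ↔ x ∈ a ∧ φ(p, x)` -/
def separation {n : ℕ} (φ : setLang.Formula (Fin n ⊕ Fin 1)) : setLang.Sentence :=
  closure (∀' ∃' ∀' (memF (&2) (&1) ⇔ (memF (&2) (&0) ⊓ plug φ ![2])))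

/-- The instance of replacement for `φ(p, x, y)`:
`∀ p a, (∀ x, x ∈ a → ∀ y y', φ(p, x, y) → φ(p, x, y') → y = y') →
∃ b, ∀ y, y ∈ b ↔ ∃ x, x ∈ a ∧ φ(p, x, y)` -/
def replacement {n : ℕ} (φ : setLang.Formula (Fin n ⊕ Fin 2)) : setLang.Sentence :=
  closure (∀' ((∀' (memF (&1) (&0) ⟹
      ∀' ∀' (plug φ ![1, 2] ⟹ plug φ ![1, 3] ⟹ (&2 =' &3)))) ⟹
    ∃' ∀' (memF (&2) (&1) ⇔ ∃' (memF (&3) (&0) ⊓ plug φ ![3, 2]))))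

/-- Zermelo-Fraenkel set theory with the axiom of choice, as a first-order theory. -/
def ZFC : setLang.Theory :=
  {extensionality, foundation, pairing, union, powerSet, infinity, choice} ∪
    {σ | ∃ (n : ℕ) (φ : setLang.Formula (Fin n ⊕ Fin 1)), σ = separation φ} ∪
    {σ | ∃ (n : ℕ) (φ : setLang.Formula (Fin n ⊕ Fin 2)), σ = replacement φ}

/-! ### The structures `⟨V_α, ∈⟩` and `⟨V_α, ∈, A ∩ V_α⟩` -/

/-- The underlying set of the structure `⟨V_α, ∈⟩`. -/
def VModel (α : Ordinal.{u}) : Type (u + 1) := {x : ZFSet.{u} // x ∈ V_ α}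

instance (α : Ordinal.{u}) : setLang.Structure (VModel α) where
  funMap f := f.elim
  RelMap | .mem => fun x => (x 0).1 ∈ (x 1).1

/-- `A` is a subset of `V_δ` that is first-order definable, with parameters, in `⟨V_δ, ∈⟩`. -/
def DefinableIn (δ : Ordinal.{u}) (A : Set ZFSet.{u}) : Prop :=
  (∀ x ∈ A, x ∈ V_ δ) ∧
    (Set.univ : Set (VModel δ)).Definable₁ setLang {x : VModel δ | x.1 ∈ A}

/-- The symbols `∈` (binary) and a unary predicate. -/
inductive SetPredRel : ℕ → Type
  | mem : SetPredRel 2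
  | pred : SetPredRel 1

/-- The language of set theory with one additional unary predicate. -/
def setPredLang : Language := ⟨fun _ => Empty, SetPredRel⟩

/-- The underlying set of the structure `⟨V_α, ∈, A ∩ V_α⟩`. -/
def VPred (_A : Set ZFSet.{u}) (α : Ordinal.{u}) : Type (u + 1) := {x : ZFSet.{u} // x ∈ V_ α}

instance (A : Set ZFSet.{u}) (α : Ordinal.{u}) : setPredLang.Structure (VPred A α) where
  funMap f := f.elim
  RelMap
    | .mem => fun x => (x 0).1 ∈ (x 1).1
    | .pred => fun x => (x 0).1 ∈ A

/-- The ordinal `β < α` as an element of `V_α`. -/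
def ordElem (A : Set ZFSet.{u}) {α β : Ordinal.{u}} (h : β < α) : VPred A α :=
  ⟨β.toZFSet, by rw [mem_vonNeumann, Ordinal.rank_toZFSet]; exact h⟩

/-- `κ < α` is the critical point of `j : V_α → V_β`, the least ordinal moved by `j`. -/
def HasCriticalPoint {A : Set ZFSet.{u}} {α β : Ordinal.{u}}
    (j : VPred A α ↪ₑ[setPredLang] VPred A β) {κ : Ordinal.{u}} (hκ : κ < α) : Prop :=
  (j (ordElem A hκ)).1 ≠ κ.toZFSet ∧
    ∀ (ξ : Ordinal.{u}) (hξ : ξ < κ), (j (ordElem A (hξ.trans hκ))).1 = ξ.toZFSet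

/-- `κ` is a `(<δ, A)`-extendible cardinal: `κ < δ` is a cardinal, and for every `α` with
`κ < α < δ` there are `θ < δ` and an elementary embedding
`j : ⟨V_α, ∈, A ∩ V_α⟩ → ⟨V_θ, ∈, A ∩ V_θ⟩` with critical point `κ` and `α < j(κ)`. -/
def IsExtendibleBelow (δ : Ordinal.{u}) (A : Set ZFSet.{u}) (κ : Ordinal.{u}) : Prop :=
  κ < δ ∧ κ.IsInitial ∧ ∀ (α : Ordinal.{u}) (hα : κ < α), α < δ →
    ∃ θ < δ, ∃ j : VPred A α ↪ₑ[setPredLang] VPred A θ,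
      HasCriticalPoint j hα ∧ α.toZFSet ∈ (j (ordElem A hα)).1

/-- `S` is a definably stationary set of ordinals below `δ`: it meets every closed unbounded
subset of `δ` that is definable, with parameters, in `⟨V_δ, ∈⟩`. -/
def DefinablyStationary (δ : Ordinal.{u}) (S : Set Ordinal.{u}) : Prop :=
  ∀ C : Set (Set.Iio δ), IsClub C →
    DefinableIn δ ((fun α : Set.Iio δ => α.1.toZFSet) '' C) → ∃ α ∈ C, α.1 ∈ S

/-! ### First-order structures as sets, and the Vopěnka scheme in `V_δ` -/

/-- The symbol `s` of arity `n`, coded as the ordered pair `⟨s, n⟩`. -/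
def symb (s : ZFSet.{u}) (n : ℕ) : ZFSet.{u} := pair s (n : Ordinal.{u}).toZFSet

/-- The first-order language coded by two sets `F` and `R`: its `n`-ary function symbols
(constants for `n = 0`) are the `s` with `⟨s, n⟩ ∈ F` and its `n`-ary relation symbols are the
`s` with `⟨s, n⟩ ∈ R`. -/
def codedLang (F R : ZFSet.{u}) : FirstOrder.Language.{u + 1, u + 1} :=
  ⟨fun n => {s : ZFSet.{u} // symb s n ∈ F}, fun n => {s : ZFSet.{u} // symb s n ∈ R}⟩

/-- A finite sequence of length `n`, as a set of ordered pairs. -/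
def tuple {D : ZFSet.{u}} {n : ℕ} (x : Fin n → D) : ZFSet.{u} :=
  ZFSet.range fun i : Fin n => pair ((i : ℕ) : Ordinal.{u}).toZFSet (x i).1

/-- A set-sized first-order structure for the language coded by `F` and `R`. The interpretations
of all function symbols are collected in the set `funs` of all `⟨⟨s, n⟩, ⟨x, y⟩⟩` such that the
interpretation of `s` maps the `n`-tuple `x` to `y`, those of the relation symbols in the set
`rels` of all `⟨⟨s, n⟩, x⟩` such that the relation `s` holds at the `n`-tuple `x`. -/
structure CodedStructure (F R : ZFSet.{u}) where
  carrier : ZFSet.{u}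
  funs : ZFSet.{u}
  rels : ZFSet.{u}
  nonempty : carrier.Nonempty
  mem_funs : ∀ z ∈ funs, ∃ (n : ℕ) (s : ZFSet.{u}) (x : Fin n → carrier) (y : carrier),
    symb s n ∈ F ∧ z = pair (symb s n) (pair (tuple x) y.1)
  existsUnique_funs : ∀ (n : ℕ) (s : ZFSet.{u}), symb s n ∈ F → ∀ x : Fin n → carrier,
    ∃! y : carrier, pair (symb s n) (pair (tuple x) y.1) ∈ funs
  mem_rels : ∀ z ∈ rels, ∃ (n : ℕ) (s : ZFSet.{u}) (x : Fin n → carrier),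
    symb s n ∈ R ∧ z = pair (symb s n) (tuple x)

/-- The set `⟨D, ⟨funs, rels⟩⟩` that is the structure. -/
def CodedStructure.code {F R : ZFSet.{u}} (M : CodedStructure F R) : ZFSet.{u} :=
  pair M.carrier (pair M.funs M.rels)

/-- The underlying set of a coded structure. -/
def CodedStructure.Carrier {F R : ZFSet.{u}} (M : CodedStructure F R) : Type (u + 1) :=
  {x : ZFSet.{u} // x ∈ M.carrier}

instance {F R : ZFSet.{u}} (M : CodedStructure F R) : (codedLang F R).Structure M.Carrier where
  funMap {n} f x := (M.existsUnique_funs n f.1 f.2 x).choose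
  RelMap {n} r x := pair (symb r.1 n) (tuple (D := M.carrier) x) ∈ M.rels

/-- The graph of a map between coded structures, as a set. -/
def graph {F R : ZFSet.{u}} {M N : CodedStructure F R} (j : M.Carrier → N.Carrier) : ZFSet.{u} :=
  ZFSet.range fun x : M.carrier => pair x.1 (j x).1

/-- `V_δ` satisfies the Vopěnka scheme: for every language that is an element of `V_δ` and every
class `𝓜` of structures for it such that `𝓜` is definable (with parameters) in `⟨V_δ, ∈⟩` and
is a proper class from the point of view of `V_δ`, there are in `V_δ` distinct `M, N ∈ 𝓜` and an
elementary embedding `j : M → N`. -/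
def SatisfiesVopenkaScheme (δ : Ordinal.{u}) : Prop :=
  ∀ F ∈ V_ δ, ∀ R ∈ V_ δ, ∀ 𝓜 : Set ZFSet.{u}, DefinableIn δ 𝓜 →
    (∀ m ∈ 𝓜, ∃ M : CodedStructure F R, M.code = m) →
    (¬ ∃ a ∈ V_ δ, ∀ m, m ∈ a ↔ m ∈ 𝓜) →
    ∃ M N : CodedStructure F R, M.code ∈ 𝓜 ∧ N.code ∈ 𝓜 ∧ M.code ≠ N.code ∧
      ∃ j : M.Carrier ↪ₑ[codedLang F R] N.Carrier, graph j ∈ V_ δ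

/-- `δ` is a Vopěnka-scheme cardinal: `V_δ` satisfies ZFC and the Vopěnka scheme. -/
def IsVopenkaSchemeCardinal (δ : Cardinal.{u}) : Prop :=
  (VModel δ.ord ⊨ ZFC) ∧ SatisfiesVopenkaScheme δ.ord

end VopenkaScheme

end

/-! All elementarity is traded for one definable predicate. An elementary embedding of ⟨V_γ, ∈, B⟩
into some ⟨V_θ, ∈, B⟩, with γ a limit, induces a map J that fixes ∅, commutes with pairs and
respects B; `BMap` keeps only this. Finitely many definable relations and functions can be packed
into B by tagging. `Base` packs in particular Tarski's clauses, as relations between satisfaction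
sets. A map respecting `Base` therefore carries satisfaction sets of a structure in V_γ to those of
its image, and restricts to an elementary embedding of any such structure whose symbols it fixes
(`BMap.exists_elementaryEmbedding`). Conversely, a map that is a set of V_δ is a first-order object
(`EMap`), so the existence of maps respecting B is definable.

The other main tool is Kunen's inconsistency in the form `BMap.eq_self`: if J fixes V_{β+ω} and is
defined on V_{β+ω+ω}, it is the identity on V_{β+ω}. The proof uses an ω-Jónsson function on
V_{β+ω}. Consequently every ordinal above the critical point is moved, as long as there is room
above it (`BMap.ord_ne`).

1 → 2: if arbitrarily large α were not moved up by any map respecting B on V_{α+ω+ω}, the Vopěnka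
scheme applied to the structures ⟨V_{α+ω+ω}, ∈, B, {α}⟩ for these α would give a map moving one of
them to a larger one.

2 → 3: for a definable unbounded class K of limit ordinals, the embedding of V_y for consecutive x <
y in K must move x (`HasEmbeddings.exists_move`). Applied to suitable K, this shows that definable
functions are bounded on sets and have unboundedly many closure points. If no κ were extendible, let
F(κ) be the least height at which κ fails, and take K to be the class of closure points of F. The
critical point κ of the resulting map is again a closure point, hence so is J(κ), and J restricted
to V_{F(κ)} is a witness that should not exist (`HasEmbeddings.exists_ext`).

3 → 1: adding a parameter to the predicate pushes critical points above any given ordinal.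
Replacement and the Vopěnka scheme follow because J moves everything of rank at least κ in its
domain out of its domain. 3 → 4: if κ missed the club C, the next point of C after some b < κ would
be definable from b and thus fixed, although it is above κ. 4 → 3 uses the club of all ordinals
below δ.

The calculations need δ to be closed under addition and greater than ω; the case δ = ω is excluded
separately. -/

noncomputable section
set_option synthInstance.maxHeartbeats 400000
set_option synthInstance.maxSize 2000
namespace VopenkaScheme

open FirstOrder FirstOrder.Language ZFSet

/-! ### Definability with parameters in V_δ, closed under the logical operations -/

section

/-- An additively principal ordinal above `ω`. -/
class Nice (δ : Ordinal.{u}) : Prop where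
  omega_lt : Ordinal.omega0 < δ
  add_lt : ∀ a < δ, ∀ b < δ, a + b < δ

variable {δ : Ordinal.{u}}

instance : Membership (VModel δ) (VModel δ) := ⟨fun y x => x.1 ∈ y.1⟩

theorem VModel.mem_def {x y : VModel δ} : x ∈ y ↔ x.1 ∈ y.1 := Iff.rfl

/-- Definability with parameters in `⟨V_δ, ∈⟩` of a relation. -/
class Dfn {α : Type} (P : (α → VModel δ) → Prop) : Prop where
  out : (Set.univ : Set (VModel δ)).Definable setLang {v | P v}

/-- Definability with parameters in `⟨V_δ, ∈⟩` of a function. -/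
class DFun {α : Type} (f : (α → VModel δ) → VModel δ) : Prop where
  out : (Set.univ : Set (VModel δ)).DefinableFun setLang f

section calculus

variable {α : Type}

instance DFun.proj (i : α) : DFun (fun v : α → VModel δ => v i) :=
  ⟨Set.DefinableFun.proj _⟩

instance DFun.const (a : VModel δ) : DFun (fun _ : α → VModel δ => a) :=
  ⟨setLang.definableFun_const α (Set.mem_univ a)⟩

theorem Dfn.subst {β : Type} [Finite β] {P : (β → VModel δ) → Prop} (hP : Dfn P)
    {F : β → (α → VModel δ) → VModel δ} (hF : ∀ i, DFun (F i)) :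
    Dfn (fun v => P (fun i => F i v)) :=
  ⟨Set.Definable.preimage_map (F := fun v i => F i v) (fun i => (hF i).out) hP.out⟩

theorem Dfn.subst₁ {P : VModel δ → Prop} (hP : Dfn (fun v : Fin 1 → VModel δ => P (v 0)))
    (f : (α → VModel δ) → VModel δ) [hf : DFun f] : Dfn (fun v => P (f v)) :=
  hP.subst (F := ![f]) (by intro i; fin_cases i; exact hf)

theorem Dfn.subst₂ {P : VModel δ → VModel δ → Prop}
    (hP : Dfn (fun v : Fin 2 → VModel δ => P (v 0) (v 1)))
    (f g : (α → VModel δ) → VModel δ) [hf : DFun f] [hg : DFun g] :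
    Dfn (fun v => P (f v) (g v)) :=
  hP.subst (F := ![f, g]) (by intro i; fin_cases i; exacts [hf, hg])

theorem Dfn.subst₃ {P : VModel δ → VModel δ → VModel δ → Prop}
    (hP : Dfn (fun v : Fin 3 → VModel δ => P (v 0) (v 1) (v 2)))
    (f g h : (α → VModel δ) → VModel δ) [hf : DFun f] [hg : DFun g] [hh : DFun h] :
    Dfn (fun v => P (f v) (g v) (h v)) :=
  hP.subst (F := ![f, g, h]) (by intro i; fin_cases i; exacts [hf, hg, hh])

instance Dfn.eq (f g : (α → VModel δ) → VModel δ) [hf : DFun f] [hg : DFun g] :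
    Dfn (fun v => f v = g v) := ⟨hf.out.ofPred_eq hg.out⟩

instance Dfn.mem (f g : (α → VModel δ) → VModel δ) [hf : DFun f] [hg : DFun g] :
    Dfn (fun v => f v ∈ g v) := by
  refine Dfn.subst₂ (P := fun x y => x ∈ y) ⟨?_⟩ f g
  refine Set.Definable.mono (Set.empty_definable_iff.2
    ⟨Relations.formula₂ memSymb (Term.var 0) (Term.var 1), ?_⟩) (Set.empty_subset _)
  ext v
  simp only [Set.mem_ofPred_eq, Formula.realize_rel₂]
  rfl

instance Dfn.and (P Q : (α → VModel δ) → Prop) [hP : Dfn P] [hQ : Dfn Q] :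
    Dfn (fun v => P v ∧ Q v) := ⟨hP.out.inter hQ.out⟩

instance Dfn.or (P Q : (α → VModel δ) → Prop) [hP : Dfn P] [hQ : Dfn Q] :
    Dfn (fun v => P v ∨ Q v) := ⟨hP.out.union hQ.out⟩

instance Dfn.not (P : (α → VModel δ) → Prop) [hP : Dfn P] :
    Dfn (fun v => ¬ P v) := ⟨hP.out.compl⟩

instance Dfn.ne (f g : (α → VModel δ) → VModel δ) [hf : DFun f] [hg : DFun g] :
    Dfn (fun v => f v ≠ g v) := Dfn.not (fun v => f v = g v)

theorem Dfn.congr {P Q : (α → VModel δ) → Prop} (hP : Dfn P) (h : ∀ v, Q v ↔ P v) :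
    Dfn Q := by
  rwa [show Q = P from funext fun v => propext (h v)]

instance Dfn.imp (P Q : (α → VModel δ) → Prop) [hP : Dfn P] [hQ : Dfn Q] :
    Dfn (fun v => P v → Q v) :=
  Dfn.congr (P := fun v => ¬ P v ∨ Q v) inferInstance fun v => by tauto

instance Dfn.iff (P Q : (α → VModel δ) → Prop) [hP : Dfn P] [hQ : Dfn Q] :
    Dfn (fun v => P v ↔ Q v) :=
  Dfn.congr (P := fun v => (P v → Q v) ∧ (Q v → P v)) inferInstance fun v => by tauto

/-- The quantified variable is the extra coordinate `none`, and quantifying it existentially is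
projecting along `some`. -/
instance Dfn.ex [Finite α] (P : (α → VModel δ) → VModel δ → Prop)
    [hP : Dfn (fun w : Option α → VModel δ => P (fun i => w (some i)) (w none))] :
    Dfn (fun v => ∃ x, P v x) := by
  refine ⟨?_⟩
  have := hP.out.image_comp (some : α → Option α)
  convert! this using 1
  ext v
  constructor
  · rintro ⟨x, hx⟩
    exact ⟨fun o => o.elim x v, hx, rfl⟩
  · rintro ⟨w, hw, rfl⟩
    exact ⟨_, hw⟩

instance Dfn.all [Finite α] (P : (α → VModel δ) → VModel δ → Prop)
    [hP : Dfn (fun w : Option α → VModel δ => P (fun i => w (some i)) (w none))] :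
    Dfn (fun v => ∀ x, P v x) :=
  Dfn.congr (P := fun v => ¬ ∃ x, ¬ P v x) inferInstance fun v => by push Not; rfl

theorem DFun.of_graph {f : (α → VModel δ) → VModel δ}
    (h : Dfn (fun w : Option α → VModel δ => w none = f (fun i => w (some i)))) : DFun f := by
  refine ⟨?_⟩
  have := h.out
  unfold Set.DefinableFun
  convert! this using 1
  ext w
  exact eq_comm

theorem DFun.of_graph₁ {F : VModel δ → VModel δ}
    (h : Dfn (fun v : Fin 2 → VModel δ => v 1 = F (v 0)))
    (f : (α → VModel δ) → VModel δ) [hf : DFun f] [Finite α] : DFun (fun v => F (f v)) := by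
  refine DFun.of_graph ?_
  have : DFun (fun w : Option α → VModel δ => f (fun i => w (some i))) :=
    ⟨Set.DefinableFun.comp (g := fun w i => w (some i))
      (fun i => (DFun.proj (some i)).out) hf.out⟩
  exact Dfn.subst₂ (P := fun x y => y = F x) h (fun w => f (fun i => w (some i)))
    (fun w => w none)

theorem DFun.of_graph₂ {F : VModel δ → VModel δ → VModel δ}
    (h : Dfn (fun v : Fin 3 → VModel δ => v 2 = F (v 0) (v 1)))
    (f g : (α → VModel δ) → VModel δ) [hf : DFun f] [hg : DFun g] [Finite α] :
    DFun (fun v => F (f v) (g v)) := by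
  refine DFun.of_graph ?_
  have h1 : DFun (fun w : Option α → VModel δ => f (fun i => w (some i))) :=
    ⟨Set.DefinableFun.comp (g := fun w i => w (some i))
      (fun i => (DFun.proj (some i)).out) hf.out⟩
  have h2 : DFun (fun w : Option α → VModel δ => g (fun i => w (some i))) :=
    ⟨Set.DefinableFun.comp (g := fun w i => w (some i))
      (fun i => (DFun.proj (some i)).out) hg.out⟩
  exact Dfn.subst₃ (P := fun x y z => z = F x y) h (fun w => f (fun i => w (some i)))
    (fun w => g (fun i => w (some i))) (fun w => w none)

end calculus

theorem VModel.val_inj {x y : VModel δ} : x = y ↔ x.1 = y.1 := Subtype.ext_iff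

theorem VModel.ext' {x y : VModel δ} (h : ∀ z : VModel δ, z ∈ x ↔ z ∈ y) : x = y := by
  refine Subtype.ext (ZFSet.ext fun z => ⟨fun hz => ?_, fun hz => ?_⟩)
  · exact (h ⟨z, (isTransitive_vonNeumann δ).mem_trans hz x.2⟩).1 hz
  · exact (h ⟨z, (isTransitive_vonNeumann δ).mem_trans hz y.2⟩).2 hz

theorem VModel.mem_elim {x : VModel δ} {z : ZFSet.{u}} (h : z ∈ x.1) : z ∈ V_ δ :=
  (isTransitive_vonNeumann δ).mem_trans h x.2

theorem Nice.succ_lt [hδ : Nice δ] {a : Ordinal.{u}} (h : a < δ) : Order.succ a < δ := by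
  rw [Order.succ_eq_add_one]
  exact hδ.add_lt _ h _ (Ordinal.one_lt_omega0.trans hδ.omega_lt)

theorem Nice.pos [hδ : Nice δ] : 0 < δ := Ordinal.omega0_pos.trans hδ.omega_lt

variable [hδ : Nice δ]

/-- `{x, y}` in `V_δ`. -/
def VModel.upair (x y : VModel δ) : VModel δ := ⟨{x.1, y.1}, by
  rw [mem_vonNeumann, rank_pair]
  exact max_lt (Nice.succ_lt (mem_vonNeumann.1 x.2)) (Nice.succ_lt (mem_vonNeumann.1 y.2))⟩

/-- `⟨x, y⟩` in `V_δ`. -/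
def VModel.pr (x y : VModel δ) : VModel δ := (x.upair x).upair (x.upair y)

/-- `∅` in `V_δ`. -/
def VModel.emp : VModel δ := ⟨∅, by rw [mem_vonNeumann, rank_empty]; exact Nice.pos⟩

theorem VModel.upair_val (x y : VModel δ) : (x.upair y).1 = {x.1, y.1} := rfl

theorem VModel.pr_val (x y : VModel δ) : (x.pr y).1 = pair x.1 y.1 := by
  simp [VModel.pr, VModel.upair_val, pair]

theorem VModel.pr_inj {x y x' y' : VModel δ} : x.pr y = x'.pr y' ↔ x = x' ∧ y = y' := by
  simp only [VModel.val_inj, VModel.pr_val, pair_inj]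

theorem VModel.mem_upair {x y z : VModel δ} : z ∈ x.upair y ↔ z = x ∨ z = y := by
  simp [VModel.mem_def, VModel.upair_val, VModel.val_inj]

theorem VModel.notMem_emp {x : VModel δ} : ¬ x ∈ (VModel.emp : VModel δ) :=
  ZFSet.notMem_empty _

instance {α : Type} [Finite α] (f g : (α → VModel δ) → VModel δ) [DFun f] [DFun g] :
    DFun (fun v => (f v).upair (g v)) := by
  refine DFun.of_graph₂ (F := VModel.upair) ?_ f g
  refine Dfn.congr (P := fun v : Fin 3 → VModel δ => ∀ z, z ∈ v 2 ↔ z = v 0 ∨ z = v 1)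
    inferInstance fun v => ?_
  constructor
  · rintro h z
    rw [h, VModel.mem_upair]
  · intro h
    exact VModel.ext' fun z => by rw [h, VModel.mem_upair]

instance {α : Type} [Finite α] (f g : (α → VModel δ) → VModel δ) [DFun f] [DFun g] :
    DFun (fun v => (f v).pr (g v)) :=
  inferInstanceAs (DFun (fun v => ((f v).upair (f v)).upair ((f v).upair (g v))))

/-- `t` is a function with domain `d`. -/
def IsFn (t d : VModel δ) : Prop :=
  (∀ z ∈ t, ∃ i ∈ d, ∃ y, z = i.pr y) ∧
    ∀ i ∈ d, ∃ y, i.pr y ∈ t ∧ ∀ y', i.pr y' ∈ t → y' = y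

instance {α : Type} [Finite α] (f g : (α → VModel δ) → VModel δ) [DFun f] [DFun g] :
    Dfn (fun v => IsFn (f v) (g v)) := by
  refine Dfn.subst₂ (P := IsFn) ?_ f g
  unfold IsFn
  infer_instance

end

/-! ### Ranks, ordinals and the cumulative hierarchy inside V_δ -/

section

variable {δ : Ordinal.{u}}

/-- A definable predicate. -/
class Def₁ (P : VModel δ → Prop) : Prop where
  out : Dfn (fun v : Fin 1 → VModel δ => P (v 0))

/-- A definable binary relation. -/
class Def₂ (P : VModel δ → VModel δ → Prop) : Prop where
  out : Dfn (fun v : Fin 2 → VModel δ => P (v 0) (v 1))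

/-- A definable unary function. -/
class DefF (F : VModel δ → VModel δ) : Prop where
  out : Dfn (fun v : Fin 2 → VModel δ => v 1 = F (v 0))

/-- `P x`, in a form on which instance resolution works. -/
def Holds (P : VModel δ → Prop) (x : VModel δ) : Prop := P x

/-- `P x y`, in a form on which instance resolution works. -/
def Holds₂ (P : VModel δ → VModel δ → Prop) (x y : VModel δ) : Prop := P x y

/-- `F x`, in a form on which instance resolution works. -/
def Ap (F : VModel δ → VModel δ) (x : VModel δ) : VModel δ := F x

instance {α : Type} (P : VModel δ → Prop) [h : Def₁ P] (f : (α → VModel δ) → VModel δ) [DFun f] :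
    Dfn (fun v => Holds P (f v)) := h.out.subst₁ f

instance {α : Type} (P : VModel δ → VModel δ → Prop) [h : Def₂ P]
    (f g : (α → VModel δ) → VModel δ) [DFun f] [DFun g] :
    Dfn (fun v => Holds₂ P (f v) (g v)) := h.out.subst₂ f g

instance {α : Type} [Finite α] (F : VModel δ → VModel δ) [h : DefF F]
    (f : (α → VModel δ) → VModel δ) [DFun f] : DFun (fun v => Ap F (f v)) :=
  DFun.of_graph₁ h.out f

theorem definableIn_iff {P : VModel δ → Prop} :
    DefinableIn δ {z | ∃ x : VModel δ, x.1 = z ∧ P x} ↔ Def₁ P := by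
  have key : ∀ x : VModel δ, x.1 ∈ {z | ∃ x : VModel δ, x.1 = z ∧ P x} ↔ P x := fun x =>
    ⟨fun ⟨y, hy, h⟩ => Subtype.ext hy ▸ h, fun h => ⟨x, rfl, h⟩⟩
  constructor
  · rintro ⟨-, h⟩
    refine ⟨⟨?_⟩⟩
    unfold Set.Definable₁ at h
    simp only [Set.mem_ofPred_eq] at h
    convert! h using 2
    ext v
    exact (key _).symm
  · rintro ⟨⟨h⟩⟩
    refine ⟨?_, ?_⟩
    · rintro _ ⟨x, rfl, -⟩
      exact x.2
    · unfold Set.Definable₁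
      convert! h using 2
      ext v
      exact key _

theorem DefinableIn.def₁ {A : Set ZFSet.{u}} (h : DefinableIn δ A) :
    Def₁ (fun x : VModel δ => x.1 ∈ A) := ⟨⟨h.2⟩⟩

/-- The rank of an element of `V_δ`. -/
def VModel.rk (x : VModel δ) : Ordinal.{u} := x.1.rank

theorem VModel.rk_lt (x : VModel δ) : x.rk < δ := mem_vonNeumann.1 x.2

theorem VModel.rk_lt_of_mem {x y : VModel δ} (h : x ∈ y) : x.rk < y.rk := rank_lt_of_mem h

theorem VModel.exists_val {x : VModel δ} {z : ZFSet.{u}} (h : z ∈ x.1) :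
    ∃ y : VModel δ, y ∈ x ∧ y.1 = z := ⟨⟨z, VModel.mem_elim h⟩, h, rfl⟩

theorem VModel.rk_le_iff {x : VModel δ} {a : Ordinal.{u}} :
    x.rk ≤ a ↔ ∀ y ∈ x, VModel.rk y < a := by
  refine rank_le_iff.trans ⟨fun h y hy => h hy, fun h y hy => ?_⟩
  obtain ⟨z, hz, rfl⟩ := VModel.exists_val hy
  exact h z hz

/-- A set in `V_δ`, as an element of `VModel δ`. -/
def VModel.of (x : ZFSet.{u}) (h : x ∈ V_ δ) : VModel δ := ⟨x, h⟩

theorem VModel.of_val {x : ZFSet.{u}} (h : x ∈ V_ δ) : (VModel.of x h).1 = x := rfl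

/-- Bounded comprehension in `V_δ`. -/
theorem VModel.exists_set (P : VModel δ → Prop) {ρ : Ordinal.{u}} (hρ : ρ < δ)
    (h : ∀ x, P x → x.rk < ρ) : ∃ b : VModel δ, b.rk ≤ ρ ∧ ∀ x, x ∈ b ↔ P x := by
  -- `P` need not be definable: the set is formed in the ambient universe, and V_δ contains every
  -- subset of V_ρ.
  have hr : (ZFSet.sep (fun z => ∃ x : VModel δ, x.1 = z ∧ P x) (V_ ρ)).rank ≤ ρ := by
    conv_rhs => rw [← rank_vonNeumann ρ]
    exact rank_mono ZFSet.sep_subset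
  refine ⟨VModel.of (ZFSet.sep (fun z => ∃ x : VModel δ, x.1 = z ∧ P x) (V_ ρ))
    (mem_vonNeumann.2 (hr.trans_lt hρ)), hr, fun x => ?_⟩
  rw [VModel.mem_def, VModel.of_val, ZFSet.mem_sep]
  constructor
  · rintro ⟨-, y, hy, hP⟩
    exact (Subtype.ext hy : y = x) ▸ hP
  · exact fun hP => ⟨mem_vonNeumann.2 (h x hP), x, rfl, hP⟩

theorem VModel.induction {P : VModel δ → Prop} (x : VModel δ)
    (h : ∀ x, (∀ y ∈ x, P y) → P x) : P x := by
  obtain ⟨x, hx⟩ := x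
  induction x using ZFSet.inductionOn with
  | h x ih => exact h _ fun y hy => ih y.1 hy y.2

/-- `x` is an ordinal. -/
def IsOrd (x : VModel δ) : Prop := x.1.IsOrdinal

theorem isOrd_iff {x : VModel δ} : IsOrd x ↔
    (∀ y ∈ x, ∀ z ∈ y, z ∈ x) ∧ ∀ y ∈ x, ∀ z ∈ y, ∀ w ∈ z, w ∈ y := by
  rw [IsOrd, ZFSet.isOrdinal_iff_forall_mem_isTransitive]
  constructor
  · rintro ⟨h1, h2⟩
    exact ⟨fun y hy z hz => h1.mem_trans hz hy, fun y hy z hz w hw => (h2 _ hy).mem_trans hw hz⟩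
  · rintro ⟨h1, h2⟩
    refine ⟨fun y hy z hz => ?_, fun y hy z hz w hw => ?_⟩
    · obtain ⟨y, hy, rfl⟩ := VModel.exists_val hy
      obtain ⟨z, hz, rfl⟩ := VModel.exists_val hz
      exact h1 y hy z hz
    · obtain ⟨y, hy, rfl⟩ := VModel.exists_val hy
      obtain ⟨z, hz, rfl⟩ := VModel.exists_val hz
      obtain ⟨w, hw, rfl⟩ := VModel.exists_val hw
      exact h2 y hy z hz w hw

variable [hδ : Nice δ]

open Classical in
/-- The element of `V_δ` given by a set, `∅` if the set is not in `V_δ`. -/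
def toV (x : ZFSet.{u}) : VModel δ := if h : x ∈ V_ δ then VModel.of x h else VModel.emp

theorem toV_val {x : ZFSet.{u}} (h : x.rank < δ) : (toV x : VModel δ).1 = x := by
  rw [toV, dif_pos (mem_vonNeumann.2 h), VModel.of_val]

/-- An ordinal as an element of `V_δ`. -/
def ord (a : Ordinal.{u}) : VModel δ := toV a.toZFSet

theorem ord_val {a : Ordinal.{u}} (h : a < δ) : (ord a : VModel δ).1 = a.toZFSet :=
  toV_val (by rwa [Ordinal.rank_toZFSet])

theorem rk_ord {a : Ordinal.{u}} (h : a < δ) : (ord a : VModel δ).rk = a := by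
  rw [VModel.rk, ord_val h, Ordinal.rank_toZFSet]

/-- `V_a` as an element of `V_δ`. -/
def vv (a : Ordinal.{u}) : VModel δ := toV (V_ a)

theorem vv_val {a : Ordinal.{u}} (h : a < δ) : (vv a : VModel δ).1 = V_ a :=
  toV_val (by rwa [rank_vonNeumann])

theorem rk_vv {a : Ordinal.{u}} (h : a < δ) : (vv a : VModel δ).rk = a := by
  rw [VModel.rk, vv_val h, rank_vonNeumann]

theorem mem_vv {a : Ordinal.{u}} (h : a < δ) {x : VModel δ} : x ∈ (vv a : VModel δ) ↔ x.rk < a := by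
  rw [VModel.mem_def, vv_val h, mem_vonNeumann]; rfl

theorem mem_ord {a : Ordinal.{u}} (h : a < δ) {x : VModel δ} :
    x ∈ (ord a : VModel δ) ↔ ∃ b < a, x = ord b := by
  rw [VModel.mem_def, ord_val h, Ordinal.mem_toZFSet_iff]
  refine exists_congr fun b => and_congr_right fun hb => ?_
  rw [VModel.val_inj, ord_val (hb.trans h), eq_comm]

theorem ord_mem_ord {a b : Ordinal.{u}} (ha : a < δ) (hb : b < δ) :
    (ord a : VModel δ) ∈ (ord b : VModel δ) ↔ a < b := by
  rw [VModel.mem_def, ord_val ha, ord_val hb, Ordinal.toZFSet_mem_toZFSet_iff]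

theorem ord_inj {a b : Ordinal.{u}} (ha : a < δ) (hb : b < δ) :
    (ord a : VModel δ) = ord b ↔ a = b := by
  rw [VModel.val_inj, ord_val ha, ord_val hb, Ordinal.toZFSet_injective.eq_iff]

theorem rk_emp : (VModel.emp : VModel δ).rk = 0 := rank_empty

theorem eq_emp {x : VModel δ} (h : ∀ y, ¬ y ∈ x) : x = VModel.emp :=
  VModel.ext' fun z => ⟨fun hz => (h z hz).elim, fun hz => (VModel.notMem_emp hz).elim⟩

theorem ord_zero : (ord 0 : VModel δ) = VModel.emp :=
  eq_emp fun y hy => by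
    obtain ⟨b, hb, -⟩ := (mem_ord Nice.pos).1 hy
    exact not_lt_bot hb

theorem rk_upair (x y : VModel δ) : (x.upair y).rk = max (Order.succ x.rk) (Order.succ y.rk) := by
  rw [VModel.rk, VModel.upair_val, rank_pair]; rfl

theorem rk_pr (x y : VModel δ) :
    (x.pr y).rk = Order.succ (Order.succ (max x.rk y.rk)) := by
  rw [VModel.pr, rk_upair, rk_upair, rk_upair, max_self, Order.succ_max, Order.succ_max,
    Order.succ_max, ← max_assoc, max_self]

theorem rk_pr_lt {x y : VModel δ} {γ : Ordinal.{u}} (hγ : Order.IsSuccLimit γ) (hx : x.rk < γ)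
    (hy : y.rk < γ) : (x.pr y).rk < γ := by
  rw [rk_pr]
  exact hγ.succ_lt (hγ.succ_lt (max_lt hx hy))

theorem lt_rk_of_pr_left {x y : VModel δ} : x.rk < (x.pr y).rk := by
  rw [rk_pr]
  exact (le_max_left _ _).trans_lt ((Order.lt_succ _).trans (Order.lt_succ _))

theorem lt_rk_of_pr_right {x y : VModel δ} : y.rk < (x.pr y).rk := by
  rw [rk_pr]
  exact (le_max_right _ _).trans_lt ((Order.lt_succ _).trans (Order.lt_succ _))

theorem IsOrd.eq {x : VModel δ} (h : IsOrd x) : x = ord x.rk :=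
  VModel.val_inj.2 (by rw [ord_val x.rk_lt]; exact h.toZFSet_rank_eq.symm)

theorem isOrd_ord {a : Ordinal.{u}} (h : a < δ) : IsOrd (ord a : VModel δ) := by
  rw [IsOrd, ord_val h]; exact isOrdinal_toZFSet a

instance : Def₁ (IsOrd : VModel δ → Prop) := ⟨by
  simp only [isOrd_iff]
  infer_instance⟩

instance {α : Type} (f : (α → VModel δ) → VModel δ) [DFun f] : Dfn (fun v => IsOrd (f v)) :=
  Def₁.out.subst₁ (P := IsOrd) f

/-- The rank of `x` is at most that of `y`. -/
def RkLe (x y : VModel δ) : Prop := x.rk ≤ y.rk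

/-- Rank comparison becomes first-order through a simulation: a relation `f` such that whenever `u`
is related to `a`, each element of `u` is related to some element of `a`. Induction on membership
shows that related sets have ranks in the right order. -/
theorem rkLe_iff {x y : VModel δ} : RkLe x y ↔
    ∃ f : VModel δ, x.pr y ∈ f ∧
      ∀ u a, VModel.pr u a ∈ f → ∀ w ∈ u, ∃ b ∈ a, VModel.pr w b ∈ f := by
  constructor
  · intro h
    -- All pairs of sets in the right order, with ranks bounded by that of `y`; such a pair has at
    -- most the rank of ⟨y, y⟩.
    obtain ⟨f, -, hf⟩ := VModel.exists_set
      (fun z => ∃ u a : VModel δ, z = u.pr a ∧ u.rk ≤ a.rk ∧ a.rk ≤ y.rk)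
      (Nice.succ_lt (y.pr y).rk_lt) (by
        rintro _ ⟨u, a, rfl, h1, h2⟩
        rw [Order.lt_succ_iff, rk_pr, rk_pr, max_self]
        exact Order.succ_le_succ (Order.succ_le_succ (max_le (h1.trans h2) h2)))
    refine ⟨f, (hf _).2 ⟨x, y, rfl, h, le_rfl⟩, fun u a hua w hw => ?_⟩
    obtain ⟨u', a', he, h1, h2⟩ := (hf _).1 hua
    obtain ⟨rfl, rfl⟩ := VModel.pr_inj.1 he
    obtain ⟨b, hb, hwb⟩ := lt_rank_iff.1 ((VModel.rk_lt_of_mem hw).trans_le h1)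
    obtain ⟨b, hb, rfl⟩ := VModel.exists_val hb
    exact ⟨b, hb, (hf _).2 ⟨w, b, rfl, hwb, (VModel.rk_lt_of_mem hb).le.trans h2⟩⟩
  · rintro ⟨f, hxy, hf⟩
    refine VModel.induction (P := fun x => ∀ y : VModel δ, x.pr y ∈ f → RkLe x y) x ?_ y hxy
    clear hxy x y
    intro x ih y hxy
    refine VModel.rk_le_iff.2 fun w hw => ?_
    obtain ⟨b, hb, hwb⟩ := hf x y hxy w hw
    exact (ih w hw b hwb).trans_lt (VModel.rk_lt_of_mem hb)

instance {α : Type} (f g : (α → VModel δ) → VModel δ) [DFun f] [DFun g] :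
    Dfn (fun v => RkLe (f v) (g v)) := by
  refine Dfn.subst₂ (P := RkLe) ?_ f g
  simp only [rkLe_iff]
  infer_instance

/-- The rank of `x` as an element of `V_δ`. -/
def rkF (x : VModel δ) : VModel δ := ord x.rk

instance {α : Type} [Finite α] (f : (α → VModel δ) → VModel δ) [DFun f] :
    DFun (fun v => rkF (f v)) := by
  refine DFun.of_graph₁ (F := rkF) ?_ f
  refine Dfn.congr (P := fun v : Fin 2 → VModel δ => IsOrd (v 1) ∧ RkLe (v 0) (v 1) ∧
    RkLe (v 1) (v 0)) inferInstance fun v => ?_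
  constructor
  · intro h
    rw [h]
    exact ⟨isOrd_ord (v 0).rk_lt, (rk_ord (v 0).rk_lt).ge, (rk_ord (v 0).rk_lt).le⟩
  · rintro ⟨h1, h2, h3⟩
    rw [h1.eq, rkF, le_antisymm h2 h3]

/-- `V_α`, for `α` the rank of `x`. -/
def vF (x : VModel δ) : VModel δ := vv x.rk

instance {α : Type} [Finite α] (f : (α → VModel δ) → VModel δ) [DFun f] :
    DFun (fun v => vF (f v)) := by
  refine DFun.of_graph₁ (F := vF) ?_ f
  refine Dfn.congr (P := fun v : Fin 2 → VModel δ => ∀ z, z ∈ v 1 ↔ ¬ RkLe (v 0) z)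
    inferInstance fun v => ?_
  constructor
  · intro h z
    rw [h, vF, mem_vv (v 0).rk_lt, RkLe, not_le]
  · intro h
    exact VModel.ext' fun z => by rw [h, vF, mem_vv (v 0).rk_lt, RkLe, not_le]

/-- `x` is a limit ordinal. -/
def IsLim (x : VModel δ) : Prop := IsOrd x ∧ Order.IsSuccLimit x.rk

theorem isLim_iff {x : VModel δ} : IsLim x ↔
    IsOrd x ∧ (∃ y, y ∈ x) ∧ ∀ y ∈ x, ∃ z ∈ x, y ∈ z := by
  refine and_congr_right fun ho => ?_
  rw [Ordinal.isSuccLimit_iff]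
  constructor
  · rintro ⟨h0, h⟩
    rw [ho.eq]
    refine ⟨⟨ord 0, (ord_mem_ord Nice.pos x.rk_lt).2 (bot_lt_iff_ne_bot.2 h0)⟩, fun y hy => ?_⟩
    obtain ⟨b, hb, rfl⟩ := (mem_ord x.rk_lt).1 hy
    have := h.succ_lt hb
    exact ⟨ord (Order.succ b), (ord_mem_ord (this.trans x.rk_lt) x.rk_lt).2 this,
      (ord_mem_ord (hb.trans x.rk_lt) (this.trans x.rk_lt)).2 (Order.lt_succ b)⟩
  · rintro ⟨⟨y, hy⟩, h⟩
    refine ⟨(zero_le.trans_lt (VModel.rk_lt_of_mem hy)).ne', ?_⟩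
    refine Order.isSuccPrelimit_of_succ_lt fun a ha => ?_
    have : ord a ∈ x := by
      rw [ho.eq]; exact (ord_mem_ord (ha.trans x.rk_lt) x.rk_lt).2 ha
    obtain ⟨z, hz, haz⟩ := h _ this
    have h1 := VModel.rk_lt_of_mem haz
    rw [rk_ord (ha.trans x.rk_lt)] at h1
    exact (Order.succ_le_of_lt h1).trans_lt (VModel.rk_lt_of_mem hz)

instance {α : Type} (f : (α → VModel δ) → VModel δ) [DFun f] : Dfn (fun v => IsLim (f v)) := by
  refine Dfn.subst₁ (P := IsLim) ?_ f
  simp only [isLim_iff]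
  infer_instance

theorem add_omega_lt {a : Ordinal.{u}} (h : a < δ) : a + Ordinal.omega0 < δ :=
  hδ.add_lt _ h _ hδ.omega_lt

theorem isSuccLimit_add_omega (a : Ordinal.{u}) : Order.IsSuccLimit (a + Ordinal.omega0) :=
  Ordinal.isSuccLimit_add a Ordinal.isSuccLimit_omega0

theorem isLim_ord {a : Ordinal.{u}} (h : a < δ) :
    IsLim (ord a : VModel δ) ↔ Order.IsSuccLimit a := by
  rw [IsLim, rk_ord h, and_iff_right (isOrd_ord h)]

/-- Minimality makes addition of ω definable, without recursion on ordinals; the strict inequality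
supplies the room above `a` needed again and again. -/
theorem isLeast_add_omega (a : Ordinal.{u}) :
    IsLeast {b | Order.IsSuccLimit b ∧ a < b} (a + Ordinal.omega0) := by
  refine ⟨⟨isSuccLimit_add_omega a, lt_add_of_pos_right _ Ordinal.omega0_pos⟩, ?_⟩
  rintro b ⟨hb, hab⟩
  rw [Ordinal.add_le_iff_of_isSuccLimit Ordinal.isSuccLimit_omega0]
  intro c hc
  obtain ⟨n, rfl⟩ := Ordinal.lt_omega0.1 hc
  exact ((Ordinal.isSuccLimit_iff.1 hb).2.add_natCast_lt hab n).le

/-- The least limit ordinal above the rank of `x`. -/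
def limF (x : VModel δ) : VModel δ := ord (x.rk + Ordinal.omega0)

instance {α : Type} [Finite α] (f : (α → VModel δ) → VModel δ) [DFun f] :
    DFun (fun v => limF (f v)) := by
  refine DFun.of_graph₁ (F := limF) ?_ f
  refine Dfn.congr (P := fun v : Fin 2 → VModel δ => IsLim (v 1) ∧ ¬ RkLe (v 1) (v 0) ∧
    ∀ y, IsLim y → ¬ RkLe y (v 0) → RkLe (v 1) y) inferInstance fun v => ?_
  have hl := add_omega_lt (v 0).rk_lt
  have h := isLeast_add_omega (v 0).rk
  constructor
  · intro he
    rw [he]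
    refine ⟨(isLim_ord hl).2 h.1.1, ?_, fun y h1 h2 => ?_⟩
    · rw [RkLe, limF, rk_ord hl, not_le]; exact h.1.2
    · rw [RkLe, limF, rk_ord hl]
      exact h.2 ⟨h1.2, not_le.1 h2⟩
  · rintro ⟨h1, h2, h3⟩
    rw [h1.1.eq, limF]
    congr 1
    refine le_antisymm ?_ (h.2 ⟨h1.2, not_le.1 h2⟩)
    have := h3 (ord ((v 0).rk + Ordinal.omega0)) ((isLim_ord hl).2 h.1.1)
      (by rw [RkLe, rk_ord hl, not_le]; exact h.1.2)
    rwa [RkLe, rk_ord hl] at this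

/-- `ω`. -/
def om : VModel δ := ord Ordinal.omega0

/-- A natural number. -/
def nat (n : ℕ) : VModel δ := ord n

theorem natCast_lt (n : ℕ) : (n : Ordinal.{u}) < δ := (Ordinal.natCast_lt_omega0 n).trans hδ.omega_lt

theorem mem_om {x : VModel δ} : x ∈ (om : VModel δ) ↔ ∃ n : ℕ, x = nat n := by
  rw [om, mem_ord hδ.omega_lt]
  constructor
  · rintro ⟨b, hb, rfl⟩
    obtain ⟨n, rfl⟩ := Ordinal.lt_omega0.1 hb
    exact ⟨n, rfl⟩
  · rintro ⟨n, rfl⟩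
    exact ⟨n, Ordinal.natCast_lt_omega0 n, rfl⟩

theorem nat_inj {m n : ℕ} : (nat m : VModel δ) = nat n ↔ m = n := by
  rw [nat, nat, ord_inj (natCast_lt _) (natCast_lt _), Nat.cast_inj]

theorem rk_nat (n : ℕ) : (nat n : VModel δ).rk = n := rk_ord (natCast_lt n)

theorem rk_om : (om : VModel δ).rk = Ordinal.omega0 := rk_ord hδ.omega_lt

/-- `x ∪ {x}`. -/
def sucF (x : VModel δ) : VModel δ := toV (insert x.1 x.1)

theorem mem_sucF {x z : VModel δ} : z ∈ sucF x ↔ z = x ∨ z ∈ x := by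
  rw [VModel.mem_def, sucF, toV_val, ZFSet.mem_insert_iff, VModel.val_inj, VModel.mem_def]
  rw [rank_insert]
  exact max_lt (Nice.succ_lt x.rk_lt) x.rk_lt

theorem nat_succ (n : ℕ) : (nat (n + 1) : VModel δ) = sucF (nat n) := by
  refine VModel.ext' fun z => ?_
  rw [mem_sucF, nat, nat, mem_ord (natCast_lt _), mem_ord (natCast_lt _)]
  constructor
  · rintro ⟨b, hb, rfl⟩
    rw [Nat.cast_succ, ← Order.succ_eq_add_one, Order.lt_succ_iff] at hb
    rcases hb.eq_or_lt with rfl | hb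
    · exact Or.inl rfl
    · exact Or.inr ⟨b, hb, rfl⟩
  · rintro (rfl | ⟨b, hb, rfl⟩)
    · exact ⟨n, by exact_mod_cast n.lt_succ_self, rfl⟩
    · exact ⟨b, hb.trans (by exact_mod_cast n.lt_succ_self), rfl⟩

instance {α : Type} [Finite α] (f : (α → VModel δ) → VModel δ) [DFun f] :
    DFun (fun v => sucF (f v)) := by
  refine DFun.of_graph₁ (F := sucF) ?_ f
  refine Dfn.congr (P := fun v : Fin 2 → VModel δ => ∀ z, z ∈ v 1 ↔ z = v 0 ∨ z ∈ v 0)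
    inferInstance fun v => ?_
  constructor
  · intro h z
    rw [h, mem_sucF]
  · intro h
    exact VModel.ext' fun z => by rw [h, mem_sucF]

end

section

variable {δ : Ordinal.{u}} [hδ : Nice δ]

/-! ### Maps respecting a predicate -/

/-- `J` respects pairs and the predicate `B` on `V_γ`. -/
structure BMap (B : VModel δ → Prop) (γ : Ordinal.{u}) (J : VModel δ → VModel δ) : Prop where
  emp : J VModel.emp = VModel.emp
  pr : ∀ x y : VModel δ, x.rk < γ → y.rk < γ → J (x.pr y) = (J x).pr (J y)
  iff : ∀ x : VModel δ, x.rk < γ → (B x ↔ B (J x))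

/-- The disjoint union of two predicates. -/
def join (P Q : VModel δ → Prop) (z : VModel δ) : Prop :=
  (∃ x, z = VModel.emp.pr x ∧ Holds P x) ∨ ∃ x, z = (VModel.emp.pr VModel.emp).pr x ∧ Holds Q x

instance (P Q : VModel δ → Prop) [Def₁ P] [Def₁ Q] : Def₁ (join P Q) := ⟨by
  unfold join; infer_instance⟩

/-- This keeps the two tags ∅ and ⟨∅, ∅⟩ of `join` apart. -/
theorem emp_ne_pr {x y : VModel δ} : VModel.emp ≠ x.pr y := fun h => by
  have := lt_rk_of_pr_left (x := x) (y := y)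
  rw [← h, rk_emp] at this
  exact not_lt_bot this

theorem BMap.mono {B : VModel δ → Prop} {γ γ' : Ordinal.{u}} {J : VModel δ → VModel δ}
    (h : BMap B γ J) (hγ : γ' ≤ γ) : BMap B γ' J :=
  ⟨h.emp, fun x y hx hy => h.pr x y (hx.trans_le hγ) (hy.trans_le hγ),
    fun x hx => h.iff x (hx.trans_le hγ)⟩

theorem rk_emp_lt {γ : Ordinal.{u}} (hγ : Order.IsSuccLimit γ) :
    (VModel.emp : VModel δ).rk < γ := by
  rw [rk_emp]; exact hγ.bot_lt

theorem join_left {P Q : VModel δ → Prop} {x : VModel δ} :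
    join P Q (VModel.emp.pr x) ↔ P x := by
  constructor
  · rintro (⟨y, hy, hP⟩ | ⟨y, hy, -⟩)
    · exact (VModel.pr_inj.1 hy).2 ▸ hP
    · exact (emp_ne_pr (VModel.pr_inj.1 hy).1).elim
  · exact fun hP => Or.inl ⟨x, rfl, hP⟩

theorem join_right {P Q : VModel δ → Prop} {x : VModel δ} :
    join P Q ((VModel.emp.pr VModel.emp).pr x) ↔ Q x := by
  constructor
  · rintro (⟨y, hy, -⟩ | ⟨y, hy, hP⟩)
    · exact (emp_ne_pr (VModel.pr_inj.1 hy).1.symm).elim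
    · exact (VModel.pr_inj.1 hy).2 ▸ hP
  · exact fun hP => Or.inr ⟨x, rfl, hP⟩

/-- `J` fixes the tag because it fixes ∅, and commutes with tagging because it commutes with pairs.
That γ is a limit keeps the tagged elements in the domain. -/
theorem BMap.left {P Q : VModel δ → Prop} {γ : Ordinal.{u}} {J : VModel δ → VModel δ}
    (h : BMap (join P Q) γ J) (hγ : Order.IsSuccLimit γ) : BMap P γ J := by
  refine ⟨h.emp, h.pr, fun x hx => ?_⟩
  have := h.iff _ (rk_pr_lt hγ (rk_emp_lt hγ) hx)
  rwa [h.pr _ _ (rk_emp_lt hγ) hx, h.emp, join_left, join_left] at this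

theorem BMap.right {P Q : VModel δ → Prop} {γ : Ordinal.{u}} {J : VModel δ → VModel δ}
    (h : BMap (join P Q) γ J) (hγ : Order.IsSuccLimit γ) : BMap Q γ J := by
  refine ⟨h.emp, h.pr, fun x hx => ?_⟩
  have h0 := rk_emp_lt (δ := δ) hγ
  have := h.iff _ (rk_pr_lt hγ (rk_pr_lt hγ h0 h0) hx)
  rwa [h.pr _ _ (rk_pr_lt hγ h0 h0) hx, h.pr _ _ h0 h0, h.emp, join_right, join_right] at this

/-- A binary relation as a predicate of pairs. -/
def un₂ (R : VModel δ → VModel δ → Prop) (z : VModel δ) : Prop := ∃ x y : VModel δ, z = x.pr y ∧ Holds₂ R x y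

/-- The graph of a function as a predicate of pairs. -/
def gr (F : VModel δ → VModel δ) (z : VModel δ) : Prop := ∃ x : VModel δ, z = x.pr (Ap F x)

instance (R : VModel δ → VModel δ → Prop) [Def₂ R] : Def₁ (un₂ R) := ⟨by
  unfold un₂; infer_instance⟩

instance (F : VModel δ → VModel δ) [DefF F] : Def₁ (gr F) := ⟨by
  unfold gr; infer_instance⟩

theorem BMap.iff₂ {R : VModel δ → VModel δ → Prop} {γ : Ordinal.{u}} {J : VModel δ → VModel δ}
    (h : BMap (un₂ R) γ J) (hγ : Order.IsSuccLimit γ) {x y : VModel δ} (hx : x.rk < γ)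
    (hy : y.rk < γ) : R x y ↔ R (J x) (J y) := by
  have key : ∀ x y : VModel δ, un₂ R (x.pr y) ↔ R x y := fun x y => by
    constructor
    · rintro ⟨x', y', he, hR⟩
      obtain ⟨rfl, rfl⟩ := VModel.pr_inj.1 he
      exact hR
    · exact fun hR => ⟨x, y, rfl, hR⟩
  have := h.iff _ (rk_pr_lt hγ hx hy)
  rwa [h.pr _ _ hx hy, key, key] at this

/-- The image of ⟨x, F x⟩ is the pair ⟨J x, J (F x)⟩, which must again lie on the graph. -/
theorem BMap.app {F : VModel δ → VModel δ} {γ : Ordinal.{u}} {J : VModel δ → VModel δ}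
    (h : BMap (gr F) γ J) (hγ : Order.IsSuccLimit γ) {x : VModel δ} (hx : x.rk < γ)
    (hy : (F x).rk < γ) : J (F x) = F (J x) := by
  have := h.iff _ (rk_pr_lt hγ hx hy)
  rw [h.pr _ _ hx hy] at this
  obtain ⟨x', he⟩ := this.1 ⟨x, rfl⟩
  obtain ⟨rfl, he⟩ := VModel.pr_inj.1 he
  exact he

instance : Def₂ (fun x y : VModel δ => x ∈ y) := ⟨inferInstance⟩
instance : Def₂ (fun x y : VModel δ => x = y) := ⟨inferInstance⟩
instance : Def₂ (IsFn : VModel δ → VModel δ → Prop) := ⟨inferInstance⟩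
instance : DefF (rkF : VModel δ → VModel δ) := ⟨inferInstance⟩
instance : DefF (vF : VModel δ → VModel δ) := ⟨inferInstance⟩
instance : DefF (limF : VModel δ → VModel δ) := ⟨inferInstance⟩
instance : DefF (sucF : VModel δ → VModel δ) := ⟨inferInstance⟩

/-- The predicate holding of a single element. -/
def single (a x : VModel δ) : Prop := x = a

instance (a : VModel δ) : Def₁ (single a) := ⟨by unfold single; infer_instance⟩

/-- This is how parameters are handled: joining the singleton of `a` to the predicate forces `J` to
fix `a`. -/
theorem BMap.single_eq {a : VModel δ} {γ : Ordinal.{u}} {J : VModel δ → VModel δ}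
    (h : BMap (single a) γ J) (ha : a.rk < γ) : J a = a := (h.iff a ha).1 rfl

/-- `y` is the range of `g`. -/
def IsRan (g y : VModel δ) : Prop := ∀ z, z ∈ y ↔ ∃ i, VModel.pr i z ∈ g

instance : Def₂ (IsRan : VModel δ → VModel δ → Prop) := ⟨by unfold IsRan; infer_instance⟩

/-! ### Sequences of length `ω` -/

/-- `t` is an `ω`-sequence of elements of `c`. -/
def IsSeq (t c : VModel δ) : Prop := IsFn t om ∧ ∀ i y, VModel.pr i y ∈ t → y ∈ c

instance {α : Type} [Finite α] (f g : (α → VModel δ) → VModel δ) [DFun f] [DFun g] :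
    Dfn (fun v => IsSeq (f v) (g v)) := by
  refine Dfn.subst₂ (P := IsSeq) ?_ f g
  unfold IsSeq; infer_instance

/-- `t` is the set coding the sequence `s`. -/
def IsAsg (t : VModel δ) (s : ℕ → VModel δ) : Prop := ∀ z, z ∈ t ↔ ∃ n, z = (nat n).pr (s n)

theorem IsAsg.pr_mem {t : VModel δ} {s : ℕ → VModel δ} (h : IsAsg t s) {n : ℕ} {y : VModel δ} :
    (nat n).pr y ∈ t ↔ y = s n := by
  rw [h]
  constructor
  · rintro ⟨m, hm⟩
    obtain ⟨h1, rfl⟩ := VModel.pr_inj.1 hm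
    rw [nat_inj.1 h1]
  · rintro rfl
    exact ⟨n, rfl⟩

theorem IsAsg.pr_mem' {t : VModel δ} {s : ℕ → VModel δ} (h : IsAsg t s) {i y : VModel δ} :
    i.pr y ∈ t ↔ ∃ n, i = nat n ∧ y = s n := by
  rw [h]
  exact exists_congr fun n => VModel.pr_inj

theorem IsAsg.isFn {t : VModel δ} {s : ℕ → VModel δ} (h : IsAsg t s) : IsFn t om := by
  refine ⟨fun z hz => ?_, fun i hi => ?_⟩
  · obtain ⟨n, rfl⟩ := (h z).1 hz
    exact ⟨_, mem_om.2 ⟨n, rfl⟩, _, rfl⟩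
  · obtain ⟨n, rfl⟩ := mem_om.1 hi
    exact ⟨s n, h.pr_mem.2 rfl, fun y' hy' => h.pr_mem.1 hy'⟩

theorem IsAsg.isSeq {t c : VModel δ} {s : ℕ → VModel δ} (h : IsAsg t s) (hs : ∀ n, s n ∈ c) :
    IsSeq t c := by
  refine ⟨h.isFn, fun i y hy => ?_⟩
  obtain ⟨n, -, rfl⟩ := h.pr_mem'.1 hy
  exact hs n

theorem IsFn.exists_asg {t : VModel δ} (h : IsFn t om) : ∃ s, IsAsg t s := by
  have h2 : ∀ n : ℕ, ∃ y, (nat n).pr y ∈ t ∧ ∀ y', (nat n).pr y' ∈ t → y' = y :=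
    fun n => h.2 _ (mem_om.2 ⟨n, rfl⟩)
  choose s hs using h2
  refine ⟨s, fun z => ⟨fun hz => ?_, ?_⟩⟩
  · obtain ⟨i, hi, y, rfl⟩ := h.1 z hz
    obtain ⟨n, rfl⟩ := mem_om.1 hi
    exact ⟨n, by rw [(hs n).2 y hz]⟩
  · rintro ⟨n, rfl⟩
    exact (hs n).1

theorem IsSeq.exists_asg {t c : VModel δ} (h : IsSeq t c) :
    ∃ s, IsAsg t s ∧ ∀ n, s n ∈ c := by
  obtain ⟨s, hs⟩ := h.1.exists_asg
  exact ⟨s, hs, fun n => h.2 _ _ (hs.pr_mem.2 rfl)⟩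

theorem exists_isAsg {ρ : Ordinal.{u}} (hρ : Ordinal.omega0 ≤ ρ) (hρ' : ρ < δ)
    (s : ℕ → VModel δ) (hs : ∀ n, (s n).rk < ρ) :
    ∃ t, IsAsg t s ∧ t.rk ≤ Order.succ (Order.succ ρ) := by
  obtain ⟨t, h1, h2⟩ := VModel.exists_set (fun z => ∃ n, z = (nat n).pr (s n))
    (Nice.succ_lt (Nice.succ_lt hρ')) (by
      rintro _ ⟨n, rfl⟩
      rw [rk_pr, Order.succ_lt_succ_iff, Order.succ_lt_succ_iff]
      refine max_lt ?_ (hs n)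
      rw [rk_nat]
      exact (Ordinal.natCast_lt_omega0 n).trans_le hρ)
  exact ⟨t, h2, h1⟩

theorem IsAsg.unique {t t' : VModel δ} {s : ℕ → VModel δ} (h : IsAsg t s) (h' : IsAsg t' s) :
    t = t' := VModel.ext' fun z => by rw [h, h']

theorem IsAsg.inj {t : VModel δ} {s s' : ℕ → VModel δ} (h : IsAsg t s) (h' : IsAsg t s') :
    s = s' := funext fun _ => h'.pr_mem.1 (h.pr_mem.2 rfl)

/-! ### Operations on sets of sequences -/

/-- `Z` is the graph of the evaluation of the `i`-th variable. -/
def OpVar (Z i c : VModel δ) : Prop :=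
  ∀ p, p ∈ Z ↔ ∃ t y, p = VModel.pr t y ∧ IsSeq t c ∧ i.pr y ∈ t

/-- `Z` is the set of sequences at which `G` and `G'` agree. -/
def OpEq (Z G G' c : VModel δ) : Prop :=
  ∀ t, t ∈ Z ↔ IsSeq t c ∧ ∃ y, t.pr y ∈ G ∧ t.pr y ∈ G'

/-- `u` is the tuple of values at `t` of the tuple `G` of functions. -/
def Ev (u G t : VModel δ) : Prop :=
  ∀ z, z ∈ u ↔ ∃ i g y, z = VModel.pr i y ∧ i.pr g ∈ G ∧ t.pr y ∈ g

/-- `Z` is the set of sequences at which the relation `r` of `m` holds for the tuple `G`. -/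
def OpRel (Z G r m : VModel δ) : Prop :=
  ∃ c fs rs, m = c.pr (VModel.pr fs rs) ∧
    ∀ t, t ∈ Z ↔ IsSeq t c ∧ ∃ u, Ev u G t ∧ r.pr u ∈ rs

/-- `Z` is the graph of the composition of the operation `f` of `m` with the tuple `G`. -/
def OpFun (Z G f m : VModel δ) : Prop :=
  ∃ c fs rs, m = c.pr (VModel.pr fs rs) ∧
    ∀ p, p ∈ Z ↔ ∃ t y, p = VModel.pr t y ∧ IsSeq t c ∧ ∃ u, Ev u G t ∧ f.pr (u.pr y) ∈ fs

/-- `Z` is the set of sequences that are in `Y` if they are in `X`. -/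
def OpImp (Z X Y c : VModel δ) : Prop := ∀ t, t ∈ Z ↔ IsSeq t c ∧ (t ∈ X → t ∈ Y)

/-- `Z` is the set of sequences whose variants in the `i`-th place are all in `X`. -/
def OpAll (Z X i c : VModel δ) : Prop :=
  ∀ t, t ∈ Z ↔ IsSeq t c ∧ ∀ t', IsSeq t' c →
    (∀ k ∈ (om : VModel δ), k ≠ i → ∀ y, k.pr y ∈ t ↔ k.pr y ∈ t') → t' ∈ X

/-- A relation of four arguments as a predicate. -/
def un₄ (R : VModel δ → VModel δ → VModel δ → VModel δ → Prop) (z : VModel δ) : Prop :=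
  ∃ a b c d, z = (VModel.pr a b).pr (VModel.pr c d) ∧ R a b c d

theorem BMap.iff₄ {R : VModel δ → VModel δ → VModel δ → VModel δ → Prop} {γ : Ordinal.{u}}
    {J : VModel δ → VModel δ} (h : BMap (un₄ R) γ J) (hγ : Order.IsSuccLimit γ)
    {a b c d : VModel δ} (ha : a.rk < γ) (hb : b.rk < γ) (hc : c.rk < γ) (hd : d.rk < γ) :
    R a b c d ↔ R (J a) (J b) (J c) (J d) := by
  have key : ∀ a b c d : VModel δ, un₄ R ((a.pr b).pr (c.pr d)) ↔ R a b c d := fun a b c d => by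
    constructor
    · rintro ⟨a', b', c', d', he, hR⟩
      obtain ⟨h1, h2⟩ := VModel.pr_inj.1 he
      obtain ⟨rfl, rfl⟩ := VModel.pr_inj.1 h1
      obtain ⟨rfl, rfl⟩ := VModel.pr_inj.1 h2
      exact hR
    · exact fun hR => ⟨a, b, c, d, rfl, hR⟩
  have := h.iff _ (rk_pr_lt hγ (rk_pr_lt hγ ha hb) (rk_pr_lt hγ hc hd))
  rwa [h.pr _ _ (rk_pr_lt hγ ha hb) (rk_pr_lt hγ hc hd), h.pr _ _ ha hb, h.pr _ _ hc hd,
    key, key] at this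

instance {α : Type} [Finite α] (f g h : (α → VModel δ) → VModel δ) [DFun f] [DFun g] [DFun h] :
    Dfn (fun v => Ev (f v) (g v) (h v)) := by
  refine Dfn.subst₃ (P := Ev) ?_ f g h
  unfold Ev; infer_instance

instance : Def₁ (un₄ (fun Z i c _ : VModel δ => OpVar Z i c)) := ⟨by
  unfold un₄ OpVar; infer_instance⟩
instance : Def₁ (un₄ (OpEq : VModel δ → _)) := ⟨by unfold un₄ OpEq; infer_instance⟩
instance : Def₁ (un₄ (OpRel : VModel δ → _)) := ⟨by unfold un₄ OpRel; infer_instance⟩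
instance : Def₁ (un₄ (OpFun : VModel δ → _)) := ⟨by unfold un₄ OpFun; infer_instance⟩
instance : Def₁ (un₄ (OpImp : VModel δ → _)) := ⟨by unfold un₄ OpImp; infer_instance⟩
instance : Def₁ (un₄ (OpAll : VModel δ → _)) := ⟨by unfold un₄ OpAll; infer_instance⟩

/-- `F` is a function from `ω`-sequences of elements of `W` to elements of `W` that takes all
values in `W` on the sequences from any subset of `W` of the cardinality of `W`. -/
def Jon (F W : VModel δ) : Prop :=
  (∀ t, IsSeq t W → ∃ w ∈ W, t.pr w ∈ F) ∧
  (∀ t w w', VModel.pr t w ∈ F → VModel.pr t w' ∈ F → w = w') ∧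
  ∀ X, (∀ x ∈ X, x ∈ W) →
    (∃ e, IsFn e W ∧ (∀ x y, VModel.pr x y ∈ e → y ∈ X) ∧
      ∀ x x' y, VModel.pr x y ∈ e → VModel.pr x' y ∈ e → x = x') →
    ∀ w ∈ W, ∃ t, IsSeq t X ∧ t.pr w ∈ F

instance : Def₂ (Jon : VModel δ → VModel δ → Prop) := ⟨by unfold Jon; infer_instance⟩

/-- The join of the basic predicates respected by all maps considered. -/
def Base : VModel δ → Prop :=
  join (un₂ fun x y => x ∈ y) <| join (un₂ fun x y => x = y) <| join (un₂ IsFn) <|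
  join (gr rkF) <| join (gr vF) <| join (gr limF) <| join (gr sucF) <| join (single om) <|
  join (un₂ IsRan) <| join (un₂ Jon) <| join (un₄ (fun Z i c _ => OpVar Z i c)) <|
  join (un₄ OpEq) <| join (un₄ OpRel) <| join (un₄ OpFun) <| join (un₄ OpImp) (un₄ OpAll)

instance : Def₁ (Base : VModel δ → Prop) := by unfold Base; infer_instance

/-! ### Action of maps respecting `Base` on the basic operations -/

section Base

variable {γ : Ordinal.{u}} {J : VModel δ → VModel δ} (h : BMap Base γ J)
  (hγ : Order.IsSuccLimit γ)
include h hγ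

theorem BMap.mem {x y : VModel δ} (hx : x.rk < γ) (hy : y.rk < γ) : x ∈ y ↔ J x ∈ J y :=
  (h.left hγ).iff₂ hγ hx hy

theorem BMap.inj {x y : VModel δ} (hx : x.rk < γ) (hy : y.rk < γ) : x = y ↔ J x = J y :=
  ((h.right hγ).left hγ).iff₂ hγ hx hy

theorem BMap.isFn {x y : VModel δ} (hx : x.rk < γ) (hy : y.rk < γ) :
    IsFn x y ↔ IsFn (J x) (J y) :=
  (((h.right hγ).right hγ).left hγ).iff₂ hγ hx hy

theorem BMap.rkF {x : VModel δ} (hx : x.rk < γ) : J (rkF x) = VopenkaScheme.rkF (J x) :=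
  ((((h.right hγ).right hγ).right hγ).left hγ).app hγ hx
    (by rwa [VopenkaScheme.rkF, rk_ord x.rk_lt])

theorem BMap.vF {x : VModel δ} (hx : x.rk < γ) : J (vF x) = VopenkaScheme.vF (J x) :=
  (((((h.right hγ).right hγ).right hγ).right hγ).left hγ).app hγ hx
    (by rwa [VopenkaScheme.vF, rk_vv x.rk_lt])

theorem BMap.limF {x : VModel δ} (hx : x.rk + Ordinal.omega0 < γ) :
    J (limF x) = VopenkaScheme.limF (J x) :=
  ((((((h.right hγ).right hγ).right hγ).right hγ).right hγ).left hγ).app hγ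
    (le_self_add.trans_lt hx)
    (by rwa [VopenkaScheme.limF, rk_ord (add_omega_lt x.rk_lt)])

end Base

end

section

variable {δ : Ordinal.{u}} [hδ : Nice δ]

section Base

variable {γ : Ordinal.{u}} {J : VModel δ → VModel δ} (h : BMap Base γ J)
  (hγ : Order.IsSuccLimit γ)
include h hγ

/-- The tail of `Base` from its seventh component on, to shorten the chains of projections. -/
theorem BMap.base₇ : BMap (join (gr sucF) <| join (single om) <|
    join (un₂ IsRan) <| join (un₂ Jon) <| join (un₄ (fun Z i c _ => OpVar Z i c)) <|
    join (un₄ OpEq) <| join (un₄ OpRel) <| join (un₄ OpFun) <| join (un₄ OpImp) (un₄ OpAll))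
    γ J :=
  (((((h.right hγ).right hγ).right hγ).right hγ).right hγ).right hγ

theorem BMap.sucF {x : VModel δ} (hx : x.rk < γ) (hx' : (sucF x).rk < γ) :
    J (sucF x) = VopenkaScheme.sucF (J x) :=
  ((h.base₇ hγ).left hγ).app hγ hx hx'

theorem BMap.nat (hω : Ordinal.omega0 < γ) (n : ℕ) : J (nat n) = VopenkaScheme.nat n := by
  induction n with
  | zero => simpa [VopenkaScheme.nat, ord_zero] using h.emp
  | succ n ih =>
    have h1 : ∀ n : ℕ, (VopenkaScheme.nat n : VModel δ).rk < γ := fun n => by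
      rw [rk_nat]; exact (Ordinal.natCast_lt_omega0 n).trans hω
    have h2 := h1 (n + 1)
    rw [nat_succ] at h2
    rw [nat_succ, h.sucF hγ (h1 n) h2, ih]

theorem BMap.om (hω : Ordinal.omega0 < γ) : J om = VopenkaScheme.om :=
  (((h.base₇ hγ).right hγ).left hγ).single_eq (by rwa [rk_om])

theorem BMap.isRan {x y : VModel δ} (hx : x.rk < γ) (hy : y.rk < γ) :
    IsRan x y ↔ IsRan (J x) (J y) :=
  ((((h.base₇ hγ).right hγ).right hγ).left hγ).iff₂ hγ hx hy

theorem BMap.jon {x y : VModel δ} (hx : x.rk < γ) (hy : y.rk < γ) :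
    Jon x y ↔ Jon (J x) (J y) :=
  (((((h.base₇ hγ).right hγ).right hγ).right hγ).left hγ).iff₂ hγ hx hy

theorem BMap.base₁₁ : BMap (join (un₄ (fun Z i c _ => OpVar Z i c)) <|
    join (un₄ OpEq) <| join (un₄ OpRel) <| join (un₄ OpFun) <| join (un₄ OpImp) (un₄ OpAll))
    γ J :=
  ((((h.base₇ hγ).right hγ).right hγ).right hγ).right hγ

theorem BMap.opVar {a b c : VModel δ} (ha : a.rk < γ) (hb : b.rk < γ) (hc : c.rk < γ) :
    OpVar a b c ↔ OpVar (J a) (J b) (J c) :=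
  -- The fourth argument is a dummy, filled by `c` again.
  ((h.base₁₁ hγ).left hγ).iff₄ hγ ha hb hc hc

theorem BMap.opEq {a b c d : VModel δ} (ha : a.rk < γ) (hb : b.rk < γ) (hc : c.rk < γ)
    (hd : d.rk < γ) : OpEq a b c d ↔ OpEq (J a) (J b) (J c) (J d) :=
  (((h.base₁₁ hγ).right hγ).left hγ).iff₄ hγ ha hb hc hd

theorem BMap.opRel {a b c d : VModel δ} (ha : a.rk < γ) (hb : b.rk < γ) (hc : c.rk < γ)
    (hd : d.rk < γ) : OpRel a b c d ↔ OpRel (J a) (J b) (J c) (J d) :=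
  ((((h.base₁₁ hγ).right hγ).right hγ).left hγ).iff₄ hγ ha hb hc hd

theorem BMap.opFun {a b c d : VModel δ} (ha : a.rk < γ) (hb : b.rk < γ) (hc : c.rk < γ)
    (hd : d.rk < γ) : OpFun a b c d ↔ OpFun (J a) (J b) (J c) (J d) :=
  (((((h.base₁₁ hγ).right hγ).right hγ).right hγ).left hγ).iff₄ hγ ha hb hc hd

theorem BMap.opImp {a b c d : VModel δ} (ha : a.rk < γ) (hb : b.rk < γ) (hc : c.rk < γ)
    (hd : d.rk < γ) : OpImp a b c d ↔ OpImp (J a) (J b) (J c) (J d) :=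
  ((((((h.base₁₁ hγ).right hγ).right hγ).right hγ).right hγ).left hγ).iff₄ hγ ha hb hc hd

theorem BMap.opAll {a b c d : VModel δ} (ha : a.rk < γ) (hb : b.rk < γ) (hc : c.rk < γ)
    (hd : d.rk < γ) : OpAll a b c d ↔ OpAll (J a) (J b) (J c) (J d) :=
  ((((((h.base₁₁ hγ).right hγ).right hγ).right hγ).right hγ).right hγ).iff₄ hγ ha hb hc hd

/-- An ordinal is its own rank, and `J` commutes with the rank function; so ordinals go to ordinals.
-/
theorem BMap.ord {a : Ordinal.{u}} (ha : a < γ) (ha' : a < δ) :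
    J (ord a) = VopenkaScheme.ord (J (ord a)).rk := by
  have := h.rkF hγ (x := VopenkaScheme.ord a) (by rwa [rk_ord ha'])
  rwa [VopenkaScheme.rkF, rk_ord ha'] at this

theorem BMap.ord_rk {x : VModel δ} (hx : x.rk < γ) :
    J (VopenkaScheme.ord x.rk) = VopenkaScheme.ord (J x).rk := h.rkF hγ hx

theorem BMap.vv {a : Ordinal.{u}} (ha : a < γ) (ha' : a < δ) :
    J (vv a) = VopenkaScheme.vv (J (VopenkaScheme.ord a)).rk := by
  have := h.vF hγ (x := VopenkaScheme.ord a) (by rwa [rk_ord ha'])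
  rwa [VopenkaScheme.vF, rk_ord ha'] at this

/-- The value of a function whose domain is fixed pointwise. -/
theorem BMap.fn_apply {t d : VModel δ} (htd : IsFn t d) (ht : t.rk < γ) (hd : d.rk < γ)
    (hJd : J d = d) (hi : ∀ i ∈ d, J i = i) {i y' : VModel δ} :
    i.pr y' ∈ J t ↔ ∃ y, y' = J y ∧ i.pr y ∈ t := by
  have hJ : IsFn (J t) d := by
    have := (h.isFn hγ ht hd).1 htd
    rwa [hJd] at this
  have key : ∀ i ∈ d, ∀ y, i.pr y ∈ t → i.pr (J y) ∈ J t := by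
    intro i hid y hy
    have hr := VModel.rk_lt_of_mem hy
    have h1 := (h.mem hγ (hr.trans ht) ht).1 hy
    rwa [h.pr i y ((lt_rk_of_pr_left.trans hr).trans ht)
      ((lt_rk_of_pr_right.trans hr).trans ht), hi i hid] at h1
  constructor
  · intro hy'
    obtain ⟨i', hi', y₁, he⟩ := hJ.1 _ hy'
    obtain ⟨rfl, rfl⟩ := VModel.pr_inj.1 he
    obtain ⟨y, hy, -⟩ := htd.2 i hi'
    -- `J t` is a function on the same domain and already takes the value `J y` at `i'`, so
    -- uniqueness of values identifies `y'`.
    obtain ⟨y₂, -, hy₂⟩ := hJ.2 i hi'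
    exact ⟨y, by rw [hy₂ _ hy', hy₂ _ (key i hi' y hy)], hy⟩
  · rintro ⟨y, rfl, hy⟩
    obtain ⟨i', hi', y₁, he⟩ := htd.1 _ hy
    obtain ⟨rfl, rfl⟩ := VModel.pr_inj.1 he
    exact key i hi' y hy

/-- Since ω and all natural numbers are fixed, the image of an ω-sequence is the sequence of images.
-/
theorem BMap.isAsg (hω : Ordinal.omega0 < γ) {t : VModel δ} {s : ℕ → VModel δ} (ht : IsAsg t s)
    (htγ : t.rk < γ) : IsAsg (J t) (fun n => J (s n)) := by
  have hom : (VopenkaScheme.om : VModel δ).rk < γ := by rwa [rk_om]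
  have hfix : ∀ i ∈ (VopenkaScheme.om : VModel δ), J i = i := by
    intro i hi
    obtain ⟨n, rfl⟩ := mem_om.1 hi
    exact h.nat hγ hω n
  have hJ : IsFn (J t) VopenkaScheme.om := by
    have := (h.isFn hγ htγ hom).1 ht.isFn
    rwa [h.om hγ hω] at this
  intro z
  constructor
  · intro hz
    obtain ⟨i, -, y', rfl⟩ := hJ.1 z hz
    obtain ⟨y, rfl, hy⟩ := (h.fn_apply hγ ht.isFn htγ hom (h.om hγ hω) hfix).1 hz
    obtain ⟨n, rfl, rfl⟩ := ht.pr_mem'.1 hy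
    exact ⟨n, rfl⟩
  · rintro ⟨n, rfl⟩
    exact (h.fn_apply hγ ht.isFn htγ hom (h.om hγ hω) hfix).2 ⟨s n, rfl, ht.pr_mem.2 rfl⟩

/-- If all ordinals up to `ρ` are fixed, so are all sets of rank at most `ρ`. -/
theorem BMap.fix_of_ord {ρ : Ordinal.{u}} (hρ : ρ < γ)
    (hfix : ∀ a ≤ ρ, J (VopenkaScheme.ord a) = VopenkaScheme.ord a) (x : VModel δ)
    (hx : x.rk ≤ ρ) : J x = x := by
  have hrk : ∀ y : VModel δ, y.rk ≤ ρ → (J y).rk = y.rk := by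
    intro y hy
    have := h.ord_rk hγ (hy.trans_lt hρ)
    rw [hfix _ hy, ord_inj y.rk_lt (J y).rk_lt] at this
    exact this.symm
  induction ha : x.rk using WellFoundedLT.induction generalizing x with
  | ind a ih =>
    subst ha
    refine VModel.ext' fun z => ⟨fun hz => ?_, fun hz => ?_⟩
    -- `J` preserves the rank of `x`, so elements of `J x` also have rank below that of `x` and are
    -- fixed by induction.
    · have hzx : z.rk < x.rk := by
        rw [← hrk x hx]; exact VModel.rk_lt_of_mem hz
      rw [h.mem hγ (hzx.trans (hx.trans_lt hρ)) (hx.trans_lt hρ), ih _ hzx z (hzx.le.trans hx) rfl]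
      exact hz
    · have hzx := VModel.rk_lt_of_mem hz
      have := (h.mem hγ (hzx.trans (hx.trans_lt hρ)) (hx.trans_lt hρ)).1 hz
      rwa [ih _ hzx z (hzx.le.trans hx) rfl] at this

end Base

/-! ### Jónsson functions and Kunen's theorem -/

/-- Recursion along a well-order of `I` of least order type: at each stage fewer than |I| values are
used up, while `S i` has at least |I| elements. -/
theorem exists_injective_choice {I B : Type*} (S : I → Set B)
    (hS : ∀ i, Nonempty (I ↪ S i)) : ∃ c : I → B, Function.Injective c ∧ ∀ i, c i ∈ S i := by
  classical
  obtain ⟨r, hr, hrI⟩ := Cardinal.exists_ord_eq I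
  have hlt : ∀ i, Cardinal.mk {j // r j i} < Cardinal.mk I := by
    intro i
    rw [← Ordinal.card_typein]
    exact Cardinal.card_typein_lt i hrI
  have hex : ∀ i (c : ∀ j, r j i → B), ∃ b ∈ S i, ∀ j hj, c j hj ≠ b := by
    intro i c
    -- If all of `S i` were used up, assigning to each of its elements an earlier index that took it
    -- would inject `I` into the predecessors of `i`.
    by_contra! hcon
    obtain ⟨e⟩ := hS i
    refine (hlt i).not_ge ?_
    choose g hg hg' using hcon
    refine Cardinal.mk_le_of_injective (f := fun k => ⟨g (e k).1 (e k).2, hg _ (e k).2⟩) ?_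
    intro k k' hk
    have h1 : g (e k).1 (e k).2 = g (e k').1 (e k').2 := congrArg Subtype.val hk
    refine e.injective (Subtype.ext ?_)
    rw [← hg' _ (e k).2, ← hg' _ (e k').2]
    congr 1
  let c : I → B := hr.wf.fix fun i c => (hex i c).choose
  have hc : ∀ i, c i = (hex i fun j _ => c j).choose := fun i => hr.wf.fix_eq _ i
  refine ⟨c, ?_, fun i => by rw [hc]; exact (hex i _).choose_spec.1⟩
  have hne : ∀ j i, r j i → c j ≠ c i := fun j i hji => by
    rw [hc i]; exact (hex i fun j _ => c j).choose_spec.2 j hji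
  intro i j hij
  rcases trichotomous_of r i j with h | h | h
  · exact (hne _ _ h hij).elim
  · exact h
  · exact (hne _ _ h hij.symm).elim

/-- The Erdős–Hajnal construction. If `W` injects into `X`, then X^ω contains a copy of W^ω, hence
at least as many sequences as there are pairs (X, w). So distinct sequences in X^ω can be chosen for
all these pairs, and `F` sends the sequence chosen for (X, w) to w. -/
theorem exists_jonsson {W : Type*} (e : (Set W × W) ↪ (ℕ → W)) :
    ∃ F : (ℕ → W) → W, ∀ X : Set W, (∃ f : W → X, Function.Injective f) →
      ∀ w, ∃ s : ℕ → W, (∀ n, s n ∈ X) ∧ F s = w := by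
  classical
  obtain ⟨c, hc, hcS⟩ := exists_injective_choice
    (I := {p : Set W × W // ∃ f : W → p.1, Function.Injective f})
    (fun p => {s : ℕ → W | ∀ n, s n ∈ p.1.1}) (by
      rintro ⟨⟨X, w⟩, f, hf⟩
      refine ⟨⟨fun p => ⟨fun n => (f (e p.1 n)).1, fun n => (f _).2⟩, ?_⟩⟩
      intro p q hpq
      refine Subtype.ext (e.injective (funext fun n => hf (Subtype.ext ?_)))
      exact congrFun (congrArg Subtype.val hpq) n)
  -- The value `s 0` at sequences that were not chosen is arbitrary.
  refine ⟨fun s => if h : ∃ p, c p = s then h.choose.1.2 else s 0, fun X hX w => ?_⟩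
  refine ⟨c ⟨(X, w), hX⟩, hcS ⟨(X, w), hX⟩, ?_⟩
  have h : ∃ p, c p = c ⟨(X, w), hX⟩ := ⟨_, rfl⟩
  simp only [dif_pos h, hc h.choose_spec]

/-- Cofinality ω enters here: a subset of V_{β+ω} is determined by its intersections with the
V_{β+n}, each of which is an element of V_{β+ω}. Hence there are enough ω-sequences for
`exists_jonsson`. -/
theorem exists_jon {β : Ordinal.{u}} (hβ : β < δ) :
    ∃ F : VModel δ, F.rk < β + Ordinal.omega0 + Ordinal.omega0 ∧
      Jon F (vv (β + Ordinal.omega0)) := by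
  classical
  set η := β + Ordinal.omega0 with hη
  have hηδ : η < δ := add_omega_lt hβ
  have hlim : Order.IsSuccLimit η := isSuccLimit_add_omega β
  have hsub : ∀ (X : Set {x : VModel δ // x ∈ (vv η : VModel δ)}) (n : ℕ),
      ∃ b : {x : VModel δ // x ∈ (vv η : VModel δ)},
        ∀ x, x ∈ b.1 ↔ ∃ h : x ∈ (vv η : VModel δ), ⟨x, h⟩ ∈ X ∧ x.rk < β + n := by
    intro X n
    have hn : β + n < η := by
      rw [hη]; exact add_lt_add_right (Ordinal.natCast_lt_omega0 n) _
    obtain ⟨b, hb, hb'⟩ := VModel.exists_set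
      (fun x => ∃ h : x ∈ (vv η : VModel δ), ⟨x, h⟩ ∈ X ∧ x.rk < β + n)
      (hn.trans hηδ) (by rintro x ⟨_, _, h⟩; exact h)
    exact ⟨⟨b, (mem_vv hηδ).2 (hb.trans_lt hn)⟩, hb'⟩
  choose b hb using hsub
  -- The point `w` is put in place 0 and the pieces of `X` in the later places.
  let e : (Set {x : VModel δ // x ∈ (vv η : VModel δ)} × {x : VModel δ // x ∈ (vv η : VModel δ)}) ↪
      (ℕ → {x : VModel δ // x ∈ (vv η : VModel δ)}) :=
    ⟨fun p n => Nat.casesOn n p.2 (fun n => b p.1 n), by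
      rintro ⟨X, w⟩ ⟨X', w'⟩ h
      have h0 : w = w' := congrFun h 0
      have h1 : ∀ n, b X n = b X' n := fun n => congrFun h (n + 1)
      have key : ∀ X X', (∀ n, b X n = b X' n) → X ⊆ X' := by
        rintro X X' h ⟨x, hx⟩ hxX
        obtain ⟨c, hc, hxc⟩ := (Ordinal.lt_add_iff_of_isSuccLimit Ordinal.isSuccLimit_omega0).1
          ((mem_vv hηδ).1 hx)
        obtain ⟨n, rfl⟩ := Ordinal.lt_omega0.1 hc
        have h3 := (hb X n x).2 ⟨hx, hxX, hxc⟩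
        rw [h n] at h3
        exact ((hb X' n x).1 h3).2.1
      rw [h0, (key X X' h1).antisymm (key X' X fun n => (h1 n).symm)]⟩
  obtain ⟨F, hF⟩ := exists_jonsson e
  have hpr : ∀ t w : VModel δ, IsSeq t (vv η) → w ∈ (vv η : VModel δ) →
      (t.pr w).rk < Order.succ (Order.succ (Order.succ η)) := by
    intro t w ht hw
    rw [rk_pr, Order.succ_lt_succ_iff, Order.succ_lt_succ_iff, Order.lt_succ_iff]
    refine max_le (VModel.rk_le_iff.2 fun z hz => ?_) ((mem_vv hηδ).1 hw).le
    obtain ⟨i, hi, y, rfl⟩ := ht.1.1 z hz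
    refine rk_pr_lt hlim ?_ ((mem_vv hηδ).1 (ht.2 _ _ hz))
    refine (VModel.rk_lt_of_mem hi).trans_le ?_
    rw [rk_om]; exact le_add_self
  have h3 : Order.succ (Order.succ (Order.succ η)) < η + Ordinal.omega0 := by
    have h := isSuccLimit_add_omega η
    exact h.succ_lt (h.succ_lt (h.succ_lt (isLeast_add_omega η).1.2))
  obtain ⟨G, hG, hG'⟩ := VModel.exists_set
    (fun p => ∃ (t : VModel δ) (s : ℕ → {x : VModel δ // x ∈ (vv η : VModel δ)}),
      IsAsg t (fun n => (s n).1) ∧ p = t.pr (F s).1)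
    (h3.trans (add_omega_lt hηδ)) (by
      rintro _ ⟨t, s, hs, rfl⟩
      exact hpr _ _ (hs.isSeq fun n => (s n).2) (F s).2)
  refine ⟨G, hG.trans_lt h3, fun t ht => ?_, fun t w w' h1 h2 => ?_, fun X hX ⟨f, hf⟩ w hw => ?_⟩
  · obtain ⟨s, hs, hs'⟩ := ht.exists_asg
    exact ⟨_, (F fun n => ⟨s n, hs' n⟩).2, (hG' _).2 ⟨t, fun n => ⟨s n, hs' n⟩, hs, rfl⟩⟩
  · obtain ⟨t₁, s₁, hs₁, he₁⟩ := (hG' _).1 h1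
    obtain ⟨t₂, s₂, hs₂, he₂⟩ := (hG' _).1 h2
    obtain ⟨rfl, rfl⟩ := VModel.pr_inj.1 he₁
    obtain ⟨rfl, rfl⟩ := VModel.pr_inj.1 he₂
    have : s₁ = s₂ := funext fun n => Subtype.ext (congrFun (hs₁.inj hs₂) n)
    rw [this]
  · obtain ⟨hf1, hf2, hf3⟩ := hf
    obtain ⟨s, hs, hs'⟩ := hF {x | x.1 ∈ X} (by
      choose g hg _ using hf1.2
      refine ⟨fun x => ⟨⟨g x.1 x.2, hX _ (hf2 _ _ (hg _ _))⟩, hf2 _ _ (hg _ _)⟩, ?_⟩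
      intro x x' hxx
      have he : g x.1 x.2 = g x'.1 x'.2 := congrArg (fun z => z.1.1) hxx
      refine Subtype.ext (hf3 _ _ _ (hg x.1 x.2) ?_)
      rw [he]
      exact hg _ _) ⟨w, hw⟩
    obtain ⟨t, ht, -⟩ := exists_isAsg (ρ := η) le_add_self hηδ (fun n => (s n).1)
      fun n => (mem_vv hηδ).1 (s n).2
    refine ⟨t, ht.isSeq hs, (hG' _).2 ⟨t, s, ht, ?_⟩⟩
    rw [hs']

/-- Kunen's theorem: a map that respects the basic predicates and fixes `V_{β+ω}` is the identity
on it. -/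
theorem BMap.eq_self {γ : Ordinal.{u}} {J : VModel δ → VModel δ} (h : BMap Base γ J)
    (hγ : Order.IsSuccLimit γ) {β : Ordinal.{u}} (hβ : β < δ)
    (hβγ : β + Ordinal.omega0 + Ordinal.omega0 ≤ γ)
    (hJ : J (VopenkaScheme.vv (β + Ordinal.omega0)) = VopenkaScheme.vv (β + Ordinal.omega0))
    {x : VModel δ} (hx : x.rk < β + Ordinal.omega0) : J x = x := by
  set η := β + Ordinal.omega0 with hη
  have hηδ : η < δ := add_omega_lt hβ
  have hlim : Order.IsSuccLimit η := isSuccLimit_add_omega β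
  have hηγ : η < γ := (isLeast_add_omega η).1.2.trans_le hβγ
  have hωγ : Ordinal.omega0 < γ := le_add_self.trans_lt hηγ
  have hWγ : (VopenkaScheme.vv η : VModel δ).rk < γ := by rwa [rk_vv hηδ]
  have hW : ∀ x ∈ (VopenkaScheme.vv η : VModel δ), J x ∈ (VopenkaScheme.vv η : VModel δ) := by
    intro x hx
    rw [← hJ]
    exact (h.mem hγ (((mem_vv hηδ).1 hx).trans hηγ) hWγ).1 hx
  -- Surjectivity is the core. The image of a Jónsson function for V_η is again one for V_η, so it
  -- attains every `w` at a sequence from the pointwise image of V_η; pulling this sequence back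
  -- along `J` exhibits `w` as a value of `J`.
  have honto : ∀ w ∈ (VopenkaScheme.vv η : VModel δ),
      ∃ x ∈ (VopenkaScheme.vv η : VModel δ), J x = w := by
    intro w hw
    obtain ⟨F, hF, hJon⟩ := exists_jon hβ
    have hF' := hF.trans_le hβγ
    have hJon' := (h.jon hγ hF' hWγ).1 hJon
    rw [hJ] at hJon'
    -- `X` is the pointwise image of V_η, and `e`, the graph of `J` on V_η, witnesses that it has
    -- the cardinality of V_η.
    obtain ⟨X, -, hX⟩ := VModel.exists_set (fun y => ∃ x ∈ (VopenkaScheme.vv η : VModel δ), y = J x)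
      hηδ (by rintro _ ⟨x, hx, rfl⟩; exact (mem_vv hηδ).1 (hW x hx))
    obtain ⟨e, -, he⟩ := VModel.exists_set
      (fun p => ∃ x ∈ (VopenkaScheme.vv η : VModel δ), p = x.pr (J x)) hηδ (by
        rintro _ ⟨x, hx, rfl⟩
        exact rk_pr_lt hlim ((mem_vv hηδ).1 hx) ((mem_vv hηδ).1 (hW x hx)))
    have he' : ∀ x y : VModel δ, x.pr y ∈ e ↔ x ∈ (VopenkaScheme.vv η : VModel δ) ∧ y = J x := by
      intro x y
      rw [he]
      constructor
      · rintro ⟨x', hx', hp⟩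
        obtain ⟨rfl, rfl⟩ := VModel.pr_inj.1 hp
        exact ⟨hx', rfl⟩
      · rintro ⟨h1, rfl⟩
        exact ⟨x, h1, rfl⟩
    obtain ⟨t, ht, htw⟩ := hJon'.2.2 X (by
      intro y hy
      obtain ⟨x, hx, rfl⟩ := (hX y).1 hy
      exact hW x hx) ⟨e, ⟨by
        intro z hz
        obtain ⟨x, hx, rfl⟩ := (he z).1 hz
        exact ⟨x, hx, _, rfl⟩, fun i hi => ⟨J i, (he' _ _).2 ⟨hi, rfl⟩, fun y' hy' =>
          ((he' _ _).1 hy').2⟩⟩, fun x y hxy => (hX y).2 ⟨x, (he' _ _).1 hxy⟩, by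
        intro x x' y h1 h2
        obtain ⟨hx, rfl⟩ := (he' _ _).1 h1
        obtain ⟨hx', h3⟩ := (he' _ _).1 h2
        exact (h.inj hγ (((mem_vv hηδ).1 hx).trans hηγ) (((mem_vv hηδ).1 hx').trans hηγ)).2 h3⟩ w hw
    obtain ⟨s, hs, hsX⟩ := ht.exists_asg
    have hs' : ∀ n, ∃ x ∈ (VopenkaScheme.vv η : VModel δ), s n = J x := fun n => (hX _).1 (hsX n)
    choose s' hs' hss using hs'
    obtain ⟨t', ht', htr⟩ := exists_isAsg (ρ := η) le_add_self hηδ s'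
      fun n => (mem_vv hηδ).1 (hs' n)
    have ht'γ : t'.rk < γ := htr.trans_lt (hγ.succ_lt (hγ.succ_lt hηγ))
    have hJt : J t' = t := by
      refine (h.isAsg hγ hωγ ht' ht'γ).unique ?_
      simpa only [← hss] using hs
    obtain ⟨w', hw', htF⟩ := hJon.1 t' (ht'.isSeq hs')
    refine ⟨w', hw', ?_⟩
    have hw'γ := ((mem_vv hηδ).1 hw').trans hηγ
    have h1 := (h.mem hγ (rk_pr_lt hγ ht'γ hw'γ) hF').1 htF
    rw [h.pr _ _ ht'γ hw'γ, hJt] at h1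
    exact hJon'.2.1 _ _ _ h1 htw
  -- A surjection of a transitive set onto itself that preserves membership in both directions is
  -- the identity.
  induction x using VModel.induction with
  | h x ih =>
    have hxγ := hx.trans hηγ
    refine VModel.ext' fun z => ⟨fun hz => ?_, fun hz => ?_⟩
    · have hzW : z ∈ (VopenkaScheme.vv η : VModel δ) := by
        refine (mem_vv hηδ).2 ((VModel.rk_lt_of_mem hz).trans ?_)
        exact (mem_vv hηδ).1 (hW x ((mem_vv hηδ).2 hx))
      obtain ⟨y, hy, rfl⟩ := honto z hzW
      have hyγ := ((mem_vv hηδ).1 hy).trans hηγ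
      have hyx := (h.mem hγ hyγ hxγ).2 hz
      rwa [ih y hyx ((mem_vv hηδ).1 hy)]
    · have hzη := (VModel.rk_lt_of_mem hz).trans hx
      have := (h.mem hγ (hzη.trans hηγ) hxγ).1 hz
      rwa [ih z hz hzη] at this

end

/-! ### Tuples, coded structures and their satisfaction sets -/

section

variable {δ : Ordinal.{u}} [hδ : Nice δ]

/-- `u` is the set coding the tuple `x`. -/
def IsTup (u : VModel δ) {n : ℕ} (x : Fin n → VModel δ) : Prop :=
  ∀ z, z ∈ u ↔ ∃ i : Fin n, z = (nat i).pr (x i)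

theorem IsTup.pr_mem {u : VModel δ} {n : ℕ} {x : Fin n → VModel δ} (h : IsTup u x)
    {i y : VModel δ} : i.pr y ∈ u ↔ ∃ k : Fin n, i = nat k ∧ y = x k := by
  rw [h]
  exact exists_congr fun _ => VModel.pr_inj

theorem mem_nat {n : ℕ} {x : VModel δ} : x ∈ (nat n : VModel δ) ↔ ∃ i : Fin n, x = nat i := by
  rw [nat, mem_ord (natCast_lt n)]
  constructor
  · rintro ⟨b, hb, rfl⟩
    obtain ⟨m, rfl⟩ := Ordinal.lt_omega0.1 (hb.trans (Ordinal.natCast_lt_omega0 n))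
    exact ⟨⟨m, by exact_mod_cast hb⟩, rfl⟩
  · rintro ⟨i, rfl⟩
    exact ⟨i, by exact_mod_cast i.2, rfl⟩

theorem IsTup.isFn {u : VModel δ} {n : ℕ} {x : Fin n → VModel δ} (h : IsTup u x) :
    IsFn u (nat n) := by
  refine ⟨fun z hz => ?_, fun i hi => ?_⟩
  · obtain ⟨i, rfl⟩ := (h z).1 hz
    exact ⟨_, mem_nat.2 ⟨i, rfl⟩, _, rfl⟩
  · obtain ⟨k, rfl⟩ := mem_nat.1 hi
    refine ⟨x k, h.pr_mem.2 ⟨k, rfl, rfl⟩, fun y' hy' => ?_⟩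
    obtain ⟨k', hk, rfl⟩ := h.pr_mem.1 hy'
    rw [Fin.ext (nat_inj.1 hk)]

theorem exists_isTup {γ : Ordinal.{u}} (hγ : Order.IsSuccLimit γ) (hω : Ordinal.omega0 < γ)
    (hγδ : γ ≤ δ) {n : ℕ} (x : Fin n → VModel δ) (hx : ∀ i, (x i).rk < γ) :
    ∃ u, IsTup u x ∧ u.rk < γ := by
  obtain ⟨ρ, hρ, hρ'⟩ : ∃ ρ < γ, ∀ i, (x i).rk ≤ ρ := by
    refine ⟨Finset.univ.sup fun i => (x i).rk, ?_, fun i => Finset.le_sup (f := fun i => (x i).rk) (Finset.mem_univ i)⟩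
    exact (Finset.sup_lt_iff hγ.bot_lt).2 fun i _ => hx i
  set μ := Order.succ (Order.succ (Order.succ (max Ordinal.omega0 ρ)))
  have hμ : μ < γ := hγ.succ_lt (hγ.succ_lt (hγ.succ_lt (max_lt hω hρ)))
  obtain ⟨u, h1, h2⟩ := VModel.exists_set (fun z => ∃ i : Fin n, z = (nat i).pr (x i))
    (hμ.trans_le hγδ) (by
      rintro _ ⟨i, rfl⟩
      rw [rk_pr, Order.succ_lt_succ_iff, Order.succ_lt_succ_iff, Order.lt_succ_iff, rk_nat]
      exact max_le_max (Ordinal.natCast_lt_omega0 _).le (hρ' i))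
  exact ⟨u, h2, h1.trans_lt hμ⟩

theorem BMap.isTup {γ : Ordinal.{u}} {J : VModel δ → VModel δ} (h : BMap Base γ J)
    (hγ : Order.IsSuccLimit γ) (hω : Ordinal.omega0 < γ) {u : VModel δ} {n : ℕ}
    {x : Fin n → VModel δ} (hu : IsTup u x) (huγ : u.rk < γ) :
    IsTup (J u) (fun i => J (x i)) := by
  have hn : (VopenkaScheme.nat n : VModel δ).rk < γ := by
    rw [rk_nat]; exact (Ordinal.natCast_lt_omega0 n).trans hω
  have hfix : ∀ i ∈ (VopenkaScheme.nat n : VModel δ), J i = i := by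
    intro i hi
    obtain ⟨k, rfl⟩ := mem_nat.1 hi
    exact h.nat hγ hω _
  have hJ : IsFn (J u) (VopenkaScheme.nat n) := by
    have := (h.isFn hγ huγ hn).1 hu.isFn
    rwa [h.nat hγ hω] at this
  intro z
  constructor
  · intro hz
    obtain ⟨i, -, y', rfl⟩ := hJ.1 z hz
    obtain ⟨y, rfl, hy⟩ := (h.fn_apply hγ hu.isFn huγ hn (h.nat hγ hω n) hfix).1 hz
    obtain ⟨n, rfl, rfl⟩ := hu.pr_mem.1 hy
    exact ⟨n, rfl⟩
  · rintro ⟨n, rfl⟩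
    exact (h.fn_apply hγ hu.isFn huγ hn (h.nat hγ hω _) hfix).2
      ⟨x n, rfl, hu.pr_mem.2 ⟨n, rfl, rfl⟩⟩

variable {F R : ZFSet.{u}}

/-- `m = ⟨c, ⟨fs, rs⟩⟩` is the code of the structure `M`. -/
structure Codes (M : CodedStructure F R) (m c fs rs : VModel δ) : Prop where
  eq : m = c.pr (fs.pr rs)
  carrier : c.1 = M.carrier
  funs : fs.1 = M.funs
  rels : rs.1 = M.rels

theorem exists_codes (M : CodedStructure F R) (m : VModel δ) (h : m.1 = M.code) :
    ∃ c fs rs, Codes M m c fs rs := by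
  have hp : ∀ x y : ZFSet.{u}, x.rank < (pair x y).rank ∧ y.rank < (pair x y).rank := by
    intro x y
    have h1 : ({x, y} : ZFSet).rank < (pair x y).rank := rank_lt_of_mem (by simp [pair])
    exact ⟨(rank_lt_of_mem (by simp)).trans h1, (rank_lt_of_mem (by simp)).trans h1⟩
  have hm : M.code.rank < δ := h ▸ m.rk_lt
  rw [CodedStructure.code] at hm
  have h1 := (hp _ _).1.trans hm
  have h2 := (hp _ _).2.trans hm
  have h3 := (hp _ _).1.trans h2
  have h4 := (hp _ _).2.trans h2
  refine ⟨toV M.carrier, toV M.funs, toV M.rels, ⟨?_, toV_val h1, toV_val h3, toV_val h4⟩⟩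
  rw [VModel.val_inj, VModel.pr_val, VModel.pr_val, toV_val h1, toV_val h3, toV_val h4, h]
  rfl

/-- An element of a coded structure as an element of `V_δ`. -/
def el {M : CodedStructure F R} (x : M.Carrier) : VModel δ := toV x.1

section codes

variable {M : CodedStructure F R} {m c fs rs : VModel δ} (h : Codes M m c fs rs)
include h

theorem Codes.el_val (x : M.Carrier) : (el x : VModel δ).1 = x.1 := by
  refine toV_val ((rank_lt_of_mem x.2).trans ?_)
  rw [← h.carrier]
  exact c.rk_lt

theorem Codes.el_mem (x : M.Carrier) : (el x : VModel δ) ∈ c := by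
  rw [VModel.mem_def, h.el_val, h.carrier]
  exact x.2

theorem Codes.exists_el {y : VModel δ} (hy : y ∈ c) : ∃ x : M.Carrier, el x = y := by
  have : y.1 ∈ M.carrier := by rwa [← h.carrier]
  exact ⟨⟨y.1, this⟩, VModel.val_inj.2 (h.el_val ⟨y.1, this⟩)⟩

theorem Codes.el_inj {x y : M.Carrier} : (el x : VModel δ) = el y ↔ x = y := by
  rw [VModel.val_inj, h.el_val, h.el_val]
  exact Subtype.ext_iff.symm

theorem Codes.isSeq_iff {t : VModel δ} :
    IsSeq t c ↔ ∃ s : ℕ → M.Carrier, IsAsg t (fun n => el (s n)) := by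
  constructor
  · intro ht
    obtain ⟨s, hs, hsc⟩ := ht.exists_asg
    choose s' hs' using fun n => h.exists_el (hsc n)
    exact ⟨s', by simpa only [hs'] using hs⟩
  · rintro ⟨s, hs⟩
    exact hs.isSeq fun n => h.el_mem _

theorem Codes.asg_inj {t : VModel δ} {s s' : ℕ → M.Carrier} (hs : IsAsg t (fun n => el (s n)))
    (hs' : IsAsg t (fun n => el (s' n))) : s = s' :=
  funext fun n => h.el_inj.1 (congrFun (hs.inj hs') n)

theorem Codes.tuple_eq {u : VModel δ} {n : ℕ} {x : Fin n → M.Carrier}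
    (hu : IsTup u (fun i => el (x i))) : u.1 = tuple (D := M.carrier) x := by
  have key : ∀ i : Fin n, ((nat i).pr (el (x i)) : VModel δ).1 =
      pair ((i : ℕ) : Ordinal.{u}).toZFSet (x i).1 := fun i => by
    rw [VModel.pr_val, h.el_val, nat, ord_val (natCast_lt _)]
  ext z
  refine Iff.trans ?_ (ZFSet.mem_range (f := fun i : Fin n =>
    pair ((i : ℕ) : Ordinal.{u}).toZFSet (x i).1)).symm
  constructor
  · intro hz
    obtain ⟨z, hz, rfl⟩ := VModel.exists_val hz
    obtain ⟨i, rfl⟩ := (hu z).1 hz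
    exact ⟨i, (key i).symm⟩
  · rintro ⟨i, rfl⟩
    have := (hu _).2 ⟨i, rfl⟩
    rw [VModel.mem_def, key] at this
    exact this

theorem Codes.rel_iff {n : ℕ} (r : (codedLang F R).Relations n) (x : Fin n → M.Carrier)
    {σ u : VModel δ} (hσ : σ.1 = symb r.1 n) (hu : IsTup u (fun i => el (x i))) :
    Structure.RelMap r x ↔ σ.pr u ∈ rs := by
  rw [VModel.mem_def, VModel.pr_val, hσ, h.tuple_eq hu, h.rels]
  rfl

theorem Codes.fun_iff {n : ℕ} (f : (codedLang F R).Functions n) (x : Fin n → M.Carrier)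
    (y : M.Carrier) {σ u : VModel δ} (hσ : σ.1 = symb f.1 n) (hu : IsTup u (fun i => el (x i))) :
    Structure.funMap f x = y ↔ σ.pr (u.pr (el y)) ∈ fs := by
  rw [VModel.mem_def, VModel.pr_val, VModel.pr_val, hσ, h.tuple_eq hu, h.funs, h.el_val]
  have hc := (M.existsUnique_funs n f.1 f.2 x).choose_spec
  constructor
  · rintro rfl
    exact hc.1
  · intro hy
    exact (hc.2 y hy).symm

end codes

/-- `Z` is the graph of the evaluation of the term `t` in `M` at `ω`-sequences. -/
def TSet (M : CodedStructure F R) {β : Type} (ix : β → ℕ) (t : (codedLang F R).Term β)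
    (Z : VModel δ) : Prop :=
  ∀ p, p ∈ Z ↔ ∃ (τ : VModel δ) (s : ℕ → M.Carrier), IsAsg τ (fun n => el (s n)) ∧
    p = τ.pr (el (t.realize fun b => s (ix b)))

/-- `Z` is the set of `ω`-sequences at which `φ` holds in `M`. -/
def FSet (M : CodedStructure F R) {n k : ℕ} (φ : (codedLang F R).BoundedFormula (Fin n) k)
    (Z : VModel δ) : Prop :=
  ∀ τ, τ ∈ Z ↔ ∃ s : ℕ → M.Carrier, IsAsg τ (fun n => el (s n)) ∧
    φ.Realize (fun i => s i) (fun l => s (n + l))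

section codes

variable {M : CodedStructure F R} {m c fs rs : VModel δ} (h : Codes M m c fs rs)
include h

theorem Codes.asg_rk {t : VModel δ} {s : ℕ → M.Carrier} (ht : IsAsg t (fun n => el (s n))) :
    t.rk ≤ Order.succ (Order.succ (max Ordinal.omega0 c.rk)) := by
  have h1 : max Ordinal.omega0 c.rk < δ := max_lt hδ.omega_lt c.rk_lt
  obtain ⟨t', ht', hr⟩ := exists_isAsg (le_max_left _ c.rk) h1 (fun n => el (s n))
    fun n => (VModel.rk_lt_of_mem (h.el_mem (s n))).trans_le (le_max_right _ _)
  rwa [ht.unique ht']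

theorem Codes.exists_asg (s : ℕ → M.Carrier) : ∃ t : VModel δ, IsAsg t (fun n => el (s n)) := by
  obtain ⟨t', ht', hr⟩ := exists_isAsg (le_max_left _ c.rk) (max_lt hδ.omega_lt c.rk_lt)
    (fun n => el (s n))
    fun n => (VModel.rk_lt_of_mem (h.el_mem (s n))).trans_le (le_max_right _ _)
  exact ⟨t', ht'⟩

theorem Codes.exists_tSet {γ : Ordinal.{u}} (hγ : Order.IsSuccLimit γ)
    (hω : Ordinal.omega0 < γ) (hγδ : γ ≤ δ) (hc : c.rk < γ) {β : Type} (ix : β → ℕ)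
    (t : (codedLang F R).Term β) : ∃ Z : VModel δ, TSet M ix t Z ∧ Z.rk < γ := by
  set μ := Order.succ (Order.succ (Order.succ (Order.succ (Order.succ
    (max Ordinal.omega0 c.rk)))))
  have hμ : μ < γ := hγ.succ_lt (hγ.succ_lt (hγ.succ_lt (hγ.succ_lt (hγ.succ_lt
    (max_lt hω hc)))))
  obtain ⟨Z, h1, h2⟩ := VModel.exists_set (fun p => ∃ (τ : VModel δ) (s : ℕ → M.Carrier),
    IsAsg τ (fun n => el (s n)) ∧ p = τ.pr (el (t.realize fun b => s (ix b))))
    (hμ.trans_le hγδ) (by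
      rintro _ ⟨τ, s, hs, rfl⟩
      rw [rk_pr, Order.succ_lt_succ_iff, Order.succ_lt_succ_iff, Order.lt_succ_iff]
      refine max_le (h.asg_rk hs) ?_
      refine (VModel.rk_lt_of_mem (h.el_mem _)).le.trans ((le_max_right Ordinal.omega0 _).trans ?_)
      exact (Order.le_succ _).trans (Order.le_succ _))
  exact ⟨Z, h2, h1.trans_lt hμ⟩

theorem Codes.exists_fSet {γ : Ordinal.{u}} (hγ : Order.IsSuccLimit γ)
    (hω : Ordinal.omega0 < γ) (hγδ : γ ≤ δ) (hc : c.rk < γ) {n k : ℕ}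
    (φ : (codedLang F R).BoundedFormula (Fin n) k) : ∃ Z : VModel δ, FSet M φ Z ∧ Z.rk < γ := by
  set μ := Order.succ (Order.succ (Order.succ (max Ordinal.omega0 c.rk)))
  have hμ : μ < γ := hγ.succ_lt (hγ.succ_lt (hγ.succ_lt (max_lt hω hc)))
  obtain ⟨Z, h1, h2⟩ := VModel.exists_set (fun τ => ∃ (s : ℕ → M.Carrier),
    IsAsg τ (fun n => el (s n)) ∧ φ.Realize (fun i => s i) (fun l => s (n + l)))
    (hμ.trans_le hγδ) (by
      rintro τ ⟨s, hs, -⟩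
      rw [Order.lt_succ_iff]
      exact h.asg_rk hs)
  exact ⟨Z, h2, h1.trans_lt hμ⟩

/-- This and the lemmas for the other operations below are Tarski's clauses: each operation
characterises the evaluation graph or satisfaction set of a compound expression in terms of those of
its parts. Assignments are ω-sequences, so that one format serves all formulas. -/
theorem Codes.opVar_iff {β : Type} {ix : β → ℕ} {b : β} {Z : VModel δ} :
    OpVar Z (nat (ix b)) c ↔ TSet M ix (Term.var b) Z := by
  refine forall_congr' fun p => iff_congr Iff.rfl ?_
  constructor
  · rintro ⟨t, y, rfl, ht, hy⟩
    obtain ⟨s, hs⟩ := h.isSeq_iff.1 ht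
    refine ⟨t, s, hs, ?_⟩
    rw [hs.pr_mem.1 hy]
    rfl
  · rintro ⟨t, s, hs, rfl⟩
    exact ⟨t, _, rfl, h.isSeq_iff.2 ⟨s, hs⟩, hs.pr_mem.2 rfl⟩

theorem Codes.tSet_pr {β : Type} {ix : β → ℕ} {t : (codedLang F R).Term β} {Z : VModel δ}
    (hZ : TSet M ix t Z) {τ y : VModel δ} {s : ℕ → M.Carrier} (hs : IsAsg τ (fun n => el (s n))) :
    τ.pr y ∈ Z ↔ y = el (t.realize fun b => s (ix b)) := by
  rw [hZ]
  constructor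
  · rintro ⟨τ', s', hs', he⟩
    obtain ⟨rfl, rfl⟩ := VModel.pr_inj.1 he
    rw [h.asg_inj hs hs']
  · rintro rfl
    exact ⟨τ, s, hs, rfl⟩

theorem Codes.ev_iff {β : Type} {ix : β → ℕ} {l : ℕ} {ts : Fin l → (codedLang F R).Term β}
    {Zs : Fin l → VModel δ} (hZ : ∀ i, TSet M ix (ts i) (Zs i)) {G : VModel δ} (hG : IsTup G Zs)
    {τ u : VModel δ} {s : ℕ → M.Carrier} (hs : IsAsg τ (fun n => el (s n))) :
    Ev u G τ ↔ IsTup u (fun i => el ((ts i).realize fun b => s (ix b))) := by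
  refine forall_congr' fun z => iff_congr Iff.rfl ?_
  constructor
  · rintro ⟨i, g, y, rfl, hg, hy⟩
    obtain ⟨k, rfl, rfl⟩ := hG.pr_mem.1 hg
    exact ⟨k, by rw [(h.tSet_pr (hZ k) hs).1 hy]⟩
  · rintro ⟨i, rfl⟩
    exact ⟨_, _, _, rfl, hG.pr_mem.2 ⟨i, rfl, rfl⟩, (h.tSet_pr (hZ i) hs).2 rfl⟩

theorem Codes.exists_tup {l : ℕ} (x : Fin l → M.Carrier) :
    ∃ u : VModel δ, IsTup u (fun i => el (x i)) := by
  have hl := isSuccLimit_add_omega (max Ordinal.omega0 c.rk)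
  have hlt := (isLeast_add_omega (max Ordinal.omega0 c.rk)).1.2
  obtain ⟨u, hu, -⟩ := exists_isTup hl ((le_max_left _ _).trans_lt hlt)
    (add_omega_lt (max_lt hδ.omega_lt c.rk_lt)).le (fun i => (el (x i) : VModel δ)) fun i =>
      (VModel.rk_lt_of_mem (h.el_mem _)).trans ((le_max_right _ _).trans_lt hlt)
  exact ⟨u, hu⟩

theorem Codes.opFun_iff {β : Type} {ix : β → ℕ} {l : ℕ} {ts : Fin l → (codedLang F R).Term β}
    {Zs : Fin l → VModel δ} (hZ : ∀ i, TSet M ix (ts i) (Zs i)) {G : VModel δ} (hG : IsTup G Zs)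
    {f : (codedLang F R).Functions l} {σ : VModel δ} (hσ : σ.1 = symb f.1 l) {Z : VModel δ} :
    OpFun Z G σ m ↔ TSet M ix (Term.func f ts) Z := by
  have key : ∀ p : VModel δ, (∃ t y, p = VModel.pr t y ∧ IsSeq t c ∧
      ∃ u, Ev u G t ∧ σ.pr (u.pr y) ∈ fs) ↔
      ∃ (τ : VModel δ) (s : ℕ → M.Carrier), IsAsg τ (fun n => el (s n)) ∧
        p = τ.pr (el ((Term.func f ts).realize fun b => s (ix b))) := by
    intro p
    constructor
    · rintro ⟨t, y, rfl, ht, u, hu, hy⟩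
      obtain ⟨s, hs⟩ := h.isSeq_iff.1 ht
      refine ⟨t, s, hs, ?_⟩
      have hu' := (h.ev_iff hZ hG hs).1 hu
      -- Everything in `funs` has the prescribed form, so values lie in the carrier.
      have hyc : y ∈ c := by
        have h1 := hy
        rw [VModel.mem_def, VModel.pr_val, VModel.pr_val, h.funs] at h1
        obtain ⟨n, s, x, y', -, he⟩ := M.mem_funs _ h1
        have := (pair_inj.1 (pair_inj.1 he).2).2
        rw [VModel.mem_def, this, h.carrier]
        exact y'.2
      obtain ⟨y, rfl⟩ := h.exists_el hyc
      rw [Term.realize_func, (h.fun_iff f _ y hσ hu').2 hy]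
    · rintro ⟨t, s, hs, rfl⟩
      obtain ⟨u, hu⟩ := h.exists_tup (fun i => (ts i).realize fun b => s (ix b))
      exact ⟨t, _, rfl, h.isSeq_iff.2 ⟨s, hs⟩, u, (h.ev_iff hZ hG hs).2 hu,
        (h.fun_iff f _ _ hσ hu).1 rfl⟩
  constructor
  · rintro ⟨c', fs', rs', he, hp⟩ p
    rw [h.eq, VModel.pr_inj, VModel.pr_inj] at he
    rw [hp, ← he.1, ← he.2.1, key]
  · intro hT
    exact ⟨c, fs, rs, h.eq, fun p => by rw [hT, key]⟩

variable {n k : ℕ}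

/-- The position of a variable of a bounded formula in an `ω`-sequence. -/
def ix (n k : ℕ) : Fin n ⊕ Fin k → ℕ := Sum.elim (fun i => i) (fun l => n + l)

omit h in
theorem elim_ix {X : Type*} (s : ℕ → X) :
    Sum.elim (fun i : Fin n => s i) (fun l : Fin k => s (n + l)) = fun b => s (ix n k b) := by
  ext b
  cases b <;> rfl

theorem Codes.opRel_iff {l : ℕ} {ts : Fin l → (codedLang F R).Term (Fin n ⊕ Fin k)}
    {Zs : Fin l → VModel δ} (hZ : ∀ i, TSet M (ix n k) (ts i) (Zs i)) {G : VModel δ}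
    (hG : IsTup G Zs) {r : (codedLang F R).Relations l} {σ : VModel δ} (hσ : σ.1 = symb r.1 l)
    {Z : VModel δ} : OpRel Z G σ m ↔ FSet M (BoundedFormula.rel r ts) Z := by
  have key : ∀ t : VModel δ, (IsSeq t c ∧ ∃ u, Ev u G t ∧ σ.pr u ∈ rs) ↔
      ∃ s : ℕ → M.Carrier, IsAsg t (fun n => el (s n)) ∧
        (BoundedFormula.rel r ts).Realize (fun i => s i) (fun l => s (n + l)) := by
    intro t
    constructor
    · rintro ⟨ht, u, hu, hy⟩
      obtain ⟨s, hs⟩ := h.isSeq_iff.1 ht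
      refine ⟨s, hs, ?_⟩
      simp only [BoundedFormula.Realize, elim_ix]
      exact (h.rel_iff r _ hσ ((h.ev_iff hZ hG hs).1 hu)).2 hy
    · rintro ⟨s, hs, hr⟩
      simp only [BoundedFormula.Realize, elim_ix] at hr
      obtain ⟨u, hu⟩ := h.exists_tup (fun i => (ts i).realize fun b => s (ix n k b))
      exact ⟨h.isSeq_iff.2 ⟨s, hs⟩, u, (h.ev_iff hZ hG hs).2 hu, (h.rel_iff r _ hσ hu).1 hr⟩
  constructor
  · rintro ⟨c', fs', rs', he, hp⟩ p
    rw [h.eq, VModel.pr_inj, VModel.pr_inj] at he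
    rw [hp, ← he.1, ← he.2.2, key]
  · intro hT
    exact ⟨c, fs, rs, h.eq, fun p => by rw [hT, key]⟩

theorem Codes.opEq_iff {t t' : (codedLang F R).Term (Fin n ⊕ Fin k)} {G G' Z : VModel δ}
    (hG : TSet M (ix n k) t G) (hG' : TSet M (ix n k) t' G') :
    OpEq Z G G' c ↔ FSet M (BoundedFormula.equal t t') Z := by
  refine forall_congr' fun p => iff_congr Iff.rfl ?_
  rw [h.isSeq_iff, ← exists_and_right]
  refine exists_congr fun s => and_congr_right fun hs => ?_
  simp only [BoundedFormula.Realize, elim_ix, h.tSet_pr hG hs, h.tSet_pr hG' hs]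
  constructor
  · rintro ⟨y, rfl, hy⟩
    exact h.el_inj.1 hy
  · intro he
    exact ⟨_, rfl, by rw [he]⟩

theorem Codes.fSet_iff {φ : (codedLang F R).BoundedFormula (Fin n) k} {X : VModel δ}
    (hX : FSet M φ X) {τ : VModel δ} {s : ℕ → M.Carrier} (hs : IsAsg τ (fun n => el (s n))) :
    τ ∈ X ↔ φ.Realize (fun i => s i) (fun l => s (n + l)) := by
  rw [hX]
  constructor
  · rintro ⟨s', hs', hr⟩
    rwa [h.asg_inj hs hs']
  · intro hr
    exact ⟨s, hs, hr⟩

theorem Codes.opImp_iff {φ ψ : (codedLang F R).BoundedFormula (Fin n) k} {X Y Z : VModel δ}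
    (hX : FSet M φ X) (hY : FSet M ψ Y) : OpImp Z X Y c ↔ FSet M (φ.imp ψ) Z := by
  refine forall_congr' fun p => iff_congr Iff.rfl ?_
  rw [h.isSeq_iff, ← exists_and_right]
  refine exists_congr fun s => and_congr_right fun hs => ?_
  rw [h.fSet_iff hX hs, h.fSet_iff hY hs, BoundedFormula.realize_imp]

/-- The newly bound variable occupies place n + k, so quantifying it amounts to varying that single
entry of the sequence. -/
theorem Codes.opAll_iff {φ : (codedLang F R).BoundedFormula (Fin n) (k + 1)} {X Z : VModel δ}
    (hX : FSet M φ X) : OpAll Z X (nat (n + k)) c ↔ FSet M φ.all Z := by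
  classical
  refine forall_congr' fun p => iff_congr Iff.rfl ?_
  rw [h.isSeq_iff, ← exists_and_right]
  refine exists_congr fun s => and_congr_right fun hs => ?_
  rw [BoundedFormula.realize_all]
  have hup : ∀ (s' : ℕ → M.Carrier) (a : M.Carrier), s' = Function.update s (n + k) a →
      (φ.Realize (fun i => s' i) (fun l => s' (n + l)) ↔
        φ.Realize (fun i : Fin n => s i) (Fin.snoc (fun l : Fin k => s (n + l)) a)) := by
    rintro s' a rfl
    have h1 : (fun i : Fin n => Function.update s (n + k) a i) = fun i : Fin n => s i := by
      ext i
      rw [Function.update_of_ne (by omega)]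
    have h2 : (fun l : Fin (k + 1) => Function.update s (n + k) a (n + l)) =
        (Fin.snoc (fun l : Fin k => s (n + l)) a : Fin (k + 1) → M.Carrier) := by
      ext l
      refine Fin.lastCases ?_ (fun l => ?_) l
      · simp
      · rw [Fin.snoc_castSucc, Function.update_of_ne (by simp; omega)]
        rfl
    rw [h1, h2]
  constructor
  · intro hall a
    obtain ⟨t', ht'⟩ := h.exists_asg (Function.update s (n + k) a)
    have h1 := hall t' (h.isSeq_iff.2 ⟨_, ht'⟩) (by
      intro i hi hne y
      obtain ⟨j, rfl⟩ := mem_om.1 hi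
      rw [hs.pr_mem, ht'.pr_mem, Function.update_of_ne]
      rintro rfl
      exact hne rfl)
    exact (hup _ a rfl).1 ((h.fSet_iff hX ht').1 h1)
  · intro hall t' ht' hag
    obtain ⟨s', hs'⟩ := h.isSeq_iff.1 ht'
    refine (h.fSet_iff hX hs').2 ((hup s' (s' (n + k)) ?_).2 (hall _))
    ext j
    by_cases hj : j = n + k
    · subst hj; simp
    · rw [Function.update_of_ne hj]
      have := (hag (nat j) (mem_om.2 ⟨j, rfl⟩) (fun he => hj (nat_inj.1 he)) (el (s j))).1
        (hs.pr_mem.2 rfl)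
      exact (h.el_inj.1 (hs'.pr_mem.1 this)).symm

end codes

end

/-! ### Maps respecting `Base` are elementary on coded structures -/

section

variable {δ : Ordinal.{u}} [hδ : Nice δ]

variable {F R : ZFSet.{u}} {M N : CodedStructure F R} {m c fs rs : VModel δ}

theorem Codes.rk_lt (h : Codes M m c fs rs) : c.rk < m.rk ∧ fs.rk < m.rk ∧ rs.rk < m.rk := by
  rw [h.eq]
  exact ⟨lt_rk_of_pr_left, lt_rk_of_pr_left.trans lt_rk_of_pr_right,
    lt_rk_of_pr_right.trans lt_rk_of_pr_right⟩

section Elementary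

variable {γ : Ordinal.{u}} {J : VModel δ → VModel δ} (h : BMap Base γ J)
  (hγ : Order.IsSuccLimit γ) (hω : Ordinal.omega0 < γ) (hγδ : γ ≤ δ)
  (hM : Codes M m c fs rs) (hmγ : m.rk < γ)
include h hγ

theorem BMap.codes (hM : Codes M m c fs rs) (hmγ : m.rk < γ) (hN : (J m).1 = N.code) :
    Codes N (J m) (J c) (J fs) (J rs) := by
  obtain ⟨h1, h2, h3⟩ := hM.rk_lt
  have he : J m = (J c).pr ((J fs).pr (J rs)) := by
    rw [hM.eq, h.pr _ _ (h1.trans hmγ) (rk_pr_lt hγ (h2.trans hmγ) (h3.trans hmγ)),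
      h.pr _ _ (h2.trans hmγ) (h3.trans hmγ)]
  rw [he, VModel.pr_val, VModel.pr_val, CodedStructure.code, pair_inj, pair_inj] at hN
  exact ⟨he, hN.1, hN.2.1, hN.2.2⟩

variable (hN : Codes N (J m) (J c) (J fs) (J rs))
  (hF : ∀ n s, symb s n ∈ F → ∃ σ : VModel δ, σ.1 = symb s n ∧ σ.rk < γ ∧ J σ = σ)
  (hR : ∀ n s, symb s n ∈ R → ∃ σ : VModel δ, σ.1 = symb s n ∧ σ.rk < γ ∧ J σ = σ)
include hω hγδ hM hmγ hN hF

/-- Induction on the term: `J` respects the clauses for variables and function symbols, and fixes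
the symbols and the natural numbers. -/
theorem BMap.tSet {β : Type} (ix : β → ℕ) (t : (codedLang F R).Term β) {Z : VModel δ}
    (hZ : TSet M ix t Z) (hZγ : Z.rk < γ) : TSet N ix t (J Z) := by
  have hc := hM.rk_lt.1.trans hmγ
  induction t generalizing Z with
  | var b =>
    have h1 : (VopenkaScheme.nat (ix b) : VModel δ).rk < γ := by
      rw [rk_nat]; exact (Ordinal.natCast_lt_omega0 _).trans hω
    have := (h.opVar hγ hZγ h1 hc).1 (hM.opVar_iff.2 hZ)
    rw [h.nat hγ hω] at this
    exact hN.opVar_iff.1 this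
  | @func l f ts ih =>
    choose Zs hZs hZsγ using fun i => hM.exists_tSet hγ hω hγδ hc ix (ts i)
    obtain ⟨G, hG, hGγ⟩ := exists_isTup hγ hω hγδ Zs hZsγ
    obtain ⟨σ, hσ, hσγ, hJσ⟩ := hF l f.1 f.2
    have := (h.opFun hγ hZγ hGγ hσγ hmγ).1 ((hM.opFun_iff hZs hG hσ).2 hZ)
    rw [hJσ] at this
    exact (hN.opFun_iff (fun i => ih i (hZs i) (hZsγ i)) (h.isTup hγ hω hG hGγ) hσ).1 this

include hR

/-- The induction on φ takes place outside V_δ, one Tarski clause per step. Hence the single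
predicate `Base` serves formulas of every complexity. -/
theorem BMap.fSet {n k : ℕ} (φ : (codedLang F R).BoundedFormula (Fin n) k) {Z : VModel δ}
    (hZ : FSet M φ Z) (hZγ : Z.rk < γ) : FSet N φ (J Z) := by
  have hc := hM.rk_lt.1.trans hmγ
  induction φ generalizing Z with
  | falsum =>
    have : Z = VModel.emp := eq_emp fun t ht => by
      obtain ⟨s, -, hs⟩ := (hZ t).1 ht
      exact hs
    rw [this, h.emp]
    intro t
    exact ⟨fun ht => (VModel.notMem_emp ht).elim, fun ⟨_, _, hs⟩ => hs.elim⟩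
  | equal t t' =>
    obtain ⟨G, hG, hGγ⟩ := hM.exists_tSet hγ hω hγδ hc (ix _ _) t
    obtain ⟨G', hG', hGγ'⟩ := hM.exists_tSet hγ hω hγδ hc (ix _ _) t'
    exact (hN.opEq_iff (h.tSet hγ hω hγδ hM hmγ hN hF _ t hG hGγ)
      (h.tSet hγ hω hγδ hM hmγ hN hF _ t' hG' hGγ')).1
      ((h.opEq hγ hZγ hGγ hGγ' hc).1 ((hM.opEq_iff hG hG').2 hZ))
  | @rel k l r ts =>
    choose Zs hZs hZsγ using fun i => hM.exists_tSet hγ hω hγδ hc (ix _ _) (ts i)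
    obtain ⟨G, hG, hGγ⟩ := exists_isTup hγ hω hγδ Zs hZsγ
    obtain ⟨σ, hσ, hσγ, hJσ⟩ := hR l r.1 r.2
    have := (h.opRel hγ hZγ hGγ hσγ hmγ).1 ((hM.opRel_iff hZs hG hσ).2 hZ)
    rw [hJσ] at this
    exact (hN.opRel_iff (fun i => h.tSet hγ hω hγδ hM hmγ hN hF _ _ (hZs i) (hZsγ i))
      (h.isTup hγ hω hG hGγ) hσ).1 this
  | imp φ ψ ih₁ ih₂ =>
    obtain ⟨X, hX, hXγ⟩ := hM.exists_fSet hγ hω hγδ hc φ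
    obtain ⟨Y, hY, hYγ⟩ := hM.exists_fSet hγ hω hγδ hc ψ
    exact (hN.opImp_iff (ih₁ hX hXγ) (ih₂ hY hYγ)).1
      ((h.opImp hγ hZγ hXγ hYγ hc).1 ((hM.opImp_iff hX hY).2 hZ))
  | @all k φ ih =>
    obtain ⟨X, hX, hXγ⟩ := hM.exists_fSet hγ hω hγδ hc φ
    have h1 : (VopenkaScheme.nat (n + k) : VModel δ).rk < γ := by
      rw [rk_nat]; exact (Ordinal.natCast_lt_omega0 _).trans hω
    have := (h.opAll hγ hZγ hXγ h1 hc).1 ((hM.opAll_iff hX).2 hZ)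
    rw [h.nat hγ hω] at this
    exact (hN.opAll_iff (ih hX hXγ)).1 this

end Elementary

/-- A map that respects `Base` and the symbols of the language restricts to an elementary
embedding of a structure into its image. -/
theorem BMap.exists_elementaryEmbedding {γ : Ordinal.{u}} {J : VModel δ → VModel δ}
    (h : BMap Base γ J) (hγ : Order.IsSuccLimit γ) (hω : Ordinal.omega0 < γ) (hγδ : γ ≤ δ)
    (hm : m.1 = M.code) (hmγ : m.rk < γ) (hJm : (J m).1 = N.code)
    (hF : ∀ n s, symb s n ∈ F → ∃ σ : VModel δ, σ.1 = symb s n ∧ σ.rk < γ ∧ J σ = σ)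
    (hR : ∀ n s, symb s n ∈ R → ∃ σ : VModel δ, σ.1 = symb s n ∧ σ.rk < γ ∧ J σ = σ) :
    ∃ j : M.Carrier ↪ₑ[codedLang F R] N.Carrier, ∀ x, (el (j x) : VModel δ) = J (el x) := by
  obtain ⟨c, fs, rs, hM⟩ := exists_codes M m hm
  have hN := h.codes hγ hM hmγ hJm
  have hc := hM.rk_lt.1.trans hmγ
  choose j hj using fun x : M.Carrier => hN.exists_el
    ((h.mem hγ ((VModel.rk_lt_of_mem (hM.el_mem x)).trans hc) hc).1 (hM.el_mem x))
  refine ⟨⟨j, fun n φ x => ?_⟩, hj⟩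
  -- A finite assignment is padded to an ω-sequence by an arbitrary element.
  obtain ⟨d, hd⟩ := M.nonempty
  set s : ℕ → M.Carrier := fun i => if hi : i < n then x ⟨i, hi⟩ else ⟨d, hd⟩
  have hs : (fun i : Fin n => s i) = x := by
    ext i
    simp [s]
  obtain ⟨t, ht⟩ := hM.exists_asg s
  have htγ : t.rk < γ := (hM.asg_rk ht).trans_lt (hγ.succ_lt (hγ.succ_lt (max_lt hω hc)))
  have hJt := h.isAsg hγ hω ht htγ
  simp only [← hj] at hJt
  obtain ⟨Z, hZ, hZγ⟩ := hM.exists_fSet hγ hω hγδ hc (k := 0) φ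
  have h1 := hM.fSet_iff hZ ht
  have h2 := hN.fSet_iff (s := fun n => j (s n))
    (h.fSet hγ hω hγδ hM hmγ hN hF hR φ hZ hZγ) hJt
  -- Truth of φ at `x` is membership of the sequence in the satisfaction set, and `J` preserves
  -- membership.
  rw [← h.mem hγ htγ hZγ] at h2
  rw [Formula.Realize, Formula.Realize]
  convert (h2.symm.trans h1) using 2
  · rw [← hs]; rfl
  · rw [← hs]

end

section

variable {δ : Ordinal.{u}} [hδ : Nice δ]

/-! ### The structures `⟨V_α, ∈, A ∩ V_α⟩` as coded structures -/

theorem tuple_one {D : ZFSet.{u}} (x : Fin 1 → D) :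
    tuple x = {pair ((0 : ℕ) : Ordinal.{u}).toZFSet (x 0).1,
      pair ((0 : ℕ) : Ordinal.{u}).toZFSet (x 0).1} := by
  ext z
  refine (ZFSet.mem_range (f := fun i : Fin 1 =>
    pair ((i : ℕ) : Ordinal.{u}).toZFSet (x i).1)).trans ?_
  simp [eq_comm]

theorem tuple_two {D : ZFSet.{u}} (x : Fin 2 → D) :
    tuple x = {pair ((0 : ℕ) : Ordinal.{u}).toZFSet (x 0).1,
      pair ((1 : ℕ) : Ordinal.{u}).toZFSet (x 1).1} := by
  ext z
  refine (ZFSet.mem_range (f := fun i : Fin 2 =>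
    pair ((i : ℕ) : Ordinal.{u}).toZFSet (x i).1)).trans ?_
  simp [Fin.exists_fin_two, eq_comm]

/-- The set of symbols of the language of set theory with a unary predicate. -/
def predSymbs : ZFSet.{u} := {symb ∅ 1, symb ∅ 2}

theorem eq_of_symb_mem {s : ZFSet.{u}} {n : ℕ} (h : symb s n ∈ predSymbs) : s = ∅ := by
  rcases ZFSet.mem_pair.1 h with h | h <;> exact (pair_inj.1 h).1

/-- The element `w` belongs to the set of relations of the structure with underlying set `c`,
membership, and the predicate `P`. -/
def PredRel (P : VModel δ → Prop) (c w : VModel δ) : Prop :=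
  (∃ x y, x ∈ c ∧ y ∈ c ∧ x ∈ y ∧ w = (VModel.emp.pr (nat 2)).pr
    (((nat 0).pr x).upair ((nat 1).pr y))) ∨
  ∃ x, x ∈ c ∧ P x ∧ w = (VModel.emp.pr (nat 1)).pr (((nat 0).pr x).upair ((nat 0).pr x))

theorem rk_upair_lt {x y : VModel δ} {γ : Ordinal.{u}} (hγ : Order.IsSuccLimit γ) (hx : x.rk < γ)
    (hy : y.rk < γ) : (x.upair y).rk < γ := by
  rw [rk_upair]
  exact max_lt (hγ.succ_lt hx) (hγ.succ_lt hy)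

theorem exists_rels (P : VModel δ → Prop) {α : Ordinal.{u}} (hα : α < δ) :
    ∃ r : VModel δ, r.rk ≤ α + Ordinal.omega0 ∧ ∀ w, w ∈ r ↔ PredRel P (vv α) w := by
  have hl := isSuccLimit_add_omega α
  have hn : ∀ n : ℕ, (nat n : VModel δ).rk < α + Ordinal.omega0 := fun n => by
    rw [rk_nat]
    exact (Ordinal.natCast_lt_omega0 n).trans_le le_add_self
  have hm : ∀ x : VModel δ, x ∈ (vv α : VModel δ) → x.rk < α + Ordinal.omega0 := fun x hx =>
    ((mem_vv hα).1 hx).trans_le le_self_add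
  refine VModel.exists_set _ (add_omega_lt hα) ?_
  rintro _ (⟨x, y, hx, hy, -, rfl⟩ | ⟨x, hx, -, rfl⟩)
  · exact rk_pr_lt hl (rk_pr_lt hl (rk_emp_lt hl) (hn _))
      (rk_upair_lt hl (rk_pr_lt hl (hn _) (hm _ hx)) (rk_pr_lt hl (hn _) (hm _ hy)))
  · exact rk_pr_lt hl (rk_pr_lt hl (rk_emp_lt hl) (hn _))
      (rk_upair_lt hl (rk_pr_lt hl (hn _) (hm _ hx)) (rk_pr_lt hl (hn _) (hm _ hx)))

open Classical in
/-- The set of relations of the structure `⟨V_α, ∈, P⟩`. -/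
def relsV (P : VModel δ → Prop) (α : Ordinal.{u}) : VModel δ :=
  if h : α < δ then (exists_rels P h).choose else VModel.emp

theorem rk_relsV (P : VModel δ → Prop) {α : Ordinal.{u}} (hα : α < δ) :
    (relsV P α).rk ≤ α + Ordinal.omega0 := by
  rw [relsV, dif_pos hα]
  exact (exists_rels P hα).choose_spec.1

theorem mem_relsV {P : VModel δ → Prop} {α : Ordinal.{u}} (hα : α < δ) {w : VModel δ} :
    w ∈ relsV P α ↔ PredRel P (vv α) w := by
  rw [relsV, dif_pos hα]
  exact (exists_rels P hα).choose_spec.2 w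

theorem symb_val (n : ℕ) : ((VModel.emp : VModel δ).pr (nat n)).1 = symb ∅ n := by
  rw [VModel.pr_val, nat, ord_val (natCast_lt n)]
  rfl

theorem upair_nat_val (m n : ℕ) (x y : VModel δ) : (((nat m).pr x).upair ((nat n).pr y)).1 =
    {pair (m : Ordinal.{u}).toZFSet x.1, pair (n : Ordinal.{u}).toZFSet y.1} := by
  rw [VModel.upair_val, VModel.pr_val, VModel.pr_val, nat, nat, ord_val (natCast_lt m),
    ord_val (natCast_lt n)]

/-- The structure `⟨V_α, ∈, P⟩` as a coded structure. -/
def vstr (P : VModel δ → Prop) {α : Ordinal.{u}} (h0 : 0 < α) (hα : α < δ) :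
    CodedStructure ∅ predSymbs.{u} where
  carrier := V_ α
  funs := ∅
  rels := (relsV P α).1
  nonempty := ⟨∅, mem_vonNeumann.2 (by rwa [rank_empty])⟩
  mem_funs z hz := (ZFSet.notMem_empty z hz).elim
  existsUnique_funs n s hs := (ZFSet.notMem_empty _ hs).elim
  mem_rels z hz := by
    obtain ⟨z, hz, rfl⟩ := VModel.exists_val (x := relsV P α) hz
    obtain ⟨x, y, hx, hy, -, rfl⟩ | ⟨x, hx, -, rfl⟩ := (mem_relsV hα).1 hz
    · rw [VModel.mem_def, vv_val hα] at hx hy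
      refine ⟨2, ∅, ![⟨x.1, hx⟩, ⟨y.1, hy⟩], by simp [predSymbs], ?_⟩
      rw [VModel.pr_val, symb_val, upair_nat_val, tuple_two]
      rfl
    · rw [VModel.mem_def, vv_val hα] at hx
      refine ⟨1, ∅, ![⟨x.1, hx⟩], by simp [predSymbs], ?_⟩
      rw [VModel.pr_val, symb_val, upair_nat_val, tuple_one]
      rfl

/-- The code of `⟨V_α, ∈, P⟩`. -/
def vcode (P : VModel δ → Prop) (α : Ordinal.{u}) : VModel δ :=
  (vv α).pr (VModel.emp.pr (relsV P α))

theorem vcode_val (P : VModel δ → Prop) {α : Ordinal.{u}} (h0 : 0 < α) (hα : α < δ) :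
    (vcode P α).1 = (vstr P h0 hα).code := by
  rw [vcode, VModel.pr_val, VModel.pr_val, vv_val hα]
  rfl

theorem rk_vcode_lt (P : VModel δ → Prop) {α : Ordinal.{u}} (hα : α < δ) :
    (vcode P α).rk < α + Ordinal.omega0 + Ordinal.omega0 := by
  have hl := isSuccLimit_add_omega (α + Ordinal.omega0)
  have h1 := (isLeast_add_omega (α + Ordinal.omega0)).1.2
  refine rk_pr_lt hl ?_ (rk_pr_lt hl (rk_emp_lt hl) ((rk_relsV P hα).trans_lt h1))
  rw [rk_vv hα]
  exact le_self_add.trans_lt h1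

theorem lt_rk_vcode (P : VModel δ → Prop) {α : Ordinal.{u}} (hα : α < δ) :
    α < (vcode P α).rk := by
  conv_lhs => rw [← rk_vv (δ := δ) hα]
  exact lt_rk_of_pr_left

/-- The code of `⟨V_α, ∈, P_p⟩` for `α` the rank of `a`. -/
def vcodeF (P : VModel δ → VModel δ → Prop) (p a : VModel δ) : VModel δ := vcode (P p) a.rk

/-- Definability is uniform in the parameter `p`, because in `exists_moved` the predicate varies
with the structure. -/
instance {α : Type} [Finite α] (P : VModel δ → VModel δ → Prop) [hP : Def₂ P]
    (f g : (α → VModel δ) → VModel δ) [DFun f] [DFun g] :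
    DFun (fun v => vcodeF P (f v) (g v)) := by
  refine DFun.of_graph₂ (F := vcodeF P) ?_ f g
  refine Dfn.congr (P := fun v : Fin 3 → VModel δ => ∃ r, v 2 = (vF (v 1)).pr (VModel.emp.pr r) ∧
    ∀ w, w ∈ r ↔ ((∃ x y, x ∈ vF (v 1) ∧ y ∈ vF (v 1) ∧ x ∈ y ∧ w = (VModel.emp.pr (nat 2)).pr
        (((nat 0).pr x).upair ((nat 1).pr y))) ∨
      ∃ x, x ∈ vF (v 1) ∧ Holds₂ P (v 0) x ∧
        w = (VModel.emp.pr (nat 1)).pr (((nat 0).pr x).upair ((nat 0).pr x))))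
    inferInstance fun v => ?_
  constructor
  · intro h
    exact ⟨_, h, fun w => mem_relsV (v 1).rk_lt⟩
  · rintro ⟨r, h, hr⟩
    rw [h, vcodeF, vcode]
    congr 2
    exact VModel.ext' fun w => (hr w).trans (mem_relsV (v 1).rk_lt).symm

instance (P : VModel δ → VModel δ → Prop) [Def₂ P] (p : VModel δ) : DefF (vcodeF P p) :=
  ⟨inferInstance⟩


theorem IsTup.inj {u : VModel δ} {n : ℕ} {x y : Fin n → VModel δ} (hx : IsTup u x)
    (hy : IsTup u y) : x = y := by
  ext1 i
  obtain ⟨k, hk, he⟩ := hy.pr_mem.1 (hx.pr_mem.2 ⟨i, rfl, rfl⟩)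
  rw [he, Fin.ext (nat_inj.1 hk)]

theorem isTup_one (x : VModel δ) (f : Fin 1 → VModel δ) (hf : f 0 = x) :
    IsTup (((nat 0).pr x).upair ((nat 0).pr x)) f := by
  intro z
  rw [VModel.mem_upair]
  simp [hf]

theorem isTup_two (x y : VModel δ) (f : Fin 2 → VModel δ) (hf : f 0 = x) (hf' : f 1 = y) :
    IsTup (((nat 0).pr x).upair ((nat 1).pr y)) f := by
  intro z
  rw [VModel.mem_upair]
  simp [hf, hf', Fin.exists_fin_two]

section

variable (P : VModel δ → Prop) {α : Ordinal.{u}} (h0 : 0 < α) (hα : α < δ)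

theorem codes_vstr : Codes (vstr P h0 hα) (vcode P α) (vv α) VModel.emp (relsV P α) :=
  ⟨rfl, vv_val hα, rfl, rfl⟩

theorem vstr_mem (r : (codedLang ∅ predSymbs.{u}).Relations 2) (hr : r.1 = ∅)
    (x : Fin 2 → (vstr P h0 hα).Carrier) : Structure.RelMap r x ↔ (x 0).1 ∈ (x 1).1 := by
  have hc := codes_vstr P h0 hα
  have hu := isTup_two _ _ (fun i => (el (x i) : VModel δ)) rfl rfl
  rw [hc.rel_iff r x (σ := VModel.emp.pr (nat 2)) (by rw [symb_val, hr]) hu, mem_relsV hα,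
    ← hc.el_val (x 0), ← hc.el_val (x 1)]
  constructor
  · rintro (⟨y, z, -, -, hxy, he⟩ | ⟨y, -, -, he⟩)
    · have := hu.inj ((VModel.pr_inj.1 he).2 ▸ isTup_two y z ![y, z] rfl rfl)
      have h1 := congrFun this 0
      have h2 := congrFun this 1
      simp only [Matrix.cons_val_zero, Matrix.cons_val_one] at h1 h2
      rw [h1, h2]
      exact hxy
    · exact absurd (nat_inj.1 (VModel.pr_inj.1 (VModel.pr_inj.1 he).1).2) (by decide)
  · exact fun h => Or.inl ⟨_, _, hc.el_mem _, hc.el_mem _, h, rfl⟩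

theorem vstr_pred (r : (codedLang ∅ predSymbs.{u}).Relations 1) (hr : r.1 = ∅)
    (x : Fin 1 → (vstr P h0 hα).Carrier) : Structure.RelMap r x ↔ P (el (x 0)) := by
  have hc := codes_vstr P h0 hα
  have hu := isTup_one _ (fun i => (el (x i) : VModel δ)) rfl
  rw [hc.rel_iff r x (σ := VModel.emp.pr (nat 1)) (by rw [symb_val, hr]) hu, mem_relsV hα]
  constructor
  · rintro (⟨y, z, -, -, -, he⟩ | ⟨y, -, hP, he⟩)
    · exact absurd (nat_inj.1 (VModel.pr_inj.1 (VModel.pr_inj.1 he).1).2) (by decide)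
    · have h1 := congrFun (hu.inj ((VModel.pr_inj.1 he).2 ▸ isTup_one y ![y] rfl)) 0
      simp only [Matrix.cons_val_zero] at h1
      rwa [h1]
  · exact fun h => Or.inr ⟨_, hc.el_mem _, h, rfl⟩

end

/-- The language of set theory with a unary predicate as a coded language. -/
def codeHom : setPredLang →ᴸ codedLang ∅ predSymbs.{u} where
  onFunction := fun _ f => f.elim
  onRelation
    | _, .mem => ⟨∅, by simp [predSymbs]⟩
    | _, .pred => ⟨∅, by simp [predSymbs]⟩

/-- The structure on `V_α` for the coded language. -/
@[reducible] def codedVPred (P : VModel δ → Prop) (A : Set ZFSet.{u}) {α : Ordinal.{u}} (h0 : 0 < α)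
    (hα : α < δ) : (codedLang ∅ predSymbs.{u}).Structure (VPred A α) :=
  inferInstanceAs ((codedLang ∅ predSymbs.{u}).Structure (vstr P h0 hα).Carrier)

theorem isExpansionOn_codeHom {P : VModel δ → Prop} {A : Set ZFSet.{u}} {α : Ordinal.{u}}
    (h0 : 0 < α) (hα : α < δ) (hP : ∀ x : VModel δ, P x ↔ x.1 ∈ A) :
    letI := codedVPred P A h0 hα
    codeHom.IsExpansionOn (VPred A α) := by
  let := codedVPred P A h0 hα
  refine ⟨fun f => f.elim, fun {n} r x => propext ?_⟩
  cases r with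
  | mem => exact vstr_mem P h0 hα _ rfl x
  | pred =>
    refine (vstr_pred P h0 hα _ rfl x).trans ((hP _).trans ?_)
    exact (congrArg (· ∈ A) ((codes_vstr P h0 hα).el_val (x 0))).to_iff

/-- An elementary embedding of the coded structures is one of the structures `⟨V_α, ∈, A⟩`. -/
theorem exists_vPred {P P' : VModel δ → Prop} {A A' : Set ZFSet.{u}} {α α' : Ordinal.{u}}
    {h0 : 0 < α} {hα : α < δ} {h0' : 0 < α'} {hα' : α' < δ} (hP : ∀ x : VModel δ, P x ↔ x.1 ∈ A)
    (hP' : ∀ x : VModel δ, P' x ↔ x.1 ∈ A')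
    (j : (vstr P h0 hα).Carrier ↪ₑ[codedLang ∅ predSymbs.{u}] (vstr P' h0' hα').Carrier) :
    ∃ i : VPred A α ↪ₑ[setPredLang] VPred A' α', ∀ x, i x = j x := by
  let := codedVPred P A h0 hα
  let := codedVPred P' A' h0' hα'
  have := isExpansionOn_codeHom h0 hα hP
  have := isExpansionOn_codeHom h0' hα' hP'
  refine ⟨⟨j, fun n φ x => ?_⟩, fun x => rfl⟩
  rw [← LHom.realize_onFormula codeHom φ, ← LHom.realize_onFormula codeHom φ]
  exact j.map_formula (codeHom.onFormula φ) x

theorem BMap.vv_ord_pos {γ : Ordinal.{u}} {J : VModel δ → VModel δ} (h : BMap Base γ J)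
    (hγ : Order.IsSuccLimit γ) {α : Ordinal.{u}} (h0 : 0 < α) (hαγ : α < γ) (hα : α < δ) :
    0 < (J (VopenkaScheme.ord α)).rk := by
  have h1 := (h.mem hγ (rk_emp_lt hγ) (by rwa [rk_ord hα])).1
    (show VModel.emp ∈ (VopenkaScheme.ord α : VModel δ) from
      ord_zero (δ := δ) ▸ (ord_mem_ord Nice.pos hα).2 h0)
  exact zero_le.trans_lt (VModel.rk_lt_of_mem h1)

/-- The predicate for the codes of the structures `⟨V_α, ∈, A⟩`. -/
def vcodeA (A : Set ZFSet.{u}) : VModel δ → Prop :=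
  gr (vcodeF (fun _ x => x.1 ∈ A) VModel.emp)

theorem def_vcodeA {A : Set ZFSet.{u}} (hA : DefinableIn δ A) :
    Def₁ (vcodeA A : VModel δ → Prop) := by
  have : Def₂ (fun _ x : VModel δ => x.1 ∈ A) := 
    ⟨hA.def₁.out.subst₁ (P := fun x => x.1 ∈ A) (fun v : Fin 2 → VModel δ => v 1)⟩
  unfold vcodeA
  infer_instance

/-- A map that respects `Base` and the codes of the structures `⟨V_α, ∈, A⟩` is elementary
on these structures. -/
theorem BMap.exists_vPred {γ : Ordinal.{u}} {J : VModel δ → VModel δ} {A : Set ZFSet.{u}}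
    (h : BMap Base γ J) (hA : BMap (vcodeA A) γ J) (hγ : Order.IsSuccLimit γ) (hγδ : γ ≤ δ)
    {α : Ordinal.{u}} (h0 : 0 < α) (hα : α < δ)
    (hαγ : α + Ordinal.omega0 + Ordinal.omega0 ≤ γ) :
    ∃ j : VPred A α ↪ₑ[setPredLang] VPred A (J (VopenkaScheme.ord α)).rk,
      ∀ x, (j x).1 = (J (toV x.1)).1 := by
  have hlt : α < γ := ((isLeast_add_omega α).1.2.trans (isLeast_add_omega _).1.2).trans_le hαγ
  have hω : Ordinal.omega0 < γ := by
    refine lt_of_lt_of_le ?_ hαγ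
    exact le_add_self.trans_lt (isLeast_add_omega (α + Ordinal.omega0)).1.2
  have h0' := h.vv_ord_pos hγ h0 hlt hα
  have hm : (vcodeF (fun _ x => x.1 ∈ A) VModel.emp (VopenkaScheme.ord α) : VModel δ) =
      vcode (fun x => x.1 ∈ A) α := by rw [vcodeF, rk_ord hα]
  -- The graph of α ↦ ⟨V_α, ∈, A⟩ is the predicate respected by `J`, so the code of one such
  -- structure goes to the code of another.
  have hJ : J (vcode (fun x => x.1 ∈ A) α) =
      vcode (fun x => x.1 ∈ A) (J (VopenkaScheme.ord α)).rk := by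
    have := BMap.app hA hγ (x := VopenkaScheme.ord α) (by rwa [rk_ord hα])
      (by rw [hm]; exact (rk_vcode_lt _ hα).trans_le hαγ)
    rwa [hm] at this
  obtain ⟨j, hj⟩ := h.exists_elementaryEmbedding hγ hω hγδ
    (vcode_val (fun x => x.1 ∈ A) h0 hα) ((rk_vcode_lt _ hα).trans_le hαγ)
    (by rw [hJ]; exact vcode_val _ h0' (J _).rk_lt)
    (fun n s hs => (ZFSet.notMem_empty _ hs).elim)
    (fun n s hs => by
      -- The symbols are pairs ⟨∅, n⟩, which `J` fixes.
      rw [eq_of_symb_mem hs]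
      have h1 : (VopenkaScheme.nat n : VModel δ).rk < γ := by
        rw [rk_nat]; exact (Ordinal.natCast_lt_omega0 _).trans hω
      refine ⟨VModel.emp.pr (VopenkaScheme.nat n), symb_val n, rk_pr_lt hγ (rk_emp_lt hγ) h1, ?_⟩
      rw [h.pr _ _ (rk_emp_lt hγ) h1, h.emp, h.nat hγ hω])
  obtain ⟨i, hi⟩ := VopenkaScheme.exists_vPred (fun _ => Iff.rfl) (fun _ => Iff.rfl) j
  refine ⟨i, fun x => ?_⟩
  rw [hi x]
  have := hj x
  rw [VModel.val_inj, (codes_vstr _ h0' _).el_val] at this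
  exact this

end

section

variable {δ : Ordinal.{u}} [hδ : Nice δ]

/-! ### Elementary embeddings as maps on `V_δ` -/

/-- The atomic formula `s ∈ t`. -/
def memP {α : Type} {n : ℕ} (s t : setPredLang.Term (α ⊕ Fin n)) : setPredLang.BoundedFormula α n :=
  Relations.boundedFormula₂ (SetPredRel.mem : setPredLang.Relations 2) s t

/-- The atomic formula stating that the predicate holds of `t`. -/
def predP {α : Type} {n : ℕ} (t : setPredLang.Term (α ⊕ Fin n)) : setPredLang.BoundedFormula α n :=
  Relations.boundedFormula₁ (SetPredRel.pred : setPredLang.Relations 1) t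

theorem realize_memP {A : Set ZFSet.{u}} {β : Ordinal.{u}} {α : Type} {n : ℕ}
    {s t : setPredLang.Term (α ⊕ Fin n)} {v : α → VPred A β} {xs : Fin n → VPred A β} :
    (memP s t).Realize v xs ↔
      (s.realize (Sum.elim v xs)).1 ∈ (t.realize (Sum.elim v xs)).1 :=
  BoundedFormula.realize_rel₂

theorem realize_predP {A : Set ZFSet.{u}} {β : Ordinal.{u}} {α : Type} {n : ℕ}
    {t : setPredLang.Term (α ⊕ Fin n)} {v : α → VPred A β} {xs : Fin n → VPred A β} :
    (predP t).Realize v xs ↔ (t.realize (Sum.elim v xs)).1 ∈ A :=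
  BoundedFormula.realize_rel₁

theorem VPred.val_inj {A : Set ZFSet.{u}} {β : Ordinal.{u}} {x y : VPred A β} :
    x = y ↔ x.1 = y.1 := Subtype.ext_iff

/-- A free variable. -/
def fv {n k : ℕ} (i : Fin n) : setPredLang.Term (Fin n ⊕ Fin k) := Term.var (Sum.inl i)

open Classical in
/-- The extension by `∅` to `V_δ` of a map between sets of the cumulative hierarchy. -/
def lift {A A' : Set ZFSet.{u}} {γ θ : Ordinal.{u}} (j : VPred A γ → VPred A' θ)
    (x : VModel δ) : VModel δ :=
  if h : x.rk < γ then toV (j ⟨x.1, mem_vonNeumann.2 h⟩).1 else VModel.emp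

section lift

variable {A A' : Set ZFSet.{u}} {γ θ : Ordinal.{u}}

theorem lift_val {j : VPred A γ → VPred A' θ} (hθ : θ ≤ δ)
    {x : VModel δ} (h : x.rk < γ) : (lift j x).1 = (j ⟨x.1, mem_vonNeumann.2 h⟩).1 := by
  rw [lift, dif_pos h, toV_val]
  exact (mem_vonNeumann.1 (j ⟨x.1, mem_vonNeumann.2 h⟩).2).trans_le hθ

theorem rk_lift_lt {j : VPred A γ → VPred A' θ} (hθ : θ ≤ δ)
    {x : VModel δ} (h : x.rk < γ) : (lift j x).rk < θ := by
  rw [VModel.rk, lift_val hθ h]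
  exact mem_vonNeumann.1 (j ⟨x.1, mem_vonNeumann.2 h⟩).2

variable (j : VPred A γ ↪ₑ[setPredLang] VPred A' θ) (hθ : θ ≤ δ)
include hθ

theorem lift_pred {x : VModel δ} (hx : x.rk < γ) : (lift j x).1 ∈ A' ↔ x.1 ∈ A := by
  rw [lift_val hθ hx]
  exact j.map_rel (SetPredRel.pred : setPredLang.Relations 1) ![⟨x.1, mem_vonNeumann.2 hx⟩]

theorem lift_emp (hγ : 0 < γ) : lift j VModel.emp = (VModel.emp : VModel δ) := by
  have h0 : (VModel.emp : VModel δ).rk < γ := by rwa [rk_emp]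
  have := j.map_formula (∀' ∼(memP (&0) (fv 0)) : setPredLang.Formula (Fin 1))
    ![⟨(VModel.emp : VModel δ).1, mem_vonNeumann.2 h0⟩]
  simp only [Formula.Realize, BoundedFormula.realize_all, BoundedFormula.realize_not,
    realize_memP, fv, Term.realize_var, Sum.elim_inl, Sum.elim_inr, Function.comp] at this
  have h2 := this.2 (fun z hz => ZFSet.notMem_empty _ hz)
  refine eq_emp fun z hz => ?_
  have hz' := hz
  rw [VModel.mem_def, lift_val hθ h0] at hz
  exact h2 ⟨z.1, (isTransitive_vonNeumann θ).mem_trans hz (j _).2⟩ hz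

/-- Being an unordered pair is a first-order property that transitive sets compute correctly, and
V_γ contains the pair because γ is a limit. -/
theorem lift_upair (hγ : Order.IsSuccLimit γ) {x y : VModel δ} (hx : x.rk < γ) (hy : y.rk < γ) :
    lift j (x.upair y) = (lift j x).upair (lift j y) := by
  have hz := rk_upair_lt hγ hx hy
  have := j.map_formula (∀' (memP (&0) (fv 0) ⇔ ((&0 =' fv 1) ⊔ (&0 =' fv 2))) :
    setPredLang.Formula (Fin 3)) ![⟨(x.upair y).1, mem_vonNeumann.2 hz⟩,
      ⟨x.1, mem_vonNeumann.2 hx⟩, ⟨y.1, mem_vonNeumann.2 hy⟩]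
  simp only [Formula.Realize, BoundedFormula.realize_all, BoundedFormula.realize_iff,
    BoundedFormula.realize_sup, BoundedFormula.realize_bdEqual,
    realize_memP, fv, Term.realize_var, Sum.elim_inl, Sum.elim_inr, Function.comp] at this
  have h2 := this.2 (fun z => by
    refine (ZFSet.mem_pair).trans (or_congr ?_ ?_)
    · exact (VPred.val_inj (x := z) (y := ⟨x.1, mem_vonNeumann.2 hx⟩)).symm
    · exact (VPred.val_inj (x := z) (y := ⟨y.1, mem_vonNeumann.2 hy⟩)).symm)
  refine VModel.ext' fun z => ?_
  rw [VModel.mem_upair]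
  constructor
  · intro hz'
    rw [VModel.mem_def, lift_val hθ hz] at hz'
    have hzθ := (isTransitive_vonNeumann θ).mem_trans hz' (j _).2
    refine ((h2 ⟨z.1, hzθ⟩).1 hz').imp ?_ ?_
    · intro h
      rw [VModel.val_inj, lift_val hθ hx]
      exact congrArg Subtype.val h
    · intro h
      rw [VModel.val_inj, lift_val hθ hy]
      exact congrArg Subtype.val h
  · rintro (rfl | rfl)
    · rw [VModel.mem_def, lift_val hθ hz, lift_val hθ hx]
      exact (h2 (j ⟨x.1, mem_vonNeumann.2 hx⟩)).2 (Or.inl rfl)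
    · rw [VModel.mem_def, lift_val hθ hz, lift_val hθ hy]
      exact (h2 (j ⟨y.1, mem_vonNeumann.2 hy⟩)).2 (Or.inr rfl)

theorem lift_pr (hγ : Order.IsSuccLimit γ) {x y : VModel δ} (hx : x.rk < γ) (hy : y.rk < γ) :
    lift j (x.pr y) = (lift j x).pr (lift j y) := by
  rw [VModel.pr, lift_upair j hθ hγ (rk_upair_lt hγ hx hx) (rk_upair_lt hγ hx hy),
    lift_upair j hθ hγ hx hx, lift_upair j hθ hγ hx hy]
  rfl

end lift

/-- A predicate as a set. -/
def toSet (P : VModel δ → Prop) : Set ZFSet.{u} := {z | ∃ x : VModel δ, x.1 = z ∧ P x}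

omit hδ in
theorem mem_toSet {P : VModel δ → Prop} {x : VModel δ} : x.1 ∈ toSet P ↔ P x :=
  ⟨fun ⟨_, hy, h⟩ => Subtype.ext hy ▸ h, fun h => ⟨x, rfl, h⟩⟩

omit hδ in
theorem definableIn_toSet (P : VModel δ → Prop) [h : Def₁ P] : DefinableIn δ (toSet P) :=
  definableIn_iff.2 h

/-- The passage from elementary embeddings to maps on V_δ; preservation of ∅, of pairs and of the
predicate is all that is retained. -/
theorem BMap.lift {P : VModel δ → Prop} {γ θ : Ordinal.{u}} (hγ : Order.IsSuccLimit γ)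
    (hθ : θ ≤ δ) (j : VPred (toSet P) γ ↪ₑ[setPredLang] VPred (toSet P) θ) :
    BMap P γ (lift j) :=
  ⟨lift_emp j hθ hγ.bot_lt, fun _ _ hx hy => lift_pr j hθ hγ hx hy, fun _ hx =>
    mem_toSet.symm.trans ((lift_pred j hθ hx).symm.trans mem_toSet)⟩

/-- An embedding of structures with predicates `join P Q` and `join P Q'`. -/
theorem BMap.lift_join {P Q Q' : VModel δ → Prop} {γ θ : Ordinal.{u}} (hγ : Order.IsSuccLimit γ)
    (hθ : θ ≤ δ) (j : VPred (toSet (join P Q)) γ ↪ₑ[setPredLang] VPred (toSet (join P Q')) θ) :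
    BMap P γ (VopenkaScheme.lift j) ∧
      ∀ x : VModel δ, x.rk < γ → (Q x ↔ Q' (VopenkaScheme.lift j x)) := by
  have he := lift_emp (δ := δ) j hθ hγ.bot_lt
  have h0 := rk_emp_lt (δ := δ) hγ
  refine ⟨⟨he, fun _ _ hx hy => lift_pr j hθ hγ hx hy, fun x hx => ?_⟩, fun x hx => ?_⟩
  · have := lift_pred j hθ (rk_pr_lt hγ h0 hx)
    rw [mem_toSet, mem_toSet, lift_pr j hθ hγ h0 hx, he, join_left, join_left] at this
    exact this.symm
  · have := lift_pred j hθ (rk_pr_lt hγ (rk_pr_lt hγ h0 h0) hx)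
    rw [mem_toSet, mem_toSet, lift_pr j hθ hγ (rk_pr_lt hγ h0 h0) hx, lift_pr j hθ hγ h0 h0, he,
      join_right, join_right] at this
    exact this.symm

theorem BMap.ord_lt {γ : Ordinal.{u}} {J : VModel δ → VModel δ} (h : BMap Base γ J)
    (hγ : Order.IsSuccLimit γ) {a b : Ordinal.{u}} (hab : a < b) (hb : b < γ) (hbδ : b < δ) :
    (J (VopenkaScheme.ord a)).rk < (J (VopenkaScheme.ord b)).rk := by
  refine VModel.rk_lt_of_mem ((h.mem hγ ?_ ?_).1 ((ord_mem_ord (hab.trans hbδ) hbδ).2 hab))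
  · rw [rk_ord (hab.trans hbδ)]; exact hab.trans hb
  · rwa [rk_ord hbδ]

/-- A strictly increasing map on ordinals is never regressive: if J(a) < a then J(J(a)) < J(a),
against minimality of a. -/
theorem BMap.le_rk_ord {γ : Ordinal.{u}} {J : VModel δ → VModel δ} (h : BMap Base γ J)
    (hγ : Order.IsSuccLimit γ) {a : Ordinal.{u}} (ha : a < γ) (haδ : a < δ) :
    a ≤ (J (VopenkaScheme.ord a)).rk := by
  induction a using WellFoundedLT.induction with
  | ind a ih =>
    by_contra hlt
    rw [not_le] at hlt
    have h1 := h.ord_lt hγ hlt ha haδ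
    exact (ih _ hlt (hlt.trans ha) (hlt.trans haδ)).not_gt h1

theorem BMap.le_rk {γ : Ordinal.{u}} {J : VModel δ → VModel δ} (h : BMap Base γ J)
    (hγ : Order.IsSuccLimit γ) {x : VModel δ} (hx : x.rk < γ) : x.rk ≤ (J x).rk := by
  have := h.le_rk_ord hγ hx x.rk_lt
  rwa [h.ord_rk hγ hx, rk_ord (J x).rk_lt] at this

/-- The set `e` is the restriction to `V_γ` of a map that respects `B`, for `γ` the rank of `g`. -/
def EMap (B : VModel δ → Prop) (e g : VModel δ) : Prop :=
  IsFn e (vF g) ∧ VModel.emp.pr VModel.emp ∈ e ∧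
    (∀ x y x' y', VModel.pr x x' ∈ e → VModel.pr y y' ∈ e →
      (VModel.pr x y).pr (VModel.pr x' y') ∈ e) ∧
    ∀ x x', VModel.pr x x' ∈ e → (Holds B x ↔ Holds B x')

instance {α : Type} [Finite α] (B : VModel δ → Prop) [Def₁ B] (f g : (α → VModel δ) → VModel δ)
    [DFun f] [DFun g] : Dfn (fun v => EMap B (f v) (g v)) := by
  refine Dfn.subst₂ (P := EMap B) ?_ f g
  unfold EMap; infer_instance

/-- With `BMap.exists_eMap` this passes between maps and the sets that code them. Quantifying over
the codes is what makes the existence of a map definable in V_δ. -/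
theorem EMap.exists_bMap {B : VModel δ → Prop} {e g : VModel δ} (h : EMap B e g) :
    ∃ J, BMap B g.rk J ∧ ∀ x y : VModel δ, x.pr y ∈ e ↔ x.rk < g.rk ∧ J x = y := by
  classical
  obtain ⟨h1, h2, h3, h4⟩ := h
  have hex : ∀ x : VModel δ, ∃ y, x.rk < g.rk → x.pr y ∈ e ∧ ∀ y', x.pr y' ∈ e → y' = y := by
    intro x
    by_cases hx : x.rk < g.rk
    · obtain ⟨y, hy⟩ := h1.2 x ((mem_vv g.rk_lt).2 hx)
      exact ⟨y, fun _ => hy⟩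
    · exact ⟨x, fun h => (hx h).elim⟩
  choose J hJ using hex
  have key : ∀ x y : VModel δ, x.pr y ∈ e ↔ x.rk < g.rk ∧ J x = y := by
    intro x y
    constructor
    · intro hxy
      obtain ⟨i, hi, y', he⟩ := h1.1 _ hxy
      obtain ⟨rfl, rfl⟩ := VModel.pr_inj.1 he
      have hx := (mem_vv g.rk_lt).1 hi
      exact ⟨hx, ((hJ x hx).2 y hxy).symm⟩
    · rintro ⟨hx, rfl⟩
      exact (hJ x hx).1
  refine ⟨J, ⟨((key _ _).1 h2).2, fun x y hx hy => ?_, fun x hx => ?_⟩, key⟩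
  · exact ((key _ _).1 (h3 x y _ _ ((key _ _).2 ⟨hx, rfl⟩) ((key _ _).2 ⟨hy, rfl⟩))).2
  · exact h4 x _ ((key _ _).2 ⟨hx, rfl⟩)

/-- The common bound θ on the ranks of the values makes the graph of `J` on V_g an element of V_δ.
-/
theorem BMap.exists_eMap {B : VModel δ → Prop} {J : VModel δ → VModel δ} {g : VModel δ}
    (h : BMap B g.rk J) (hg : Order.IsSuccLimit g.rk) {θ : Ordinal.{u}} (hθ : θ < δ)
    (hJ : ∀ x : VModel δ, x.rk < g.rk → (J x).rk < θ) :
    ∃ e, EMap B e g ∧ ∀ x y : VModel δ, x.pr y ∈ e ↔ x.rk < g.rk ∧ J x = y := by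
  obtain ⟨e, -, he⟩ := VModel.exists_set
    (fun z => ∃ x : VModel δ, x.rk < g.rk ∧ z = x.pr (J x))
    (Nice.succ_lt (Nice.succ_lt (max_lt g.rk_lt hθ))) (by
      rintro _ ⟨x, hx, rfl⟩
      rw [rk_pr, Order.succ_lt_succ_iff, Order.succ_lt_succ_iff]
      exact max_lt_max hx (hJ x hx))
  have key : ∀ x y : VModel δ, x.pr y ∈ e ↔ x.rk < g.rk ∧ J x = y := by
    intro x y
    rw [he]
    constructor
    · rintro ⟨x', hx, hh⟩
      obtain ⟨rfl, rfl⟩ := VModel.pr_inj.1 hh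
      exact ⟨hx, rfl⟩
    · rintro ⟨hx, rfl⟩
      exact ⟨x, hx, rfl⟩
  refine ⟨e, ⟨⟨fun z hz => ?_, fun x hx => ?_⟩, (key _ _).2 ⟨rk_emp_lt hg, h.emp⟩, ?_, ?_⟩, key⟩
  · obtain ⟨x, hx, rfl⟩ := (he z).1 hz
    exact ⟨x, (mem_vv g.rk_lt).2 hx, _, rfl⟩
  · have hx := (mem_vv g.rk_lt).1 hx
    exact ⟨J x, (key _ _).2 ⟨hx, rfl⟩, fun y' hy' => ((key _ _).1 hy').2.symm⟩
  · intro x y x' y' hx hy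
    obtain ⟨hx1, rfl⟩ := (key _ _).1 hx
    obtain ⟨hy1, rfl⟩ := (key _ _).1 hy
    exact (key _ _).2 ⟨rk_pr_lt hg hx1 hy1, h.pr x y hx1 hy1⟩
  · intro x x' hx
    obtain ⟨hx1, rfl⟩ := (key _ _).1 hx
    exact h.iff x hx1

end

section

variable {δ : Ordinal.{u}} [hδ : Nice δ]

/-! ### From the Vopěnka scheme to embeddings -/

theorem CodedStructure.code_inj {F R : ZFSet.{u}} {M N : CodedStructure F R}
    (h : M.code = N.code) : M = N := by
  obtain ⟨c, f, r, _, _, _, _⟩ := M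
  obtain ⟨c', f', r', _, _, _, _⟩ := N
  simp only [CodedStructure.code, pair_inj] at h
  obtain ⟨rfl, rfl, rfl⟩ := h
  rfl

theorem rk_limF (x : VModel δ) : (limF x).rk = x.rk + Ordinal.omega0 :=
  rk_ord (add_omega_lt x.rk_lt)

instance {α : Type} [Finite α] (f g : (α → VModel δ) → VModel δ) [DFun f] [DFun g] :
    Dfn (fun v => Holds (single (f v)) (g v)) := inferInstanceAs (Dfn fun v => g v = f v)

instance (B : VModel δ → Prop) [Def₁ B] : Def₂ (fun p => join B (single p)) :=
  ⟨by unfold join; infer_instance⟩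

/-- Some map respecting `B` moves the ordinal `x` up and is defined somewhat above it. -/
def Moved (B : VModel δ → Prop) (x : VModel δ) : Prop :=
  ∃ e y, EMap B e (limF (limF x)) ∧ x.pr y ∈ e ∧ x ∈ y

theorem predSymbs_mem : predSymbs.{u} ∈ V_ δ := by
  have := ((VModel.emp.pr (nat 1)).upair (VModel.emp.pr (nat 2)) : VModel δ).2
  have he : ((VModel.emp.pr (nat 1)).upair (VModel.emp.pr (nat 2)) : VModel δ).1 = predSymbs := by
    rw [VModel.upair_val, symb_val, symb_val]
    rfl
  rwa [he] at this

/-- If unboundedly many α were not moved, the structures ⟨V_{α+ω+ω}, ∈, B, {α}⟩ for these α would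
form a definable proper class. An embedding between two distinct ones sends the distinguished
ordinal of the first to that of the second, which must be larger; so the first ordinal is moved
after all. -/
theorem exists_moved (h : SatisfiesVopenkaScheme δ) (B : VModel δ → Prop) [Def₁ B] :
    ∃ μ < δ, ∀ α, μ ≤ α → α < δ → Moved (join Base B) (ord α) := by
  set P : VModel δ → VModel δ → Prop := fun p => join (join Base B) (single p)
  have : Def₂ P := inferInstance
  -- The height α + ω + ω of the structures is the height on which `Moved` asks for a map.
  set C : VModel δ → Prop := fun z => ∃ x, IsOrd x ∧
    ¬ (∃ e y, EMap (join Base B) e (limF (limF x)) ∧ x.pr y ∈ e ∧ x ∈ y) ∧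
    z = vcodeF P x (limF (limF x))
  have hC : Def₁ C := ⟨inferInstance⟩
  have hpos : ∀ x : VModel δ, 0 < (limF (limF x)).rk := fun x => by
    rw [rk_limF]
    exact Ordinal.omega0_pos.trans_le le_add_self
  by_contra hcon
  push Not at hcon
  obtain ⟨M, N, hM, hN, hMN, j, -⟩ := h ∅ (VModel.emp : VModel δ).2 predSymbs predSymbs_mem
    (toSet C) (definableIn_toSet C) (by
      rintro _ ⟨_, rfl, x, -, -, rfl⟩
      exact ⟨_, (vcode_val (P x) (hpos x) (VModel.rk_lt _)).symm⟩) (by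
      -- The code of the structure for α has rank above α, so the class is not contained in any set.
      rintro ⟨a, ha, hm⟩
      obtain ⟨α, hα, hαδ, hbad⟩ := hcon a.rank (mem_vonNeumann.1 ha)
      have h1 : (vcodeF P (ord α) (limF (limF (ord α))) : VModel δ).1 ∈ a :=
        (hm _).2 ⟨_, rfl, ord α, isOrd_ord hαδ, hbad, rfl⟩
      have h2 : (ord α : VModel δ).rk < (vcodeF P (ord α) (limF (limF (ord α)))).rk := by
        refine lt_trans ?_ (lt_rk_vcode _ (VModel.rk_lt _))
        rw [rk_limF, rk_limF]
        exact (isLeast_add_omega _).1.2.trans (isLeast_add_omega _).1.2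
      rw [rk_ord hαδ] at h2
      exact (hα.trans_lt h2).not_gt (rank_lt_of_mem h1))
  obtain ⟨_, hM, x, hx, hbad, rfl⟩ := hM
  obtain ⟨_, hN, x', hx', -, rfl⟩ := hN
  obtain rfl := CodedStructure.code_inj
    (hM.symm.trans (vcode_val (P x) (hpos x) (VModel.rk_lt _)))
  obtain rfl := CodedStructure.code_inj
    (hN.symm.trans (vcode_val (P x') (hpos x') (VModel.rk_lt _)))
  obtain ⟨i, -⟩ := exists_vPred (A := toSet (P x)) (A' := toSet (P x')) (fun _ => mem_toSet.symm)
    (fun _ => mem_toSet.symm) j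
  have hl : Order.IsSuccLimit (limF (limF x)).rk := by
    rw [rk_limF]; exact isSuccLimit_add_omega _
  have hxl : x.rk < (limF (limF x)).rk := by
    rw [rk_limF, rk_limF]
    exact (isLeast_add_omega _).1.2.trans (isLeast_add_omega _).1.2
  obtain ⟨hJ, hs⟩ := BMap.lift_join hl (limF (limF x')).rk_lt.le i
  -- The second half of the joined predicate holds only of `x` on one side and only of `x'` on the
  -- other.
  have hJx : lift i x = x' := (hs x hxl).1 rfl
  have hle := (hJ.left hl).le_rk hl hxl
  rw [hJx] at hle
  have hlt : x.rk < x'.rk := by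
    refine hle.lt_of_ne fun he => hMN ?_
    have : x = x' := by rw [hx.eq, he, ← hx'.eq]
    subst this
    rfl
  obtain ⟨e, he, he'⟩ := hJ.exists_eMap hl (limF (limF x')).rk_lt
    fun y hy => rk_lift_lt (limF (limF x')).rk_lt.le hy
  refine hbad ⟨e, x', he, (he' x x').2 ⟨hxl, hJx⟩, ?_⟩
  rw [hx.eq, hx'.eq]
  exact (ord_mem_ord x.rk_lt x'.rk_lt).2 hlt

/-- A map on V_{α+ω+ω} that respects the codes of the structures ⟨V_ξ, ∈, A⟩ and moves α up
restricts to an elementary embedding on ⟨V_α, ∈, A⟩, whose code lies in its domain. -/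
theorem exists_embedding_of_vopenka (h : SatisfiesVopenkaScheme δ) {A : Set ZFSet.{u}}
    (hA : DefinableIn δ A) : ∃ μ < δ, ∀ α : Ordinal.{u}, μ ≤ α → α < δ →
      ∃ θ : Ordinal.{u}, α < θ ∧ θ < δ ∧ Nonempty (VPred A α ↪ₑ[setPredLang] VPred A θ) := by
  have := def_vcodeA (δ := δ) hA
  obtain ⟨μ, hμ, hmoved⟩ := exists_moved h (vcodeA A)
  -- The bound 1 keeps V_α nonempty.
  refine ⟨max μ 1, max_lt hμ (Ordinal.one_lt_omega0.trans hδ.omega_lt), fun α hα hαδ => ?_⟩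
  obtain ⟨e, y, he, hy, hlt⟩ := hmoved α ((le_max_left _ _).trans hα) hαδ
  obtain ⟨J, hJ, hJe⟩ := he.exists_bMap
  rw [rk_limF, rk_limF, rk_ord hαδ] at hJ
  have hl := isSuccLimit_add_omega (α + Ordinal.omega0)
  obtain ⟨-, rfl⟩ := (hJe _ _).1 hy
  obtain ⟨j, -⟩ := (hJ.left hl).exists_vPred (hJ.right hl) hl
    (add_omega_lt (add_omega_lt hαδ)).le
    (zero_lt_one.trans_le ((le_max_right _ _).trans hα)) hαδ le_rfl
  refine ⟨_, ?_, (J (ord α)).rk_lt, ⟨j⟩⟩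
  have := VModel.rk_lt_of_mem hlt
  rwa [rk_ord hαδ] at this

end

section

variable {δ : Ordinal.{u}} [hδ : Nice δ]

/-! ### Moving elements of definable unbounded classes -/

/-- For every definable `A`, all sufficiently large `⟨V_α, ∈, A⟩` have proper elementary
end extensions of the same form. -/
def HasEmbeddings (δ : Ordinal.{u}) : Prop :=
  ∀ A : Set ZFSet.{u}, DefinableIn δ A →
    ∃ μ < δ, ∀ α : Ordinal.{u}, μ ≤ α → α < δ →
      ∃ θ : Ordinal.{u}, α < θ ∧ θ < δ ∧ Nonempty (VPred A α ↪ₑ[setPredLang] VPred A θ)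

/-- The predicate `B` of pairs `⟨∅, x⟩` joined with the class `K` of limit ordinals. -/
def tagged (B K : VModel δ → Prop) (z : VModel δ) : Prop :=
  (∃ x, z = VModel.emp.pr x ∧ Holds B x) ∨ Holds K z

instance (B K : VModel δ → Prop) [Def₁ B] [Def₁ K] : Def₁ (tagged B K) :=
  ⟨by unfold tagged; infer_instance⟩

/-- Limit ordinals contain ∅ and pairs do not. So `K` can be recovered from `tagged B K` by the
simple formula ∅ ∈ w, without writing out a formula for tagging. -/
theorem emp_notMem_pr {x y : VModel δ} : ¬ VModel.emp ∈ x.pr y := by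
  rw [VModel.pr, VModel.mem_upair]
  rintro (h | h)
  · have : x ∈ (VModel.emp : VModel δ) := by rw [h]; exact VModel.mem_upair.2 (Or.inl rfl)
    exact VModel.notMem_emp this
  · have : x ∈ (VModel.emp : VModel δ) := by rw [h]; exact VModel.mem_upair.2 (Or.inl rfl)
    exact VModel.notMem_emp this

theorem IsLim.emp_mem {x : VModel δ} (h : IsLim x) : VModel.emp ∈ x := by
  rw [h.1.eq, ← ord_zero]
  exact (ord_mem_ord Nice.pos x.rk_lt).2 h.2.bot_lt

/-- For consecutive x < y in `K`, the structure V_y sees x as the last point of `K`, so J(x) is the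
last point of `K` in V_θ. As y < θ is a point of `K` too, J(x) cannot be x. -/
theorem HasEmbeddings.exists_move (h : HasEmbeddings δ) (B K : VModel δ → Prop) [Def₁ B] [Def₁ K]
    (hK : ∀ x, K x → IsLim x) (hunb : ∀ ρ < δ, ∃ x, K x ∧ ρ < x.rk) {ρ : Ordinal.{u}}
    (hρ : ρ < δ) : ∃ x y : VModel δ, ∃ J, K x ∧ K y ∧ x.rk < y.rk ∧
      (∀ z, K z → z.rk < y.rk → z.rk ≤ x.rk) ∧ ρ < x.rk ∧ BMap B y.rk J ∧ J x ≠ x ∧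
      ∃ θ < δ, ∀ z : VModel δ, z.rk < y.rk → (J z).rk < θ := by
  obtain ⟨μ, hμ, hemb⟩ := h _ (definableIn_toSet (tagged B K))
  obtain ⟨x, hKx, hx⟩ := hunb _ (max_lt hμ hρ)
  -- `y` is the next element of `K` after `x`.
  obtain ⟨a, ⟨y, ⟨hKy, hxy⟩, rfl⟩, hmin⟩ := WellFounded.has_min (wellFounded_lt (α := Ordinal.{u}))
    (VModel.rk '' {y : VModel δ | K y ∧ x.rk < y.rk})
    (by obtain ⟨y, hy⟩ := hunb _ x.rk_lt; exact ⟨_, y, hy, rfl⟩)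
  have hcons : ∀ z, K z → z.rk < y.rk → z.rk ≤ x.rk := fun z hz hzy => by
    by_contra hlt
    exact hmin _ ⟨z, ⟨hz, not_le.1 hlt⟩, rfl⟩ hzy
  obtain ⟨θ, hθ, hθδ, ⟨j⟩⟩ := hemb y.rk (((le_max_left _ _).trans_lt (hx.trans hxy)).le) y.rk_lt
  have hl := (hK y hKy).2
  have he := lift_emp (δ := δ) j hθδ.le hl.bot_lt
  have h0 := rk_emp_lt (δ := δ) hl
  have hB : ∀ x : VModel δ, (VModel.emp.pr x).1 ∈ toSet (tagged B K) ↔ B x := by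
    intro x
    rw [mem_toSet]
    constructor
    · rintro (⟨x', he, hx⟩ | hx)
      · exact (VModel.pr_inj.1 he).2 ▸ hx
      · exact (emp_notMem_pr (hK _ hx).emp_mem).elim
    · exact fun hx => Or.inl ⟨x, rfl, hx⟩
  refine ⟨x, y, lift j, hKx, hKy, hxy, hcons, (le_max_right _ _).trans_lt hx,
    ⟨he, fun _ _ hx hy => lift_pr j hθδ.le hl hx hy, fun z hz => ?_⟩, fun hfix => ?_, θ, hθδ,
    fun z hz => rk_lift_lt hθδ.le hz⟩
  · rw [← hB, ← hB, ← he, ← lift_pr j hθδ.le hl h0 hz, he, lift_pred j hθδ.le (rk_pr_lt hl h0 hz)]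
  -- The formula says that every w in the predicate with ∅ ∈ w satisfies w ∈ x or w = x; the set ∅
  -- is passed as a second parameter.
  · have := j.map_formula (∀' (predP (&0) ⟹ (memP (fv 1) (&0) ⟹
      (memP (&0) (fv 0) ⊔ (&0 =' fv 0)))) : setPredLang.Formula (Fin 2))
      ![⟨x.1, mem_vonNeumann.2 hxy⟩, ⟨(VModel.emp : VModel δ).1, mem_vonNeumann.2 h0⟩]
    simp only [Formula.Realize, BoundedFormula.realize_all, BoundedFormula.realize_imp,
      BoundedFormula.realize_sup, BoundedFormula.realize_bdEqual, realize_memP, realize_predP,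
      fv, Term.realize_var, Sum.elim_inl, Sum.elim_inr, Function.comp] at this
    have h2 := this.2 (fun w hw hw' => by
      change w.1 ∈ toSet (tagged B K) at hw
      change ∅ ∈ w.1 at hw'
      obtain ⟨z, hzw, hz⟩ := hw
      rw [← hzw] at hw'
      have hKz : K z := by
        rcases hz with ⟨z', rfl, -⟩ | hz
        · exact (emp_notMem_pr (δ := δ) hw').elim
        · exact hz
      have hzy : z.rk < y.rk := by
        rw [VModel.rk, hzw]
        exact mem_vonNeumann.1 w.2
      rcases (hcons z hKz hzy).lt_or_eq with hlt | heq
      · left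
        change w.1 ∈ x.1
        rw [← hzw, ← VModel.mem_def, (hK z hKz).1.eq, (hK x hKx).1.eq]
        exact (ord_mem_ord z.rk_lt x.rk_lt).2 hlt
      · right
        refine (VPred.val_inj (x := w) (y := ⟨x.1, mem_vonNeumann.2 hxy⟩)).2 ?_
        change w.1 = x.1
        rw [← hzw, (hK z hKz).1.eq, heq, ← (hK x hKx).1.eq]) ⟨y.1, mem_vonNeumann.2 hθ⟩
    have h3 : y.1 ∈ x.1 ∨ y.1 = x.1 := by
      have h4 : (j ⟨x.1, mem_vonNeumann.2 hxy⟩).1 = x.1 := by rw [← lift_val hθδ.le hxy, hfix]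
      have h5 : (j ⟨(VModel.emp : VModel δ).1, mem_vonNeumann.2 h0⟩).1 = ∅ := by
        rw [← lift_val hθδ.le h0, he]; rfl
      have h6 := h2 (mem_toSet.2 (Or.inr hKy)) (by
        change (j ⟨(VModel.emp : VModel δ).1, mem_vonNeumann.2 h0⟩).1 ∈ y.1
        rw [h5]
        exact (hK y hKy).emp_mem)
      refine h6.imp (fun h => ?_) fun h => ?_
      · change y.1 ∈ (j ⟨x.1, mem_vonNeumann.2 hxy⟩).1 at h
        rwa [h4] at h
      · rw [← h4]
        exact congrArg Subtype.val h
    rcases h3 with h3 | h3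
    · exact (VModel.rk_lt_of_mem (x := y) (y := x) h3).not_gt hxy
    · exact hxy.ne' (congrArg rank h3)

end

section

variable {δ : Ordinal.{u}} [hδ : Nice δ]

/-! ### Least witnesses -/

/-- The least limit ordinal in the relation `Q` to `x`. -/
def leastF (Q : VModel δ → VModel δ → Prop) (x : VModel δ) : VModel δ :=
  ord (sInf {η | ∃ y : VModel δ, IsLim y ∧ Q x y ∧ y.rk = η})

theorem leastF_spec {Q : VModel δ → VModel δ → Prop} {x : VModel δ}
    (h : ∃ y, IsLim y ∧ Q x y) : IsLim (leastF Q x) ∧ Q x (leastF Q x) ∧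
      ∀ y, IsLim y → Q x y → (leastF Q x).rk ≤ y.rk := by
  obtain ⟨y, hy, hQ⟩ := h
  obtain ⟨z, hz, hQz, hr⟩ := csInf_mem (s := {η | ∃ y : VModel δ, IsLim y ∧ Q x y ∧ y.rk = η})
    ⟨_, y, hy, hQ, rfl⟩
  have he : leastF Q x = z := by rw [leastF, ← hr, ← hz.1.eq]
  rw [he]
  refine ⟨hz, hQz, fun w hw hQw => ?_⟩
  rw [hr]
  exact csInf_le' ⟨w, hw, hQw, rfl⟩

theorem def_leastF {Q : VModel δ → VModel δ → Prop} [Def₂ Q]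
    (h : ∀ x, ∃ y, IsLim y ∧ Q x y) : DefF (leastF Q) := by
  refine ⟨Dfn.congr (P := fun v : Fin 2 → VModel δ => IsLim (v 1) ∧ Holds₂ Q (v 0) (v 1) ∧
    ∀ y, IsLim y → Holds₂ Q (v 0) y → RkLe (v 1) y) inferInstance fun v => ?_⟩
  obtain ⟨h1, h2, h3⟩ := leastF_spec (h (v 0))
  constructor
  · intro he
    rw [he]
    exact ⟨h1, h2, h3⟩
  · rintro ⟨h4, h5, h6⟩
    rw [h4.1.eq, h1.1.eq, le_antisymm (h6 _ h1 h2) (h3 _ h4 h5)]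

/-! ### Closure points of definable functions -/

/-- Otherwise the values of `F` on V_τ form an unbounded class, and some value F(z) is moved by a
map respecting `F`. With V_{τ+ω} as a fixed parameter, Kunen's theorem shows that z is fixed, hence
so is F(z). This takes the place of replacement, which is not yet available. -/
theorem HasEmbeddings.bounded (h : HasEmbeddings δ) (F : VModel δ → VModel δ) [DefF F]
    (hF : ∀ x, IsLim (F x)) {τ : Ordinal.{u}} (hτ : τ < δ) :
    ∃ ρ < δ, ∀ x : VModel δ, x.rk < τ → (F x).rk ≤ ρ := by
  by_contra hcon
  push Not at hcon
  set K : VModel δ → Prop := fun z => ∃ x ∈ (vv τ : VModel δ), z = Ap F x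
  have : Def₁ K := ⟨inferInstance⟩
  -- Taking the moved value above τ + ω + ω gives Kunen's theorem the room it needs.
  obtain ⟨x, y, J, ⟨z, hz, rfl⟩, hy, hxy, -, hρ, hJ, hne, -⟩ := h.exists_move
    (join Base (join (single (vv (τ + Ordinal.omega0))) (gr F))) K
    (by rintro _ ⟨x, -, rfl⟩; exact hF x)
    (fun ρ hρ => by
      obtain ⟨x, hx, hlt⟩ := hcon ρ hρ
      exact ⟨F x, ⟨x, (mem_vv hτ).2 hx, rfl⟩, hlt⟩) (add_omega_lt (add_omega_lt hτ))
  have hl : Order.IsSuccLimit y.rk := by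
    obtain ⟨w, -, rfl⟩ := hy
    exact (hF w).2
  have hz := (mem_vv hτ).1 hz
  have hlt := hρ.trans hxy
  have hvv : (vv (τ + Ordinal.omega0) : VModel δ).rk < y.rk := by
    rw [rk_vv (add_omega_lt hτ)]
    exact (isLeast_add_omega _).1.2.trans hlt
  have hz' := hz.trans (isLeast_add_omega τ).1.2
  have hJz : J z = z := (hJ.left hl).eq_self hl hτ hlt.le
    (((hJ.right hl).left hl).single_eq hvv) hz'
  have := ((hJ.right hl).right hl).app hl
    (hz'.trans ((isLeast_add_omega _).1.2.trans hlt)) hxy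
  rw [hJz] at this
  exact hne this

/-- A closure point is sought as the supremum of an ω-sequence of iterates. If there are no closure
points above ρ, the iterates are unbounded in δ and form a definable class. But a map that fixes the
starting point and commutes with the iterated function fixes every iterate in its domain, against
`HasEmbeddings.exists_move`. -/
theorem HasEmbeddings.exists_closed (h : HasEmbeddings δ) (F : VModel δ → VModel δ) [DefF F]
    (hF : ∀ x, IsLim (F x)) {ρ : Ordinal.{u}} (hρ : ρ < δ) :
    ∃ c : VModel δ, IsLim c ∧ ρ < c.rk ∧ ∀ x : VModel δ, x.rk < c.rk → (F x).rk < c.rk := by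
  by_contra hcon
  push Not at hcon
  -- `y` lies above `t` and above all values of `F` on V_t; such `y` exist by boundedness.
  set Q : VModel δ → VModel δ → Prop := fun t y => ¬ RkLe y t ∧ ∀ x ∈ vF t, ¬ RkLe y (Ap F x)
  have : Def₂ Q := ⟨inferInstance⟩
  have hQ : ∀ x, ∃ y, IsLim y ∧ Q x y := fun x => by
    obtain ⟨σ, hσ, hb⟩ := h.bounded F hF x.rk_lt
    have h1 := add_omega_lt (max_lt x.rk_lt hσ)
    have h2 := (isLeast_add_omega (max x.rk σ)).1.2
    refine ⟨ord (max x.rk σ + Ordinal.omega0), (isLim_ord h1).2 (isSuccLimit_add_omega _), ?_, ?_⟩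
    · rw [RkLe, rk_ord h1, not_le]
      exact (le_max_left _ _).trans_lt h2
    · intro z hz
      rw [RkLe, rk_ord h1, not_le]
      exact (hb z ((mem_vv x.rk_lt).1 hz)).trans_lt ((le_max_right _ _).trans_lt h2)
  have := def_leastF hQ
  set g := leastF Q
  set s₀ : VModel δ := ord (ρ + Ordinal.omega0)
  set s : ℕ → VModel δ := fun n => g^[n] s₀
  have hs : ∀ n, s (n + 1) = g (s n) := fun n => Function.iterate_succ_apply' g n s₀
  have hlt : ∀ n, (s n).rk < (s (n + 1)).rk := fun n => by
    rw [hs]; exact not_le.1 (leastF_spec (hQ (s n))).2.1.1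
  have hmono : StrictMono fun n => (s n).rk := strictMono_nat_of_lt_succ hlt
  have hlim : ∀ n, IsLim (s n) := fun n => by
    cases n with
    | zero => exact (isLim_ord (add_omega_lt hρ)).2 (isSuccLimit_add_omega _)
    | succ n => rw [hs]; exact (leastF_spec (hQ (s n))).1
  have hFs : ∀ n (x : VModel δ), x.rk < (s n).rk → (F x).rk < (s (n + 1)).rk := fun n x hx => by
    rw [hs]
    exact not_le.1 ((leastF_spec (hQ (s n))).2.1.2 x ((mem_vv (s n).rk_lt).2 hx))
  -- If the iterates were bounded, their supremum would be a closure point.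
  have hunb : ∀ θ < δ, ∃ n, θ < (s n).rk := by
    by_contra hb
    push Not at hb
    obtain ⟨θ, hθ, hb⟩ := hb
    set c := ⨆ n, (s n).rk
    have hcδ : c < δ := (Ordinal.iSup_le hb).trans_lt hθ
    have hle : ∀ n, (s n).rk ≤ c := fun n => Ordinal.le_iSup (fun n => (s n).rk) n
    have hex : ∀ a < c, ∃ n, a < (s n).rk := fun a ha => Ordinal.lt_iSup_iff.1 ha
    obtain ⟨x, hx, hx'⟩ := hcon (ord c) ((isLim_ord hcδ).2 (by
      rw [Ordinal.isSuccLimit_iff]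
      refine ⟨(zero_le.trans_lt ((hlt 0).trans_le (hle 1))).ne',
        Order.isSuccPrelimit_of_succ_lt fun a ha => ?_⟩
      obtain ⟨n, hn⟩ := hex a ha
      exact (Order.succ_le_of_lt hn).trans_lt ((hlt n).trans_le (hle _)))) (by
      rw [rk_ord hcδ]
      refine lt_of_lt_of_le ?_ (hle 0)
      change ρ < (ord (ρ + Ordinal.omega0) : VModel δ).rk
      rw [rk_ord (add_omega_lt hρ)]
      exact (isLeast_add_omega ρ).1.2)
    rw [rk_ord hcδ] at hx hx'
    obtain ⟨n, hn⟩ := hex _ hx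
    exact (hx'.trans_lt (hFs n x hn)).not_ge (hle _)
  -- A definition of the set of iterates by closure. Closure is demanded only at elements of rank
  -- below `z`, so that a finite initial segment of the iterates can serve as `X`.
  set K : VModel δ → Prop := fun z => ∀ X : VModel δ, s₀ ∈ X → (∀ w ∈ X, ¬ RkLe z w → Ap g w ∈ X) → z ∈ X
  have hKd : Def₁ K := ⟨inferInstance⟩
  have hK : ∀ z, K z ↔ ∃ n, z = s n := by
    intro z
    constructor
    · intro hz
      obtain ⟨n, hn⟩ := hunb _ z.rk_lt
      obtain ⟨X, -, hX⟩ := VModel.exists_set (fun w => ∃ k ≤ n, w = s k)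
        (Nice.succ_lt (s n).rk_lt) (by
          rintro _ ⟨k, hk, rfl⟩
          rw [Order.lt_succ_iff]
          exact hmono.monotone hk)
      obtain ⟨k, -, hk⟩ := (hX z).1 (hz X ((hX _).2 ⟨0, zero_le, rfl⟩) fun w hw hzw => by
        obtain ⟨k, -, rfl⟩ := (hX w).1 hw
        have hkn : k < n := hmono.lt_iff_lt.1 ((not_le.1 hzw).trans hn)
        exact (hX _).2 ⟨k + 1, hkn, (hs k).symm⟩)
      exact ⟨k, hk⟩
    · rintro ⟨n, rfl⟩ X h0 hX
      have : ∀ k ≤ n, s k ∈ X := by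
        intro k
        induction k with
        | zero => exact fun _ => h0
        | succ k ih =>
          intro hk
          have := hX _ (ih (by omega)) (not_le.2 (hmono (show k < n by omega)))
          rw [hs]
          exact this
      exact this n le_rfl
  obtain ⟨x, y, J, hx, hy, hxy, -, -, hJ, hne, -⟩ := h.exists_move
    (join (single s₀) (gr g)) K (fun z hz => by obtain ⟨n, rfl⟩ := (hK z).1 hz; exact hlim n)
    (fun θ hθ => by obtain ⟨n, hn⟩ := hunb θ hθ; exact ⟨s n, (hK _).2 ⟨n, rfl⟩, hn⟩) hρ
  obtain ⟨n, rfl⟩ := (hK x).1 hx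
  obtain ⟨m, rfl⟩ := (hK y).1 hy
  have hl := (hlim m).2
  refine hne ?_
  -- The start `s₀` is a fixed parameter and `J` commutes with `g`, so fixedness propagates along
  -- the iterates.
  have : ∀ k, (s k).rk < (s m).rk → J (s k) = s k := by
    intro k
    induction k with
    | zero => exact fun h0 => (hJ.left hl).single_eq h0
    | succ k ih =>
      intro hk
      have h1 := (hlt k).trans hk
      have := (hJ.right hl).app hl h1 (by rwa [← hs])
      rwa [ih h1, ← hs] at this
  exact this n hxy

/-- Maps respecting `Base` move all ordinals above their critical point. -/
theorem BMap.ord_ne {γ : Ordinal.{u}} {J : VModel δ → VModel δ} (h : BMap Base γ J)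
    (hγ : Order.IsSuccLimit γ) {κ a : Ordinal.{u}} (hκ : J (VopenkaScheme.ord κ) ≠ VopenkaScheme.ord κ)
    (hκa : κ ≤ a) (haδ : a < δ) (h1 : a + Ordinal.omega0 + Ordinal.omega0 < γ) :
    J (VopenkaScheme.ord a) ≠ VopenkaScheme.ord a := by
  intro hJa
  have h2 := (isLeast_add_omega (a + Ordinal.omega0)).1.2
  -- If a is fixed, then so are a + ω and V_{a+ω}; by Kunen's theorem everything in V_{a+ω} is
  -- fixed, including κ.
  have h3 : J (VopenkaScheme.limF (VopenkaScheme.ord a)) =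
      VopenkaScheme.limF (J (VopenkaScheme.ord a)) :=
    h.limF hγ (by rw [rk_ord haδ]; exact h2.trans h1)
  rw [hJa] at h3
  have h4 := h.vv hγ (h2.trans h1) (add_omega_lt haδ)
  have h5 : (VopenkaScheme.limF (VopenkaScheme.ord a) : VModel δ) =
      VopenkaScheme.ord (a + Ordinal.omega0) := by rw [VopenkaScheme.limF, rk_ord haδ]
  rw [h5] at h3
  rw [h3, rk_ord (add_omega_lt haδ)] at h4
  refine hκ (h.eq_self hγ haδ h1.le h4 ?_)
  rw [rk_ord (hκa.trans_lt haδ)]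
  exact hκa.trans_lt (isLeast_add_omega a).1.2

/-- Some map respecting `B` on `V_g` moves `k` above `g` and fixes the elements of `k`. -/
def Ext (B : VModel δ → Prop) (k g : VModel δ) : Prop :=
  ∃ e, EMap B e g ∧ (∀ x ∈ k, x.pr x ∈ e) ∧ ∃ y, k.pr y ∈ e ∧ g ∈ y

instance {α : Type} [Finite α] (B : VModel δ → Prop) [Def₁ B] (f g : (α → VModel δ) → VModel δ)
    [DFun f] [DFun g] : Dfn (fun v => Ext B (f v) (g v)) := by
  refine Dfn.subst₂ (P := Ext B) ?_ f g
  unfold Ext; infer_instance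

/-- Suppose every κ fails, and let F give the least limit height above κ + ω + ω at which it fails.
A map that respects F and its class of closure points, and moves one of them, has a critical point κ
that is itself a closure point. Then J(κ) is one as well, and F(κ) < J(κ), so `J` restricted to
V_{F(κ)} is a witness at the height where κ was to fail. -/
theorem HasEmbeddings.exists_ext (h : HasEmbeddings δ) (B : VModel δ → Prop) [Def₁ B] :
    ∃ κ < δ, ∀ η < δ, Order.IsSuccLimit η → κ + Ordinal.omega0 + Ordinal.omega0 < η →
      Ext (join Base B) (ord κ) (ord η) := by
  by_contra hcon
  push Not at hcon
  -- `Q x y` holds when `y` is above rk(x) + ω + ω and is a height at which rk(x) fails.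
  set Q : VModel δ → VModel δ → Prop := fun x y =>
    ¬ RkLe y (limF (limF x)) ∧ ¬ Ext (join Base B) (rkF x) y
  have : Def₂ Q := ⟨inferInstance⟩
  have hQ : ∀ x, ∃ y, IsLim y ∧ Q x y := fun x => by
    obtain ⟨η, hη, hl, hlt, hE⟩ := hcon x.rk x.rk_lt
    refine ⟨ord η, (isLim_ord hη).2 hl, ?_, hE⟩
    rwa [RkLe, rk_ord hη, rk_limF, rk_limF, not_le]
  have := def_leastF hQ
  set F := leastF Q
  have hF : ∀ x, IsLim (F x) := fun x => (leastF_spec (hQ x)).1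
  have hFx : ∀ x, x.rk + Ordinal.omega0 + Ordinal.omega0 < (F x).rk := fun x => by
    have := (leastF_spec (hQ x)).2.1.1
    rwa [RkLe, rk_limF, rk_limF, not_le] at this
  set C : VModel δ → Prop := fun c => IsLim c ∧ ∀ x ∈ c, Ap F x ∈ c
  have : Def₁ C := ⟨inferInstance⟩
  obtain ⟨x, y, J, hx, hy, hxy, -, -, hJ, hne, θ, hθ, hbd⟩ := h.exists_move
    (join (join Base B) (join (gr F) C)) C (fun x hx => hx.1) (fun ρ hρ => by
      obtain ⟨c, hc, hρc, hcl⟩ := h.exists_closed F hF hρ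
      refine ⟨c, ⟨hc, fun x hx => ?_⟩, hρc⟩
      have h1 := hcl x (VModel.rk_lt_of_mem hx)
      change F x ∈ c
      rw [(hF x).1.eq, hc.1.eq]
      exact (ord_mem_ord (F x).rk_lt c.rk_lt).2 h1) Nice.pos
  have hl := hy.1.2
  have hB := hJ.left hl
  have hb := hB.left hl
  have hg := (hJ.right hl).left hl
  have hcl : ∀ c, C c → ∀ a < c.rk, (F (ord a)).rk < c.rk := fun c hc a ha => by
    refine VModel.rk_lt_of_mem (hc.2 (ord a) ?_)
    rw [hc.1.1.eq]
    exact (ord_mem_ord (ha.trans c.rk_lt) c.rk_lt).2 ha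
  obtain ⟨κ, ⟨hκy, hκ⟩, hmin⟩ := WellFounded.has_min (wellFounded_lt (α := Ordinal.{u}))
    {a | a < y.rk ∧ J (ord a) ≠ ord a} ⟨x.rk, hxy, by rwa [← hx.1.1.eq]⟩
  have hfix : ∀ a < κ, J (ord a) = ord a := fun a ha => by
    by_contra hJa
    exact hmin a ⟨ha.trans hκy, hJa⟩ ha
  have hκδ := hκy.trans y.rk_lt
  -- Since F(a) exceeds a + ω + ω, closure of `y` under F leaves the room below `y` that Kunen's
  -- theorem requires.
  have hadd : ∀ a < y.rk, a + Ordinal.omega0 + Ordinal.omega0 < y.rk := fun a ha => by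
    have := (hFx (ord a)).trans (hcl y hy a ha)
    rwa [rk_ord (ha.trans y.rk_lt)] at this
  have hmove : ∀ a, κ ≤ a → a < y.rk → J (ord a) ≠ ord a := fun a hκa ha =>
    hb.ord_ne hl hκ hκa (ha.trans y.rk_lt) (hadd a ha)
  -- For a < κ the ordinal F(a) is fixed by `J`, whereas all ordinals from κ up to `y` are moved.
  have hFκ : ∀ a < κ, (F (ord a)).rk < κ := fun a ha => by
    have h1 := hcl y hy a (ha.trans hκy)
    have h2 := hg.app hl (x := ord a) (by rw [rk_ord (ha.trans hκδ)]; exact ha.trans hκy) h1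
    rw [hfix a ha] at h2
    by_contra hle
    refine hmove _ (not_lt.1 hle) h1 ?_
    rwa [← (hF (ord a)).1.eq]
  have hκC : C (ord κ) := by
    refine ⟨(isLim_ord hκδ).2 ?_, fun z hz => ?_⟩
    · rw [Ordinal.isSuccLimit_iff]
      refine ⟨?_, Order.isSuccPrelimit_of_succ_lt fun a ha => ?_⟩
      · rintro rfl
        rw [ord_zero] at hκ
        exact hκ hb.emp
      · refine lt_of_le_of_lt ?_ (hFκ a ha)
        have := hFx (ord a)
        rw [rk_ord (ha.trans hκδ)] at this
        exact (Order.succ_le_of_lt ((isLeast_add_omega a).1.2.trans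
          ((isLeast_add_omega _).1.2.trans this)))
    · obtain ⟨a, ha, rfl⟩ := (mem_ord hκδ).1 hz
      change F (ord a) ∈ _
      rw [(hF _).1.eq]
      exact (ord_mem_ord (VModel.rk_lt _) hκδ).2 (hFκ a ha)
  -- The class of closure points is part of the respected predicate, so J(κ) is a closure point
  -- above κ.
  have hJC : C (J (ord κ)) :=
    (((hJ.right hl).right hl).iff (ord κ) (by rwa [rk_ord hκδ])).1 hκC
  have hlt : κ < (J (ord κ)).rk := (hb.le_rk_ord hl hκy hκδ).lt_of_ne fun he =>
    hκ (by rw [hb.ord hl hκy hκδ, ← he])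
  have hFJ := hcl _ hJC κ hlt
  have hFy := hcl y hy κ hκy
  obtain ⟨e, he, he'⟩ := (hB.mono hFy.le).exists_eMap (hF _).2 hθ fun z hz => hbd z (hz.trans hFy)
  have hκF : κ < (F (ord κ)).rk := by
    have := hFx (ord κ)
    rw [rk_ord hκδ] at this
    exact (isLeast_add_omega κ).1.2.trans ((isLeast_add_omega _).1.2.trans this)
  -- This contradicts the choice of F(κ) as a height at which κ fails.
  refine (leastF_spec (hQ (ord κ))).2.1.2 ⟨e, he, fun z hz => ?_, J (ord κ), ?_, ?_⟩
  · rw [rkF, rk_ord hκδ] at hz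
    obtain ⟨a, ha, rfl⟩ := (mem_ord hκδ).1 hz
    exact (he' _ _).2 ⟨by rw [rk_ord (ha.trans hκδ)]; exact ha.trans hκF, hfix a ha⟩
  · rw [rkF, rk_ord hκδ]
    exact (he' _ _).2 ⟨by rwa [rk_ord hκδ], rfl⟩
  · change F (ord κ) ∈ _
    rw [(hF _).1.eq, hJC.1.1.eq]
    exact (ord_mem_ord (VModel.rk_lt _) (VModel.rk_lt _)).2 hFJ

end

section

variable {δ : Ordinal.{u}} [hδ : Nice δ]

/-! ### Extendible cardinals -/

/-- If β < κ had the cardinality of κ, let f map β onto κ. The map J(f) has range J(κ), which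
contains κ; but β, its elements and all values of f are fixed, so J(f) takes only values below κ. -/
theorem BMap.isInitial {γ : Ordinal.{u}} {J : VModel δ → VModel δ} (h : BMap Base γ J)
    (hγ : Order.IsSuccLimit γ) (hγδ : γ ≤ δ) {κ : Ordinal.{u}} (hκγ : κ < γ)
    (hfix : ∀ a < κ, J (VopenkaScheme.ord a) = VopenkaScheme.ord a)
    (hκ : J (VopenkaScheme.ord κ) ≠ VopenkaScheme.ord κ) :
    κ.IsInitial := by
  by_contra hne
  set β := κ.card.ord
  have hβ : β < κ := (Cardinal.ord_card_le κ).lt_of_ne hne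
  have hκδ := hκγ.trans_le hγδ
  have hβδ := hβ.trans hκδ
  obtain ⟨e⟩ : Nonempty (Set.Iio β ≃ Set.Iio κ) := Cardinal.eq.1 (by
    rw [Cardinal.mk_Iio_ordinal, Cardinal.mk_Iio_ordinal, Cardinal.card_ord])
  set μ := Order.succ (Order.succ κ)
  have hμ : μ < γ := hγ.succ_lt (hγ.succ_lt hκγ)
  obtain ⟨f, hfr, hf⟩ := VModel.exists_set (fun z : VModel δ => ∃ b : Set.Iio β,
    z = (VopenkaScheme.ord b.1).pr (VopenkaScheme.ord (e b).1)) (hμ.trans_le hγδ) (by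
      rintro _ ⟨b, rfl⟩
      rw [rk_pr, Order.succ_lt_succ_iff, Order.succ_lt_succ_iff,
        rk_ord (lt_trans b.2 hβδ), rk_ord (lt_trans (e b).2 hκδ)]
      exact max_lt (lt_trans b.2 hβ) (e b).2)
  have hfγ := hfr.trans_lt hμ
  have key : ∀ x y : VModel δ, x.pr y ∈ f ↔
      ∃ b : Set.Iio β, x = VopenkaScheme.ord b.1 ∧ y = VopenkaScheme.ord (e b).1 := fun x y => by
    rw [hf]
    exact exists_congr fun b => VModel.pr_inj
  have hfn : IsFn f (VopenkaScheme.ord β) := by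
    refine ⟨fun z hz => ?_, fun i hi => ?_⟩
    · obtain ⟨b, rfl⟩ := (hf z).1 hz
      exact ⟨_, (mem_ord hβδ).2 ⟨b.1, b.2, rfl⟩, _, rfl⟩
    · obtain ⟨b, hb, rfl⟩ := (mem_ord hβδ).1 hi
      refine ⟨_, (key _ _).2 ⟨⟨b, hb⟩, rfl, rfl⟩, fun y' hy' => ?_⟩
      obtain ⟨b', h1, rfl⟩ := (key _ _).1 hy'
      have : b' = ⟨b, hb⟩ := Subtype.ext
        ((ord_inj (lt_trans b'.2 hβδ) (lt_trans hb hβδ)).1 h1.symm)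
      rw [this]
  have hran : IsRan f (VopenkaScheme.ord κ) := by
    intro z
    rw [mem_ord hκδ]
    constructor
    · rintro ⟨c, hc, rfl⟩
      exact ⟨_, (key _ _).2 ⟨e.symm ⟨c, hc⟩, rfl, by rw [e.apply_symm_apply]⟩⟩
    · rintro ⟨i, hi⟩
      obtain ⟨b, rfl, rfl⟩ := (key _ _).1 hi
      exact ⟨_, (e b).2, rfl⟩
  have hβr : (VopenkaScheme.ord β : VModel δ).rk < γ := by
    rw [rk_ord hβδ]; exact hβ.trans hκγ
  have hJran := (h.isRan hγ hfγ (by rwa [rk_ord hκδ])).1 hran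
  have hlt : κ < (J (VopenkaScheme.ord κ)).rk := (h.le_rk_ord hγ hκγ hκδ).lt_of_ne fun he =>
    hκ (by rw [h.ord hγ hκγ hκδ, ← he])
  have hmem : VopenkaScheme.ord κ ∈ J (VopenkaScheme.ord κ) := by
    rw [h.ord hγ hκγ hκδ]
    exact (ord_mem_ord hκδ (VModel.rk_lt _)).2 hlt
  obtain ⟨i, hi⟩ := (hJran _).1 hmem
  obtain ⟨y, hy, hiy⟩ := (h.fn_apply hγ hfn hfγ hβr (hfix β hβ) (fun i hi => by
    obtain ⟨b, hb, rfl⟩ := (mem_ord hβδ).1 hi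
    exact hfix b (hb.trans hβ))).1 hi
  obtain ⟨b, -, rfl⟩ := (key _ _).1 hiy
  rw [hfix _ (e b).2, ord_inj hκδ (lt_trans (e b).2 hκδ)] at hy
  exact absurd (e b).2 (by rw [Set.mem_Iio, ← hy]; exact lt_irrefl κ)

/-- Maps with critical point `κ` and large image of `κ` make `κ` extendible. -/
theorem isExtendibleBelow_of_bMap {A : Set ZFSet.{u}} {κ : Ordinal.{u}} (hκ : κ < δ)
    (h : ∀ α < δ, κ < α → ∃ J, BMap (join Base (vcodeA A) : VModel δ → Prop)
      (α + Ordinal.omega0 + Ordinal.omega0) J ∧ (∀ a < κ, J (ord a) = ord a) ∧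
      α < (J (ord κ)).rk) : IsExtendibleBelow δ A κ := by
  have hl := fun α : Ordinal.{u} => isSuccLimit_add_omega (α + Ordinal.omega0)
  have hlt := fun α : Ordinal.{u} =>
    (isLeast_add_omega α).1.2.trans (isLeast_add_omega (α + Ordinal.omega0)).1.2
  refine ⟨hκ, ?_, fun α hα hαδ => ?_⟩
  -- The instance α = κ + 1 already suffices to see that κ is a cardinal.
  · obtain ⟨J, hJ, hfix, hJκ⟩ := h _ (Nice.succ_lt hκ) (Order.lt_succ κ)
    refine (hJ.left (hl _)).isInitial (hl _)
      (add_omega_lt (add_omega_lt (Nice.succ_lt hκ))).le ((Order.lt_succ κ).trans (hlt _)) hfix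
      fun he => ?_
    rw [he, rk_ord hκ] at hJκ
    exact (Order.lt_succ κ).not_gt hJκ
  · obtain ⟨J, hJ, hfix, hJκ⟩ := h _ hαδ hα
    obtain ⟨j, hj⟩ := (hJ.left (hl _)).exists_vPred (hJ.right (hl _)) (hl _)
      (add_omega_lt (add_omega_lt hαδ)).le (zero_le.trans_lt hα) hαδ le_rfl
    have hJo := (hJ.left (hl _)).ord (hl _) (hα.trans (hlt α)) hκ
    have hjκ : (j (ordElem A hα)).1 = (J (ord κ)).1 := hj _
    refine ⟨_, (J (ord α)).rk_lt, j, ⟨?_, fun ξ hξ => ?_⟩, ?_⟩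
    · rw [hjκ, hJo, ord_val (VModel.rk_lt _)]
      exact fun he => (hα.trans hJκ).ne' (Ordinal.toZFSet_injective he)
    · refine (hj _).trans ?_
      change (J (ord ξ)).1 = _
      rw [hfix ξ hξ, ord_val (hξ.trans hκ)]
    · rw [hjκ, hJo, ord_val (VModel.rk_lt _), Ordinal.toZFSet_mem_toZFSet_iff]
      exact hJκ

theorem HasEmbeddings.exists_isExtendibleBelow (h : HasEmbeddings δ) {A : Set ZFSet.{u}}
    (hA : DefinableIn δ A) : ∃ κ : Ordinal.{u}, IsExtendibleBelow δ A κ := by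
  have := def_vcodeA hA
  obtain ⟨κ, hκ, hext⟩ := h.exists_ext (vcodeA A)
  refine ⟨κ, isExtendibleBelow_of_bMap hκ fun α hα hκα => ?_⟩
  -- The third ω makes η strictly larger than α + ω + ω, and hence than κ + ω + ω, as
  -- `HasEmbeddings.exists_ext` requires.
  set η := α + Ordinal.omega0 + Ordinal.omega0 + Ordinal.omega0
  have hη : η < δ := add_omega_lt (add_omega_lt (add_omega_lt hα))
  have hη' : α + Ordinal.omega0 + Ordinal.omega0 < η := (isLeast_add_omega _).1.2
  have hle : κ + Ordinal.omega0 + Ordinal.omega0 ≤ α + Ordinal.omega0 + Ordinal.omega0 := by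
    gcongr
  have hαη : α < η := (isLeast_add_omega _).1.2.trans ((isLeast_add_omega _).1.2.trans hη')
  obtain ⟨e, he, hfix, y, hy, hlt⟩ := hext η hη (isSuccLimit_add_omega _) (hle.trans_lt hη')
  obtain ⟨J, hJ, hJe⟩ := he.exists_bMap
  rw [rk_ord hη] at hJ
  obtain ⟨-, rfl⟩ := (hJe _ _).1 hy
  refine ⟨J, hJ.mono hη'.le, fun a ha => ?_, ?_⟩
  · exact ((hJe _ _).1 (hfix _ ((ord_mem_ord (ha.trans hκ) hκ).2 ha))).2
  · have := VModel.rk_lt_of_mem hlt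
    rw [rk_ord hη] at this
    exact hαη.trans this

/-- An extendible cardinal for a definable predicate gives maps respecting this predicate. -/
theorem IsExtendibleBelow.exists_bMap {B : VModel δ → Prop} {κ : Ordinal.{u}}
    (h : IsExtendibleBelow δ (toSet B) κ) {α : Ordinal.{u}} (hκα : κ < α) (hαδ : α < δ)
    (hα : Order.IsSuccLimit α) : ∃ J, BMap B α J ∧ (∀ a < κ, J (ord a) = ord a) ∧
      α < (J (ord κ)).rk ∧ ∃ θ < δ, ∀ x : VModel δ, x.rk < α → (J x).rk < θ := by
  obtain ⟨hκ, -, h⟩ := h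
  obtain ⟨θ, hθ, j, ⟨-, hfix⟩, hlt⟩ := h α hκα hαδ
  have hval : ∀ a (ha : a < α), (lift j (ord a) : VModel δ).1 = (j (ordElem _ ha)).1 := by
    intro a ha
    have haδ := ha.trans hαδ
    rw [lift_val hθ.le (by rwa [rk_ord haδ])]
    congr 2
    exact VPred.val_inj.2 (ord_val haδ)
  refine ⟨lift j, BMap.lift hα hθ.le j, fun a ha => ?_, ?_, θ, hθ,
    fun x hx => rk_lift_lt hθ.le hx⟩
  · rw [VModel.val_inj, hval a (ha.trans hκα), hfix a ha, ord_val (ha.trans hκ)]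
  · rw [VModel.rk, hval κ hκα]
    conv_lhs => rw [← Ordinal.rank_toZFSet α]
    exact rank_lt_of_mem hlt

end

section

variable {δ : Ordinal.{u}} [hδ : Nice δ]

/-! ### Definable stationarity -/

theorem IsExtendibleBelow.pos {B : VModel δ → Prop} {κ : Ordinal.{u}}
    (h : IsExtendibleBelow δ (toSet B) κ) : 0 < κ := by
  refine pos_iff_ne_zero.2 ?_
  rintro rfl
  obtain ⟨J, hJ, -, hlt, -⟩ := h.exists_bMap Ordinal.omega0_pos hδ.omega_lt
    Ordinal.isSuccLimit_omega0
  rw [ord_zero, hJ.emp, rk_emp] at hlt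
  exact not_lt_bot hlt

/-- If there are extendible cardinals for all definable predicates then they form definably
stationary sets. -/
theorem definablyStationary_of_exists
    (h : ∀ A : Set ZFSet.{u}, DefinableIn δ A → ∃ κ : Ordinal.{u}, IsExtendibleBelow δ A κ)
    {A : Set ZFSet.{u}} (hA : DefinableIn δ A) :
    DefinablyStationary δ {κ : Ordinal.{u} | IsExtendibleBelow δ A κ} := by
  intro C hC hCd
  have := def_vcodeA hA
  set Cl : VModel δ → Prop := fun z => z.1 ∈ (fun α : Set.Iio δ => α.1.toZFSet) '' C
  have : Def₁ Cl := hCd.def₁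
  have hCl : ∀ a (ha : a < δ), Cl (ord a) ↔ ⟨a, ha⟩ ∈ C := by
    intro a ha
    change (ord a : VModel δ).1 ∈ _ ↔ _
    rw [ord_val ha]
    constructor
    · rintro ⟨b, hb, he⟩
      rwa [← (Subtype.ext (Ordinal.toZFSet_injective he) : b = ⟨a, ha⟩)]
    · exact fun hc => ⟨_, hc, rfl⟩
  have hCl' : ∀ z, Cl z → ∃ b ∈ C, z = ord b.1 := by
    rintro z ⟨b, hb, he⟩
    exact ⟨b, hb, VModel.val_inj.2 (by rw [ord_val b.2, ← he])⟩
  -- `y` is the next point of the club above `x`.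
  set Nx : VModel δ → VModel δ → Prop := fun x y => Holds Cl y ∧ ¬ RkLe y x ∧
    ∀ z, Holds Cl z → ¬ RkLe z x → RkLe y z
  have : Def₂ Nx := ⟨inferInstance⟩
  obtain ⟨κ, hκ⟩ := h _ (definableIn_toSet (join (join Base (vcodeA A)) (un₂ Nx)))
  have hκδ := hκ.1
  have hl := fun α : Ordinal.{u} => isSuccLimit_add_omega (α + Ordinal.omega0)
  have hlt := fun α : Ordinal.{u} =>
    (isLeast_add_omega α).1.2.trans (isLeast_add_omega (α + Ordinal.omega0)).1.2
  refine ⟨⟨κ, hκδ⟩, ?_, isExtendibleBelow_of_bMap hκδ fun α hα hκα => ?_⟩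
  · by_contra hκC
    -- If `C` had points cofinal in κ, then κ would be in `C` by closure; so `C` is bounded below κ.
    obtain ⟨b, hb, hbC⟩ : ∃ b < κ, ∀ c ∈ C, c.1 < κ → c.1 ≤ b := by
      by_contra hcon
      push Not at hcon
      refine hκC (hC.isLUB_mem (t := {c | c ∈ C ∧ c.1 < κ}) (fun c hc => hc.1) ?_ ⟨?_, ?_⟩)
      · obtain ⟨c, hc, hcκ, -⟩ := hcon 0 hκ.pos
        exact ⟨c, hc, hcκ⟩
      · exact fun c hc => hc.2.le
      · intro d hd
        by_contra hlt
        obtain ⟨c, hc, hcκ, hdc⟩ := hcon d.1 (not_le.1 hlt)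
        exact hdc.not_ge (hd ⟨hc, hcκ⟩)
    have hbδ := hb.trans hκδ
    obtain ⟨c, ⟨hc, hbc⟩, hmin⟩ := WellFounded.has_min (wellFounded_lt (α := Set.Iio δ))
      {c | c ∈ C ∧ b < c.1} (by
        obtain ⟨c, hc, hle⟩ := hC.isCofinal ⟨κ, hκδ⟩
        exact ⟨c, hc, hb.trans_le hle⟩)
    have hκc : κ < c.1 := by
      rcases lt_trichotomy c.1 κ with hlt | heq | hlt
      · exact ((hbC c hc hlt).not_gt hbc).elim
      · exact (hκC ((Subtype.ext heq.symm : (⟨κ, hκδ⟩ : Set.Iio δ) = c) ▸ hc)).elim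
      · exact hlt
    have hNx : ∀ y, Nx (ord b) y ↔ y = ord c.1 := by
      have h1 : Nx (ord b) (ord c.1) := by
        refine ⟨(hCl c.1 c.2).2 hc, ?_, fun z hz hzb => ?_⟩
        · rw [RkLe, rk_ord c.2, rk_ord hbδ, not_le]
          exact hbc
        · obtain ⟨d, hd, rfl⟩ := hCl' z hz
          rw [RkLe, rk_ord d.2, rk_ord hbδ, not_le] at hzb
          rw [RkLe, rk_ord d.2, rk_ord c.2]
          exact not_lt.1 (hmin d ⟨hd, hzb⟩)
      refine fun y => ⟨fun hy => ?_, fun he => he ▸ h1⟩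
      obtain ⟨d, hd, rfl⟩ := hCl' y hy.1
      have h2 := le_antisymm (h1.2.2 _ hy.1 hy.2.1) (hy.2.2 _ h1.1 h1.2.1)
      rw [rk_ord c.2, rk_ord d.2] at h2
      rw [h2]
    set α := c.1 + Ordinal.omega0 + Ordinal.omega0 + Ordinal.omega0
    have hα : α < δ := add_omega_lt (add_omega_lt (add_omega_lt c.2))
    have hcα : c.1 + Ordinal.omega0 + Ordinal.omega0 < α := (isLeast_add_omega _).1.2
    have hcα' := (hlt c.1).trans hcα
    have hαl : Order.IsSuccLimit α := isSuccLimit_add_omega _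
    obtain ⟨J, hJ, hfix, hJκ, -⟩ := hκ.exists_bMap (hκc.trans hcα') hα hαl
    have h1 := (hJ.right hαl).iff₂ hαl (x := ord b) (y := ord c.1)
      (by rw [rk_ord hbδ]; exact hbc.trans hcα') (by rwa [rk_ord c.2])
    rw [hfix b hb, hNx, hNx] at h1
    -- Since b is fixed, so is the next point c of the club; but c lies above the critical point, so
    -- it must be moved.
    refine ((hJ.left hαl).left hαl).ord_ne hαl (fun he => ?_) hκc.le c.2 hcα (h1.1 rfl)
    rw [he, rk_ord hκδ] at hJκ
    exact (hκc.trans hcα').not_gt hJκ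
  · have hα' := add_omega_lt (add_omega_lt hα)
    obtain ⟨J, hJ, hfix, hJκ, -⟩ := hκ.exists_bMap (hκα.trans (hlt α)) hα' (hl α)
    exact ⟨J, hJ.left (hl α), hfix, (hlt α).trans hJκ⟩

end

section

variable {δ : Ordinal.{u}}

/-! ### The axioms of ZFC in `V_δ` -/

theorem realize_memF {α : Type} {n : ℕ} {s t : setLang.Term (α ⊕ Fin n)} {v : α → VModel δ}
    {xs : Fin n → VModel δ} : (memF s t).Realize v xs ↔
      s.realize (Sum.elim v xs) ∈ t.realize (Sum.elim v xs) :=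
  BoundedFormula.realize_rel₂

theorem realize_closure {n : ℕ} {φ : setLang.Formula (Fin n)} :
    (VModel δ ⊨ closure φ) ↔ ∀ p : Fin n → VModel δ, φ.Realize p := by
  rw [closure, Sentence.Realize, Formula.realize_iAlls]
  refine forall_congr' fun p => ?_
  rw [Formula.realize_relabel]
  rfl

theorem realize_plug {n k m : ℕ} {φ : setLang.Formula (Fin n ⊕ Fin k)} {v : Fin k → Fin m}
    {p : Fin n → VModel δ} {xs : Fin m → VModel δ} :
    (plug φ v).Realize p xs ↔ φ.Realize (Sum.elim p (xs ∘ v)) := by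
  refine BoundedFormula.realize_relabel.trans ?_
  rw [Formula.Realize]
  convert! Iff.rfl using 2
  ext i
  cases i <;> rfl

theorem dfn_realize {n : ℕ} (φ : setLang.Formula (Fin n ⊕ Fin 2)) (p : Fin n → VModel δ) :
    Def₂ (fun x y => φ.Realize (Sum.elim p ![x, y])) := by
  have h : Dfn (fun v : Fin n ⊕ Fin 2 → VModel δ => φ.Realize v) :=
    ⟨Set.Definable.mono (Set.empty_definable_iff.2 ⟨φ, rfl⟩) (Set.empty_subset _)⟩
  refine ⟨Dfn.congr (h.subst (F := Sum.elim (fun i _ => p i) fun k v => v k) ?_) fun v => ?_⟩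
  · rintro (i | k)
    · exact DFun.const (p i)
    · exact DFun.proj k
  · convert! Iff.rfl using 2
    ext i
    rcases i with i | k
    · rfl
    · fin_cases k <;> rfl

/-- `V_δ` satisfies the replacement scheme, expressed with definable relations. -/
def HasReplacement (δ : Ordinal.{u}) : Prop :=
  ∀ (Q : VModel δ → VModel δ → Prop) [Def₂ Q] (a : VModel δ),
    (∀ x ∈ a, ∀ y y', Q x y → Q x y' → y = y') → ∃ b : VModel δ, ∀ y, y ∈ b ↔ ∃ x ∈ a, Q x y

variable [hδ : Nice δ]

omit hδ in
theorem realize_extensionality : VModel δ ⊨ extensionality := by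
  simp only [extensionality, Sentence.Realize, Formula.Realize, BoundedFormula.realize_all,
    BoundedFormula.realize_imp, BoundedFormula.realize_iff, BoundedFormula.realize_bdEqual,
    realize_memF, Term.realize_var, Sum.elim_inr, Function.comp]
  intro x y h
  exact VModel.ext' h

omit hδ in
theorem realize_foundation : VModel δ ⊨ foundation := by
  simp only [foundation, Sentence.Realize, Formula.Realize, BoundedFormula.realize_all,
    BoundedFormula.realize_imp, BoundedFormula.realize_ex, BoundedFormula.realize_inf,
    BoundedFormula.realize_not, realize_memF, Term.realize_var, Sum.elim_inr, Function.comp]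
  rintro x ⟨y, hy⟩
  obtain ⟨a, ⟨z, hz, rfl⟩, hmin⟩ := WellFounded.has_min (wellFounded_lt (α := Ordinal.{u}))
    (VModel.rk '' {y : VModel δ | y ∈ x}) ⟨_, y, hy, rfl⟩
  exact ⟨z, hz, fun w hw => hmin _ ⟨w, hw.1, rfl⟩ (VModel.rk_lt_of_mem hw.2)⟩

theorem realize_pairing : VModel δ ⊨ pairing := by
  simp only [pairing, Sentence.Realize, Formula.Realize, BoundedFormula.realize_all,
    BoundedFormula.realize_ex, BoundedFormula.realize_iff, BoundedFormula.realize_sup,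
    BoundedFormula.realize_bdEqual, realize_memF, Term.realize_var, Sum.elim_inr, Function.comp]
  exact fun x y => ⟨x.upair y, fun z => VModel.mem_upair⟩

omit hδ in
theorem realize_union : VModel δ ⊨ union := by
  simp only [union, Sentence.Realize, Formula.Realize, BoundedFormula.realize_all,
    BoundedFormula.realize_ex, BoundedFormula.realize_iff, BoundedFormula.realize_inf,
    realize_memF, Term.realize_var, Sum.elim_inr, Function.comp]
  intro x
  obtain ⟨b, -, hb⟩ := VModel.exists_set (fun z => ∃ y, y ∈ x ∧ z ∈ y) x.rk_lt (by
    rintro z ⟨y, hy, hz⟩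
    exact (VModel.rk_lt_of_mem hz).trans (VModel.rk_lt_of_mem hy))
  exact ⟨b, hb⟩

theorem realize_powerSet : VModel δ ⊨ powerSet := by
  simp only [powerSet, Sentence.Realize, Formula.Realize, BoundedFormula.realize_all,
    BoundedFormula.realize_ex, BoundedFormula.realize_iff, BoundedFormula.realize_imp,
    realize_memF, Term.realize_var, Sum.elim_inr, Function.comp]
  intro x
  obtain ⟨b, -, hb⟩ := VModel.exists_set (fun z : VModel δ => ∀ y, y ∈ z → y ∈ x)
    (Nice.succ_lt x.rk_lt) (by
      intro z hz
      rw [Order.lt_succ_iff]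
      exact VModel.rk_le_iff.2 fun y hy => VModel.rk_lt_of_mem (hz y hy))
  exact ⟨b, hb⟩

theorem realize_infinity : VModel δ ⊨ infinity := by
  simp only [infinity, Sentence.Realize, Formula.Realize, BoundedFormula.realize_all,
    BoundedFormula.realize_ex, BoundedFormula.realize_iff, BoundedFormula.realize_imp,
    BoundedFormula.realize_inf, BoundedFormula.realize_sup, BoundedFormula.realize_not,
    BoundedFormula.realize_bdEqual, realize_memF, Term.realize_var, Sum.elim_inr, Function.comp]
  refine ⟨om, ⟨nat 0, mem_om.2 ⟨0, rfl⟩, fun z => ?_⟩, fun x hx => ?_⟩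
  · change ¬ z ∈ (nat 0 : VModel δ)
    rw [nat, Nat.cast_zero, ord_zero]
    exact VModel.notMem_emp
  · change x ∈ (om : VModel δ) at hx
    obtain ⟨n, rfl⟩ := mem_om.1 hx
    refine ⟨nat (n + 1), mem_om.2 ⟨n + 1, rfl⟩, fun z => ?_⟩
    change z ∈ (nat (n + 1) : VModel δ) ↔ z ∈ (nat n : VModel δ) ∨ z = nat n
    rw [nat_succ, mem_sucF, or_comm]

omit hδ in
theorem realize_choice : VModel δ ⊨ choice := by
  simp only [choice, Sentence.Realize, Formula.Realize, BoundedFormula.realize_all,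
    BoundedFormula.realize_ex, BoundedFormula.realize_iff, BoundedFormula.realize_imp,
    BoundedFormula.realize_inf, BoundedFormula.realize_bdEqual, realize_memF, Term.realize_var,
    Sum.elim_inr, Function.comp]
  intro a h1 h2
  change ∀ x : VModel δ, x ∈ a → ∃ y, y ∈ x at h1
  change ∀ x x' y : VModel δ, x ∈ a → x' ∈ a → y ∈ x → y ∈ x' → x = x' at h2
  change ∃ c : VModel δ, ∀ x : VModel δ, x ∈ a → ∃ y, ∀ z, z ∈ x ∧ z ∈ c ↔ z = y
  -- The transversal is chosen in the ambient universe; it lies in V_δ because its elements have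
  -- ranks below that of `a`.
  choose f hf using h1
  obtain ⟨c, -, hc⟩ := VModel.exists_set (fun z => ∃ x, ∃ hx : x ∈ a, z = f x hx) a.rk_lt (by
    rintro _ ⟨x, hx, rfl⟩
    exact (VModel.rk_lt_of_mem (hf x hx)).trans (VModel.rk_lt_of_mem hx))
  refine ⟨c, fun x hx => ⟨f x hx, fun z => ⟨?_, ?_⟩⟩⟩
  · rintro ⟨hz, hzc⟩
    obtain ⟨x', hx', rfl⟩ := (hc z).1 hzc
    have := h2 x x' _ hx hx' hz (hf x' hx')
    subst this
    rfl
  · rintro rfl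
    exact ⟨hf x hx, (hc _).2 ⟨x, hx, rfl⟩⟩

omit hδ in
theorem realize_separation {n : ℕ} (φ : setLang.Formula (Fin n ⊕ Fin 1)) :
    VModel δ ⊨ separation φ := by
  rw [separation, realize_closure]
  intro p
  simp only [Formula.Realize, BoundedFormula.realize_all, BoundedFormula.realize_ex,
    BoundedFormula.realize_iff, BoundedFormula.realize_inf, realize_memF, realize_plug,
    Term.realize_var, Sum.elim_inr, Function.comp]
  intro a
  obtain ⟨b, -, hb⟩ := VModel.exists_set
    (fun x : VModel δ => x ∈ a ∧ φ.Realize (Sum.elim p ![x])) a.rk_lt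
    fun x hx => VModel.rk_lt_of_mem hx.1
  refine ⟨b, fun x => (hb x).trans (and_congr_right fun _ => ?_)⟩
  have hv : ∀ f : Fin 1 → VModel δ, f 0 = x → f = ![x] := by
    rintro f rfl
    ext i
    fin_cases i
    rfl
  exact (congrArg (fun f => φ.Realize (Sum.elim p f)) (hv _ rfl)).symm.to_iff

omit hδ in
theorem realize_replacement (h : HasReplacement δ) {n : ℕ}
    (φ : setLang.Formula (Fin n ⊕ Fin 2)) : VModel δ ⊨ replacement φ := by
  rw [replacement, realize_closure]
  intro p
  simp only [Formula.Realize, BoundedFormula.realize_all, BoundedFormula.realize_ex,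
    BoundedFormula.realize_iff, BoundedFormula.realize_inf, BoundedFormula.realize_imp,
    BoundedFormula.realize_bdEqual, realize_memF, realize_plug,
    Term.realize_var, Sum.elim_inr, Function.comp]
  intro a ha
  have := dfn_realize φ p
  have hv : ∀ x y : VModel δ, ∀ f : Fin 2 → VModel δ, f 0 = x → f 1 = y → f = ![x, y] := by
    rintro x y f rfl rfl
    ext i
    fin_cases i <;> rfl
  obtain ⟨b, hb⟩ := h (fun x y => φ.Realize (Sum.elim p ![x, y])) a fun x hx y y' hy hy' => by
    refine ha x hx y y' ?_ ?_
    · exact (congrArg (fun f => φ.Realize (Sum.elim p f)) (hv x y _ rfl rfl)).mpr hy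
    · exact (congrArg (fun f => φ.Realize (Sum.elim p f)) (hv x y' _ rfl rfl)).mpr hy'
  refine ⟨b, fun y => (hb y).trans (exists_congr fun x => and_congr_right fun _ => ?_)⟩
  exact (congrArg (fun f => φ.Realize (Sum.elim p f)) (hv x y _ rfl rfl)).symm.to_iff

theorem models_ZFC (h : HasReplacement δ) : VModel δ ⊨ ZFC := by
  refine ⟨fun σ hσ => ?_⟩
  rcases hσ with (hσ | ⟨n, φ, rfl⟩) | ⟨n, φ, rfl⟩
  · rcases hσ with rfl | rfl | rfl | rfl | rfl | rfl | rfl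
    exacts [realize_extensionality, realize_foundation, realize_pairing, realize_union,
      realize_powerSet, realize_infinity, realize_choice]
  · exact realize_separation φ
  · exact realize_replacement h φ

end

section

variable {δ : Ordinal.{u}}

section nice

variable [hδ : Nice δ]

/-! ### From extendible cardinals to the Vopěnka scheme -/

/-- For every definable `A` there is an extendible cardinal for `A`. -/
def HasExtendibles (δ : Ordinal.{u}) : Prop :=
  ∀ A : Set ZFSet.{u}, DefinableIn δ A → ∃ κ : Ordinal.{u}, IsExtendibleBelow δ A κ

/-- There are maps respecting a definable predicate with large critical points and large domains. -/
theorem HasExtendibles.exists_bMap (h : HasExtendibles δ) (B : VModel δ → Prop) [Def₁ B]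
    {ρ : Ordinal.{u}} (hρ : ρ < δ) : ∃ κ < δ, ρ < κ ∧ ∀ β < δ, ∃ γ J,
      Order.IsSuccLimit γ ∧ Ordinal.omega0 < γ ∧ γ < δ ∧ β < γ ∧ BMap (join Base B) γ J ∧
        (∀ x : VModel δ, x.rk < κ → J x = x) ∧
        ∀ x : VModel δ, κ ≤ x.rk → x.rk < γ → γ < (J x).rk := by
  obtain ⟨κ, hκ⟩ := h _ (definableIn_toSet (join (join Base B) (single (ord ρ))))
  have hκδ := hκ.1
  have hJ : ∀ β < δ, ∃ γ J, Order.IsSuccLimit γ ∧ Ordinal.omega0 < γ ∧ γ < δ ∧ β < γ ∧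
      ρ + Ordinal.omega0 + Ordinal.omega0 < γ ∧ κ < γ ∧
      BMap (join (join Base B) (single (ord ρ))) γ J ∧ (∀ a < κ, J (ord a) = ord a) ∧
      γ < (J (ord κ)).rk := by
    intro β hβ
    -- The domain of height γ = μ + ω lies above β, above κ, and above ρ + ω + ω, as Kunen's theorem
    -- at ρ requires.
    set μ := max (max β κ) (ρ + Ordinal.omega0 + Ordinal.omega0)
    have hμ : μ < δ := max_lt (max_lt hβ hκδ) (add_omega_lt (add_omega_lt hρ))
    have h1 := (isLeast_add_omega μ).1.2
    have h2 : max β κ < μ + Ordinal.omega0 := (le_max_left _ _).trans_lt h1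
    have h3 : ρ + Ordinal.omega0 + Ordinal.omega0 < μ + Ordinal.omega0 :=
      (le_max_right _ _).trans_lt h1
    have hκγ := (le_max_right _ _).trans_lt h2
    obtain ⟨J, hJ, hfix, hlt, -⟩ := hκ.exists_bMap hκγ (add_omega_lt hμ) (isSuccLimit_add_omega μ)
    exact ⟨_, J, isSuccLimit_add_omega μ, le_add_self.trans_lt h3, add_omega_lt hμ,
      (le_max_left _ _).trans_lt h2, h3, hκγ, hJ, hfix, hlt⟩
  have hρκ : ρ < κ := by
    -- If κ ≤ ρ, then ρ would be moved; but ρ is fixed, its singleton being part of the predicate.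
    by_contra hle
    obtain ⟨γ, J, hγ, -, -, -, hργ, hκγ, hJ, -, hlt⟩ := hJ 0 Nice.pos
    have hρr : (ord ρ : VModel δ).rk < γ := by
      rw [rk_ord hρ]
      exact (isLeast_add_omega _).1.2.trans ((isLeast_add_omega _).1.2.trans hργ)
    refine ((hJ.left hγ).left hγ).ord_ne hγ (fun he => ?_) (not_lt.1 hle) hρ hργ
      ((hJ.right hγ).single_eq hρr)
    rw [he, rk_ord hκδ] at hlt
    exact hκγ.not_gt hlt
  refine ⟨κ, hκδ, hρκ, fun β hβ => ?_⟩
  obtain ⟨γ, J, hγ, hω, hγδ, hβγ, -, hκγ, hJ, hfix, hlt⟩ := hJ β hβ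
  have hB := hJ.left hγ
  refine ⟨γ, J, hγ, hω, hγδ, hβγ, hB, fun x hx => ?_, fun x hx hxγ => ?_⟩
  · exact (hB.left hγ).fix_of_ord hγ (hx.trans hκγ) (fun a ha => hfix a (ha.trans_lt hx)) x le_rfl
  · rcases hx.eq_or_lt with he | hκx
    · have := (hB.left hγ).ord_rk hγ hxγ
      rw [← he] at this
      rwa [this, rk_ord (J x).rk_lt] at hlt
    · have h1 := (hB.left hγ).ord_lt hγ hκx hxγ x.rk_lt
      rw [(hB.left hγ).ord_rk hγ hxγ, rk_ord (J x).rk_lt] at h1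
      exact hlt.trans h1

/-- Take κ above the rank of `a`. If x ∈ a is related to y, then x is fixed, so by uniqueness y is
fixed too. Sets of rank at least κ are moved, so all values lie in V_κ. -/
theorem HasExtendibles.hasReplacement (h : HasExtendibles δ) : HasReplacement δ := by
  intro Q _ a ha
  set Q' : VModel δ → VModel δ → Prop := fun x y => x ∈ a ∧ Holds₂ Q x y
  have : Def₂ Q' := ⟨inferInstance⟩
  obtain ⟨κ, hκ, haκ, hex⟩ := h.exists_bMap (un₂ Q') a.rk_lt
  obtain ⟨b, -, hb⟩ := VModel.exists_set (fun y => ∃ x ∈ a, Q x y) hκ (by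
    rintro y ⟨x, hx, hQ⟩
    by_contra hle
    obtain ⟨γ, J, hγ, -, -, hlt, hJ, hfix, hmove⟩ := hex _ (max_lt y.rk_lt a.rk_lt)
    have hyγ := (le_max_left _ _).trans_lt hlt
    have hxa := VModel.rk_lt_of_mem hx
    have hxγ := hxa.trans ((le_max_right _ _).trans_lt hlt)
    have h1 := ((hJ.right hγ).iff₂ hγ hxγ hyγ).1 ⟨hx, hQ⟩
    rw [hfix x (hxa.trans haκ)] at h1
    have h2 := hmove y (not_lt.1 hle) hyγ
    rw [← ha x hx y _ hQ h1.2] at h2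
    exact h2.not_gt hyγ)
  exact ⟨b, hb⟩

theorem graph_mem {F R : ZFSet.{u}} {M N : CodedStructure F R} {m n : VModel δ}
    (hm : m.1 = M.code) (hn : n.1 = N.code) (j : M.Carrier → N.Carrier) : graph j ∈ V_ δ := by
  obtain ⟨c, fs, rs, hM⟩ := exists_codes M m hm
  obtain ⟨c', fs', rs', hN⟩ := exists_codes N n hn
  obtain ⟨g, -, hg⟩ := VModel.exists_set (fun z => ∃ x : M.Carrier, z = (el x).pr (el (j x)))
    (c.pr c').rk_lt (by
      rintro _ ⟨x, rfl⟩
      rw [rk_pr, rk_pr, Order.succ_lt_succ_iff, Order.succ_lt_succ_iff]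
      exact max_lt_max (VModel.rk_lt_of_mem (hM.el_mem x)) (VModel.rk_lt_of_mem (hN.el_mem (j x))))
  have hval : ∀ x : M.Carrier, ((el x).pr (el (j x)) : VModel δ).1 = pair x.1 (j x).1 := fun x => by
    rw [VModel.pr_val, hM.el_val, hN.el_val]
  have : g.1 = graph j := by
    ext z
    refine Iff.trans ?_ (ZFSet.mem_range (f := fun x : M.carrier => pair x.1 (j x).1)).symm
    constructor
    · intro hz
      obtain ⟨z, hz, rfl⟩ := VModel.exists_val hz
      obtain ⟨x, rfl⟩ := (hg z).1 hz
      exact ⟨x, (hval x).symm⟩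
    · rintro ⟨x, rfl⟩
      exact hval x ▸ VModel.mem_def.1 ((hg _).2 ⟨x, rfl⟩)
  rw [← this]
  exact g.2

/-- A proper class has a member `m` of rank at least κ. A map respecting the class sends `m` to
another member, of larger rank, and is elementary on the structure coded by `m`. -/
theorem HasExtendibles.satisfiesVopenkaScheme (h : HasExtendibles δ) :
    SatisfiesVopenkaScheme δ := by
  intro F hF R hR 𝓜 hd hcode hproper
  set P : VModel δ → Prop := fun x => x.1 ∈ 𝓜
  have : Def₁ P := hd.def₁
  -- Taking κ above the ranks of `F` and `R` makes `J` fix all symbols of the language.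
  obtain ⟨κ, hκ, hρκ, hex⟩ := h.exists_bMap P
    (max_lt (mem_vonNeumann.1 hF) (mem_vonNeumann.1 hR))
  obtain ⟨m, hm, hmκ⟩ : ∃ m : VModel δ, P m ∧ κ ≤ m.rk := by
    by_contra hcon
    push Not at hcon
    obtain ⟨b, -, hb⟩ := VModel.exists_set P hκ hcon
    refine hproper ⟨b.1, b.2, fun z => ⟨fun hz => ?_, fun hz => ?_⟩⟩
    · obtain ⟨z, hz, rfl⟩ := VModel.exists_val hz
      exact (hb z).1 hz
    · exact (hb (VModel.of z (hd.1 z hz))).2 hz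
  obtain ⟨γ, J, hγ, hω, hγδ, hmγ, hJ, hfix, hmove⟩ := hex _ m.rk_lt
  have hJm : P (J m) := ((hJ.right hγ).iff m hmγ).1 hm
  obtain ⟨M, hM⟩ := hcode _ hm
  obtain ⟨N, hN⟩ := hcode _ hJm
  have hsymb : ∀ S : ZFSet.{u}, S.rank < κ → ∀ n s, symb s n ∈ S →
      ∃ σ : VModel δ, σ.1 = symb s n ∧ σ.rk < γ ∧ J σ = σ := by
    intro S hS n s hs
    have h1 := (rank_lt_of_mem hs).trans hS
    have h2 : (VModel.of (symb s n) (mem_vonNeumann.2 (h1.trans hκ))).rk < κ := h1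
    exact ⟨VModel.of _ (mem_vonNeumann.2 (h1.trans hκ)), rfl, h2.trans (hmκ.trans_lt hmγ),
      hfix _ h2⟩
  obtain ⟨j, -⟩ := (hJ.left hγ).exists_elementaryEmbedding hγ hω hγδ.le hM.symm hmγ hN.symm
    (hsymb F ((le_max_left _ _).trans_lt hρκ)) (hsymb R ((le_max_right _ _).trans_lt hρκ))
  -- The structures differ because J(m) has rank above γ and `m` has rank below γ.
  refine ⟨M, N, hM ▸ hm, hN ▸ hJm, fun he => ?_, j, graph_mem hM.symm hN.symm j⟩
  have h1 := hmove m hmκ hmγ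
  have h2 : J m = m := VModel.val_inj.2 (by rw [← hM, ← hN, he])
  rw [h2] at h1
  exact h1.not_gt hmγ

end nice

/-! ### The case `δ = ω` -/

/-- An inductive set has elements of arbitrarily large finite rank, so it has infinite rank itself.
-/
theorem ne_omega_of_models (h : VModel δ ⊨ infinity) : δ ≠ Ordinal.omega0 := by
  rintro rfl
  simp only [infinity, Sentence.Realize, Formula.Realize, BoundedFormula.realize_all,
    BoundedFormula.realize_ex, BoundedFormula.realize_iff, BoundedFormula.realize_imp,
    BoundedFormula.realize_inf, BoundedFormula.realize_sup, BoundedFormula.realize_not,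
    BoundedFormula.realize_bdEqual, realize_memF, Term.realize_var, Sum.elim_inr,
    Function.comp] at h
  obtain ⟨w, ⟨e, hew, -⟩, hsuc⟩ := h
  have key : ∀ n : ℕ, ∃ x : VModel Ordinal.omega0, x ∈ w ∧ (n : Ordinal.{u}) ≤ x.rk := by
    intro n
    induction n with
    | zero => exact ⟨e, hew, by simp⟩
    | succ n ih =>
      obtain ⟨x, hx, hn⟩ := ih
      obtain ⟨y, hy, hxy⟩ := hsuc x hx
      refine ⟨y, hy, ?_⟩
      rw [Nat.cast_succ, ← Order.succ_eq_add_one, Order.succ_le_iff]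
      exact hn.trans_lt (VModel.rk_lt_of_mem ((hxy x).2 (Or.inr rfl)))
  obtain ⟨n, hn⟩ := Ordinal.lt_omega0.1 w.rk_lt
  obtain ⟨x, hx, hle⟩ := key n
  exact (hle.trans_lt (VModel.rk_lt_of_mem hx)).ne' hn

theorem finite_vonNeumann (n : ℕ) : {x | x ∈ V_ (n : Ordinal.{u})}.Finite := by
  induction n with
  | zero => simp
  | succ n ih =>
    rw [Nat.cast_succ, vonNeumann_add_one]
    refine (ih.finite_subsets.preimage (f := fun x : ZFSet.{u} => {z | z ∈ x}) ?_).subset ?_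
    · intro x _ y _ he
      exact ZFSet.ext fun z => Set.ext_iff.1 he z
    · intro x hx z hz
      exact ZFSet.mem_powerset.1 hx hz

/-- Each V_n is finite, and a strictly larger V_θ satisfies the first-order sentence asserting one
more element than V_n has. -/
theorem HasEmbeddings.ne_omega (h : HasEmbeddings δ) : δ ≠ Ordinal.omega0 := by
  rintro rfl
  obtain ⟨μ, hμ, hj⟩ := h ∅ ⟨fun x hx => hx.elim, by
    simp only [Set.mem_empty_iff_false]
    exact Set.definable_empty⟩
  obtain ⟨θ, hμθ, -, ⟨j⟩⟩ := hj μ le_rfl hμ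
  obtain ⟨n, rfl⟩ := Ordinal.lt_omega0.1 hμ
  have : Finite (VPred ∅ (n : Ordinal.{u})) := (finite_vonNeumann n).to_subtype
  set k := Nat.card (VPred ∅ (n : Ordinal.{u}))
  have hk : Cardinal.mk (VPred ∅ (n : Ordinal.{u})) = k := Nat.cast_card.symm
  let f : Option (VPred ∅ (n : Ordinal.{u})) → VPred ∅ θ := fun o =>
    o.elim ⟨V_ (n : Ordinal.{u}), vonNeumann_mem_of_lt hμθ⟩
      fun x => ⟨x.1, vonNeumann_subset_of_le hμθ.le x.2⟩
  have hf : Function.Injective f := by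
    rintro (_ | x) (_ | y) he
    · rfl
    · exact (mem_irrefl _ ((congrArg Subtype.val he : V_ (n : Ordinal.{u}) = y.1) ▸ y.2)).elim
    · exact (mem_irrefl _ ((congrArg Subtype.val he : x.1 = V_ (n : Ordinal.{u})) ▸ x.2)).elim
    · have h1 : (f (some x)).1 = (f (some y)).1 := congrArg Subtype.val he
      exact congrArg some (VPred.val_inj.2 h1)
  have h1 := Cardinal.mk_le_of_injective hf
  rw [Cardinal.mk_option, hk] at h1
  have h2 : VPred ∅ θ ⊨ Sentence.cardGe setPredLang (k + 1) :=
    (Sentence.realize_cardGe _ _).2 (by exact_mod_cast h1)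
  have h3 := (Sentence.realize_cardGe _ _).1
    ((j.elementarilyEquivalent.realize_sentence _).2 h2)
  rw [hk] at h3
  exact absurd (Nat.cast_le.1 h3) (by omega)

/-! ### The equivalence -/

theorem nice_ord {δ : Cardinal.{u}} (hδ : Cardinal.aleph0 ≤ δ) (h : δ.ord ≠ Ordinal.omega0) :
    Nice δ.ord where
  omega_lt := by
    refine lt_of_le_of_ne ?_ h.symm
    rw [← Cardinal.ord_aleph0]
    exact Cardinal.ord_le_ord.2 hδ
  add_lt a ha b hb := Ordinal.isPrincipal_add_ord hδ ha hb

/-- Since α ∈ j(κ) ∈ V_θ, the target is strictly higher. Only that δ is a limit is needed, so this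
can be used to exclude δ = ω before `Nice δ` is known. -/
theorem HasExtendibles.hasEmbeddings (hδ : Order.IsSuccLimit δ) (h : HasExtendibles δ) :
    HasEmbeddings δ := by
  intro A hA
  obtain ⟨κ, hκ, -, hκA⟩ := h A hA
  refine ⟨Order.succ κ, hδ.succ_lt hκ, fun α hα hαδ => ?_⟩
  obtain ⟨θ, hθ, j, -, hlt⟩ := hκA α (Order.succ_le_iff.1 hα) hαδ
  refine ⟨θ, ?_, hθ, ⟨j⟩⟩
  have := rank_lt_of_mem hlt
  rw [Ordinal.rank_toZFSet] at this
  exact this.trans (mem_vonNeumann.1 (j (ordElem A (Order.succ_le_iff.1 hα))).2)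

theorem hasExtendibles_of_stationary (h : ∀ A : Set ZFSet.{u}, DefinableIn δ A →
    DefinablyStationary δ {κ : Ordinal.{u} | IsExtendibleBelow δ A κ}) : HasExtendibles δ := by
  intro A hA
  have hO : Def₁ (IsOrd : VModel δ → Prop) := ⟨by simp only [isOrd_iff]; infer_instance⟩
  have hO' : DefinableIn δ ((fun α : Set.Iio δ => α.1.toZFSet) '' Set.univ) := by
    convert definableIn_toSet (IsOrd : VModel δ → Prop) using 1
    ext z
    constructor
    · rintro ⟨α, -, rfl⟩
      have hα : α.1.toZFSet ∈ V_ δ := by rw [mem_vonNeumann, Ordinal.rank_toZFSet]; exact α.2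
      exact ⟨VModel.of _ hα, rfl,
        isOrdinal_toZFSet α.1⟩
    · rintro ⟨x, rfl, hx⟩
      exact ⟨⟨x.rk, x.rk_lt⟩, trivial, IsOrdinal.toZFSet_rank_eq hx⟩
  -- The set of all ordinals below δ is a definable club.
  obtain ⟨κ, -, hκ⟩ := h A hA Set.univ IsClub.univ hO'
  exact ⟨_, hκ⟩

end

end VopenkaScheme
end

open VopenkaScheme FirstOrder in
theorem theorem2p4 (δ : Cardinal.{u}) (hδ : Cardinal.aleph0 ≤ δ) :
    List.TFAE [
      IsVopenkaSchemeCardinal δ,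
      ∀ A : Set ZFSet.{u}, DefinableIn δ.ord A →
        ∃ μ < δ.ord, ∀ α : Ordinal.{u}, μ ≤ α → α < δ.ord →
          ∃ θ : Ordinal.{u}, α < θ ∧ θ < δ.ord ∧
            Nonempty (VPred A α ↪ₑ[setPredLang] VPred A θ),
      ∀ A : Set ZFSet.{u}, DefinableIn δ.ord A →
        ∃ κ : Ordinal.{u}, IsExtendibleBelow δ.ord A κ,
      ∀ A : Set ZFSet.{u}, DefinableIn δ.ord A →
        DefinablyStationary δ.ord {κ : Ordinal.{u} | IsExtendibleBelow δ.ord A κ}] := by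
  have hlim : Order.IsSuccLimit δ.ord := Cardinal.isSuccLimit_ord hδ
  tfae_have 1 → 2 := by
    rintro ⟨hZ, hV⟩
    -- As in the next three implications, the case δ = ω is excluded first, which gives `Nice
    -- δ.ord`.
    have := nice_ord hδ (ne_omega_of_models (hZ.realize_of_mem _
      (Or.inl (Or.inl (by simp)))))
    exact fun A hA => exists_embedding_of_vopenka hV hA
  tfae_have 2 → 3 := by
    intro h
    have := nice_ord hδ (HasEmbeddings.ne_omega h)
    exact fun A hA => HasEmbeddings.exists_isExtendibleBelow h hA
  tfae_have 3 → 1 := by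
    intro h
    have := nice_ord hδ (HasExtendibles.hasEmbeddings hlim h).ne_omega
    exact ⟨models_ZFC (HasExtendibles.hasReplacement h),
      HasExtendibles.satisfiesVopenkaScheme h⟩
  tfae_have 3 → 4 := by
    intro h
    have := nice_ord hδ (HasExtendibles.hasEmbeddings hlim h).ne_omega
    exact fun A hA => definablyStationary_of_exists h hA
  tfae_have 4 → 3 := hasExtendibles_of_stationary
  tfae_finish
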